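/- \textbf{Conventions.} Manifolds are smooth, finite-dimensional, Hausdorff and second countable; submanifolds may be immersed. Let $\mathfrak g$ be a finite-dimensional real Lie algebra and $t\in (S^2\mathfrak g)^{\mathfrak g}$, with associated map $t^\sharp:\mathfrak g^*\to\mathfrak g$, $t^\sharp\alpha=t(\alpha,\cdot)$, and let $\phi\in\bigwedge^3\mathfrak g$ be $\phi(\alpha,\beta,\gamma)=\frac14\langle[t^\sharp\alpha,t^\sharp\beta],\gamma\rangle$. An action of $\mathfrak g$ on $M$ is a Lie algebra homomorphism $\rho$ from $\mathfrak g$ to the vector fields on $M$. For a subspace $\mathfrak h\subset\mathfrak g$, the $\mathfrak h$-orbit of a point is the set of points reached from it along finitely many integral curves of the fields $\rho(v)$, $v\in\mathfrak h$; an orbit is regarded as an immersed submanifold with tangent spaces $\rho(\mathfrak h)_x$. The action is transitive on $M$ if $M$ is a single $\mathfrak g$-orbit. We say that $X/\mathfrak h$ is a manifold $B$ if there is a surjective submersion $X\to B$ whose fibres are the $\mathfrak h$-orbits in $X$. A $\mathfrak g$-quasi-Poisson structure on $M$ consists of an action $\rho$ of $\mathfrak g$ and a $\mathfrak g$-invariant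 bivector field $\pi$ with $\frac12[\pi,\pi]=\rho^{\otimes3}(\phi)$ (Schouten bracket, normalized by $\frac12[\pi,\pi](df,dk,dl)=\{f,\{k,l\}\}+\text{cyclic}$, where $\{f,k\}=\pi(df,dk)$). A quasi-Poisson map is a smooth equivariant map $F$ with $F_*\pi_M=\pi_{M'}$. Put $\sigma=\pi+\frac12\rho^{\otimes2}(t)$ and $T^{big}M=\{\rho(v)+\pi(\alpha,\cdot)\}\subset TM$. The structure is quasi-Poisson-commutative if $\sigma=0$. For $\mathfrak c\subset\mathfrak g$ put $\mathfrak c^\perp=t^\sharp(\operatorname{Ann}\mathfrak c)$. A Lie subalgebra $\mathfrak c$ is coisotropic if $t$ vanishes on $\operatorname{Ann}\mathfrak c\times\operatorname{Ann}\mathfrak c$; then $\mathfrak c^\perp$ is an ideal of $\mathfrak c$ and $t$ descends to an invariant $t'\in S^2(\mathfrak c/\mathfrak c^\perp)$, which is used for $\mathfrak c/\mathfrak c^\perp$-quasi-Poisson structures. If $t$ is non-degenerate, $\mathfrak c$ is Lagrangian if $\mathfrak c^\perp=\mathfrak c$. A \emph{central pair} $N_L\xleftarrow{\mu_L}M\xrightarrow{\mu_R}N_R$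 consists of a $\mathfrak g$-quasi-Poisson manifold $M$, $\mathfrak g$-quasi-Poisson-commutative manifolds $N_L,N_R$, and smooth $\mathfrak g$-equivariant maps with $\sigma(d(f\circ\mu_L),\cdot)=0$ for all $f\in C^\infty(N_L)$ and $\sigma(\cdot,d(f\circ\mu_R))=0$ for all $f\in C^\infty(N_R)$. It is \emph{split-symplectic} if $t$ is non-degenerate, $T^{big}M=TM$, and the actions of $\mathfrak g$ on $N_L$ and $N_R$ are transitive with Lagrangian stabilizers. \textbf{Theorem (Split-symplectic central reduction 2).} Let $N_L\xleftarrow{\mu_L}M\xrightarrow{\mu_R}N_R$ be a split-symplectic central pair over $(\mathfrak g,t)$, let $\mathfrak c\subset\mathfrak g$ be a coisotropic Lie subalgebra, and let $\mathcal O_L\subset N_L$ and $\mathcal O_R\subset N_R$ be $\mathfrak c$-orbits. Suppose that $\mu_L\times\mu_R:M\to N_L\times N_R$ is transverse to $\mathcal O_L\times\mathcal O_R$ and that $M/\mathfrak c^\perp$, $\mathcal O_L/\mathfrak c^\perp$ and $\mathcal O_R/\mathfrak c^\perp$ are manifolds. Then $M/\mathfrak c^\perp$ carries a $\mathfrak c/\mathfrak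 c^\perp$-quasi-Poisson structure whose action is induced by that of $\mathfrak c$ on $M$ and whose bivector field is pushed forward from $M$; $$M':=\bigl(\mu_L^{-1}(\mathcal O_L)\cap\mu_R^{-1}(\mathcal O_R)\bigr)/\mathfrak c^\perp\subset M/\mathfrak c^\perp$$ is a manifold and a $\mathfrak c/\mathfrak c^\perp$-quasi-Poisson submanifold of it, i.e.\ an immersed submanifold (embedded, if $\mathcal O_L$ and $\mathcal O_R$ are embedded) with a $\mathfrak c/\mathfrak c^\perp$-quasi-Poisson structure for which the inclusion is a quasi-Poisson map; $\mathcal O_L/\mathfrak c^\perp$ and $\mathcal O_R/\mathfrak c^\perp$ carry quasi-Poisson-commutative $\mathfrak c/\mathfrak c^\perp$-structures with the actions induced by those of $\mathfrak c$ on $\mathcal O_L$ and $\mathcal O_R$; and, with the maps induced by $\mu_L$ and $\mu_R$, $$\mathcal O_L/\mathfrak c^\perp\longleftarrow M'\longrightarrow\mathcal O_R/\mathfrak c^\perp$$ is a split-symplectic central pair over $(\mathfrak c/\mathfrak c^\perp,t')$. -/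

import Mathlib

open scoped Manifold ContDiff

universe u v

noncomputable section

namespace QuasiPoisson


/-! ## Invariant symmetric tensors on a Lie algebra -/

section Algebra

variable {g : Type*} [LieRing g] [LieAlgebra ℝ g]

/-- An element `t ∈ (S²g)^g` of a finite-dimensional real Lie algebra `g`, given by the map
`t♯ : g* → g`, `t♯ α = t(α, ·)`.  Symmetry is `t(α, β) = t(β, α)`; invariance is
`(ad u ⊗ 1 + 1 ⊗ ad u) t = 0`, contracted with `α` in the first slot. -/
structure InvTensor (g : Type*) [LieRing g] [LieAlgebra ℝ g] where
  sharp : Module.Dual ℝ g →ₗ[ℝ] g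
  symm : ∀ α β : Module.Dual ℝ g, β (sharp α) = α (sharp β)
  invariant : ∀ (u : g) (α : Module.Dual ℝ g),
    ⁅u, sharp α⁆ + sharp (α ∘ₗ (LieAlgebra.ad ℝ g u : g →ₗ[ℝ] g)) = 0

/-- `t` is non-degenerate. -/
def InvTensor.Nondegenerate (t : InvTensor g) : Prop := Function.Bijective t.sharp

/-- The element `φ = -[t¹², t²³]/4 ∈ ⋀³g`:  `φ(α, β, γ) = ⟨[t♯α, t♯β], γ⟩ / 4`. -/
def InvTensor.phi (t : InvTensor g) (α β γ : Module.Dual ℝ g) : ℝ :=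
  (1 / 4) * γ ⁅t.sharp α, t.sharp β⁆

/-- `c^⊥ = t(Ann c, ·) ⊆ g`. -/
def InvTensor.perp (t : InvTensor g) (c : Submodule ℝ g) : Submodule ℝ g :=
  c.dualAnnihilator.map t.sharp

/-- `c` is coisotropic: the image of `t` in `S²(g/c)` vanishes. -/
def InvTensor.IsCoisotropic (t : InvTensor g) (c : Submodule ℝ g) : Prop :=
  ∀ α ∈ c.dualAnnihilator, ∀ β ∈ c.dualAnnihilator, β (t.sharp α) = 0

/-- `c` is Lagrangian: `c^⊥ = c` (used for non-degenerate `t`). -/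
def InvTensor.IsLagrangian (t : InvTensor g) (c : Submodule ℝ g) : Prop :=
  t.perp c = c

/-- `c^⊥ ∩ c` as an ideal of `c`; for coisotropic `c` this is `c^⊥` itself
(see `perp_le_of_isCoisotropic`). -/
def InvTensor.perpIdeal (t : InvTensor g) (c : LieSubalgebra ℝ g) : LieIdeal ℝ c where
  toSubmodule := (t.perp c.toSubmodule).comap c.toSubmodule.subtype
  lie_mem := by
    rintro ⟨v, hv⟩ ⟨w, hw⟩ h
    obtain ⟨α, hα, hαw⟩ := h
    refine ⟨-(α ∘ₗ (LieAlgebra.ad ℝ g v : g →ₗ[ℝ] g)), ?_, ?_⟩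
    · rw [SetLike.mem_coe, Submodule.mem_dualAnnihilator]
      intro x hx
      have h1 := (Submodule.mem_dualAnnihilator α).1 hα ⁅v, x⁆ (c.lie_mem hv hx)
      simpa using h1
    · have h2 := t.invariant v α
      have h3 : t.sharp α = w := hαw
      rw [h3] at h2
      rw [map_neg]
      exact (eq_neg_of_add_eq_zero_left h2).symm

theorem InvTensor.perp_le_of_isCoisotropic (t : InvTensor g) {c : LieSubalgebra ℝ g}
    (hc : t.IsCoisotropic c.toSubmodule) : t.perp c.toSubmodule ≤ c.toSubmodule := by
  rintro _ ⟨α, hα, rfl⟩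
  rw [← Subspace.forall_mem_dualAnnihilator_apply_eq_zero_iff]
  intro β hβ
  exact hc α hα β hβ

/-- A covector killing `c^⊥` is sent by `t♯` into `c`. -/
theorem InvTensor.sharp_mem (t : InvTensor g) (c : LieSubalgebra ℝ g) {α : Module.Dual ℝ g}
    (hα : ∀ w ∈ t.perp c.toSubmodule, α w = 0) : t.sharp α ∈ c := by
  change t.sharp α ∈ c.toSubmodule
  rw [← Subspace.forall_mem_dualAnnihilator_apply_eq_zero_iff]
  intro β hβ
  rw [t.symm]
  exact hα _ ⟨β, hβ, rfl⟩

/-- The Lie algebra `c / c^⊥`. -/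
abbrev InvTensor.RedAlg (t : InvTensor g) (c : LieSubalgebra ℝ g) : Type _ :=
  c ⧸ t.perpIdeal c

/-- The projection `c → c / c^⊥`. -/
def InvTensor.redMk (t : InvTensor g) (c : LieSubalgebra ℝ g) : c →ₗ[ℝ] t.RedAlg c :=
  (LieSubmodule.Quotient.mk' (t.perpIdeal c) : c →ₗ[ℝ] t.RedAlg c)

theorem InvTensor.redMk_eq_zero (t : InvTensor g) (c : LieSubalgebra ℝ g) (u : c) :
    t.redMk c u = 0 ↔ (u : g) ∈ t.perp c.toSubmodule :=
  LieSubmodule.Quotient.mk_eq_zero' (N := t.perpIdeal c)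

theorem InvTensor.redMk_surjective (t : InvTensor g) (c : LieSubalgebra ℝ g) :
    Function.Surjective (t.redMk c) :=
  LieSubmodule.Quotient.surjective_mk' (t.perpIdeal c)

theorem InvTensor.redMk_lie (t : InvTensor g) (c : LieSubalgebra ℝ g) (u v : c) :
    t.redMk c ⁅u, v⁆ = ⁅t.redMk c u, t.redMk c v⁆ :=
  rfl

/-- A linear projection of `g` onto `c`, used to extend linear forms from `c` to `g`. -/
def retract (c : LieSubalgebra ℝ g) : g →ₗ[ℝ] c :=
  (LinearMap.exists_leftInverse_of_injective c.toSubmodule.subtype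
    (Submodule.ker_subtype _)).choose

theorem retract_apply (c : LieSubalgebra ℝ g) (u : c) : retract c (u : g) = u :=
  LinearMap.congr_fun (LinearMap.exists_leftInverse_of_injective c.toSubmodule.subtype
    (Submodule.ker_subtype _)).choose_spec u

/-- The extension to `g` of a linear form on `c / c^⊥`. -/
def InvTensor.ext (t : InvTensor g) (c : LieSubalgebra ℝ g) :
    Module.Dual ℝ (t.RedAlg c) →ₗ[ℝ] Module.Dual ℝ g :=
  LinearMap.lcomp ℝ ℝ (t.redMk c ∘ₗ retract c)

theorem InvTensor.ext_apply (t : InvTensor g) (c : LieSubalgebra ℝ g)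
    (ξ : Module.Dual ℝ (t.RedAlg c)) (u : c) : t.ext c ξ (u : g) = ξ (t.redMk c u) := by
  simp [InvTensor.ext, retract_apply]

theorem InvTensor.sharp_mem_of_ext (t : InvTensor g) (c : LieSubalgebra ℝ g)
    (hc : t.IsCoisotropic c.toSubmodule) (ξ : Module.Dual ℝ (t.RedAlg c)) (α : Module.Dual ℝ g)
    (hα : ∀ u : c, α (u : g) = ξ (t.redMk c u)) : t.sharp α ∈ c := by
  refine t.sharp_mem c fun w hw => ?_
  have h := hα ⟨w, t.perp_le_of_isCoisotropic hc hw⟩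
  rw [(t.redMk_eq_zero c _).2 hw, map_zero] at h
  exact h

/-- The map `t'♯ : (c/c^⊥)* → c/c^⊥` to which `t♯` descends: extend a linear form to `g`, apply
`t♯` (the result lies in `c`) and project.  By `redSharp_apply` the choice of the extension is
irrelevant. -/
def InvTensor.redSharp (t : InvTensor g) (c : LieSubalgebra ℝ g)
    (hc : t.IsCoisotropic c.toSubmodule) :
    Module.Dual ℝ (t.RedAlg c) →ₗ[ℝ] t.RedAlg c :=
  t.redMk c ∘ₗ LinearMap.codRestrict c.toSubmodule (t.sharp ∘ₗ t.ext c)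
    (fun ξ => t.sharp_mem_of_ext c hc ξ _ (t.ext_apply c ξ))

theorem InvTensor.redSharp_apply (t : InvTensor g) (c : LieSubalgebra ℝ g)
    (hc : t.IsCoisotropic c.toSubmodule) (ξ : Module.Dual ℝ (t.RedAlg c)) (α : Module.Dual ℝ g)
    (hα : ∀ u : c, α (u : g) = ξ (t.redMk c u)) :
    t.redSharp c hc ξ = t.redMk c ⟨t.sharp α, t.sharp_mem_of_ext c hc ξ α hα⟩ := by
  refine eq_of_sub_eq_zero ?_
  change t.redMk c _ - _ = 0
  rw [← map_sub, t.redMk_eq_zero]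
  refine ⟨t.ext c ξ - α, ?_, ?_⟩
  · rw [SetLike.mem_coe, Submodule.mem_dualAnnihilator]
    intro x hx
    have h1 := t.ext_apply c ξ ⟨x, hx⟩
    have h2 := hα ⟨x, hx⟩
    rw [LinearMap.sub_apply, h1, h2, sub_self]
  · rw [map_sub]
    rfl

/-- The element `t' ∈ S²(c/c^⊥)` to which `t` descends, for coisotropic `c`. -/
def InvTensor.reduced (t : InvTensor g) (c : LieSubalgebra ℝ g)
    (hc : t.IsCoisotropic c.toSubmodule) : InvTensor (t.RedAlg c) where
  sharp := t.redSharp c hc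
  symm ξ η := by
    rw [t.redSharp_apply c hc ξ _ (t.ext_apply c ξ), t.redSharp_apply c hc η _ (t.ext_apply c η),
      ← t.ext_apply c η, ← t.ext_apply c ξ]
    exact t.symm _ _
  invariant u ξ := by
    obtain ⟨v, rfl⟩ := t.redMk_surjective c u
    have hα : ∀ w : c, (t.ext c ξ ∘ₗ (LieAlgebra.ad ℝ g (v : g) : g →ₗ[ℝ] g)) (w : g) =
        (ξ ∘ₗ (LieAlgebra.ad ℝ (t.RedAlg c) (t.redMk c v) :
          t.RedAlg c →ₗ[ℝ] t.RedAlg c)) (t.redMk c w) := by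
      intro w
      have h := t.ext_apply c ξ ⁅v, w⁆
      rw [t.redMk_lie] at h
      simpa using h
    rw [t.redSharp_apply c hc ξ _ (t.ext_apply c ξ), t.redSharp_apply c hc _ _ hα,
      ← t.redMk_lie, ← map_add]
    have h0 : (⁅v, (⟨t.sharp (t.ext c ξ), t.sharp_mem_of_ext c hc ξ _ (t.ext_apply c ξ)⟩ : c)⁆ +
        ⟨t.sharp (t.ext c ξ ∘ₗ (LieAlgebra.ad ℝ g (v : g) : g →ₗ[ℝ] g)),
          t.sharp_mem_of_ext c hc _ _ hα⟩ : c) = 0 := by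
      apply Subtype.ext
      exact t.invariant (v : g) (t.ext c ξ)
    rw [h0, map_zero]

end Algebra

/-! ## Manifolds and maps -/

/-- A smooth manifold: finite-dimensional, without boundary, Hausdorff, second countable. -/
structure Mfd : Type (u + 1) where
  dim : ℕ
  carrier : Type u
  [top : TopologicalSpace carrier]
  [charted : ChartedSpace (EuclideanSpace ℝ (Fin dim)) carrier]
  [smooth : IsManifold (𝓡 dim) ∞ carrier]
  [t2 : T2Space carrier]
  [secondCountable : SecondCountableTopology carrier]

attribute [instance] Mfd.top Mfd.charted Mfd.smooth Mfd.t2 Mfd.secondCountable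

instance : CoeSort Mfd.{u} (Type u) := ⟨Mfd.carrier⟩

/-- The tangent space `T_x M`. -/
abbrev Mfd.T (M : Mfd.{u}) (x : M) : Type := TangentSpace (𝓡 M.dim) x

/-- The cotangent space `T*_x M`. -/
abbrev Mfd.coT (M : Mfd.{u}) (x : M) : Type := M.T x →L[ℝ] ℝ

/-- Smooth maps between manifolds. -/
def Smooth {M N : Mfd.{u}} (F : M → N) : Prop := ContMDiff (𝓡 M.dim) (𝓡 N.dim) ∞ F

/-- Smooth real-valued functions. -/
def SmoothFun {M : Mfd.{u}} (f : M → ℝ) : Prop := ContMDiff (𝓡 M.dim) 𝓘(ℝ, ℝ) ∞ f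

/-- The tangent map `T_x F : T_x M → T_{F x} N`. -/
def tmap {M N : Mfd.{u}} (F : M → N) (x : M) : M.T x →L[ℝ] N.T (F x) :=
  mfderiv (𝓡 M.dim) (𝓡 N.dim) F x

/-- The differential `d_x f ∈ T*_x M` of a real-valued function. -/
def diff {M : Mfd.{u}} (f : M → ℝ) (x : M) : M.coT x := mvfderiv (𝓡 M.dim) f x

/-- Injective immersions: immersed submanifolds. -/
structure IsInjImmersion {M N : Mfd.{u}} (j : M → N) : Prop where
  smooth : Smooth j
  injective : Function.Injective j
  immersion : ∀ x, Function.Injective (tmap j x)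

/-- Surjective submersions. -/
structure IsSurjSubmersion {M N : Mfd.{u}} (q : M → N) : Prop where
  smooth : Smooth q
  surjective : Function.Surjective q
  submersion : ∀ x, Function.Surjective (tmap q x)

/-! ## Actions of Lie algebras, orbits, quotients -/

/-- An action of the Lie algebra `g` on `M`: a Lie algebra homomorphism from `g` to the smooth
vector fields on `M`. -/
structure LieAct (g : Type*) [LieRing g] [LieAlgebra ℝ g] (M : Mfd.{u}) where
  rho : g →ₗ[ℝ] ((x : M) → M.T x)
  smooth : ∀ v, ContMDiff (𝓡 M.dim) (𝓡 M.dim).tangent ∞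
    (fun x => (⟨x, rho v x⟩ : TangentBundle (𝓡 M.dim) M))
  lie : ∀ v w x, rho ⁅v, w⁆ x = VectorField.mlieBracket (𝓡 M.dim) (rho v) (rho w) x

section Actions

variable {g : Type*} [LieRing g] [LieAlgebra ℝ g] {M : Mfd.{u}}

/-- `g → T_x M`, `v ↦ ρ(v)_x`. -/
def LieAct.at (A : LieAct g M) (x : M) : g →ₗ[ℝ] M.T x :=
  (LinearMap.proj x : ((y : M) → M.T y) →ₗ[ℝ] M.T x) ∘ₗ A.rho

/-- The dual map `T*_x M → g*`. -/
def LieAct.coat (A : LieAct g M) (x : M) (α : M.coT x) : Module.Dual ℝ g :=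
  (α : M.T x →ₗ[ℝ] ℝ) ∘ₗ A.at x

/-- The stabilizer of `x` in `g`. -/
def LieAct.stabilizer (A : LieAct g M) (x : M) : Submodule ℝ g := LinearMap.ker (A.at x)

/-- `y` lies on the orbit of `x` under `h ⊆ g`: one gets from `x` to `y` by following finitely many
integral curves of the vector fields `ρ(v)`, `v ∈ h`. (Integral curves need not be defined for all
times; since `h` is a linear subspace, the time can be normalized to `1`, and the relation is
symmetric.) -/
def LieAct.SameOrbit (A : LieAct g M) (h : Submodule ℝ g) : M → M → Prop :=
  Relation.ReflTransGen fun x y => ∃ v ∈ h, ∃ γ : ℝ → M,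
    IsMIntegralCurveOn (I := 𝓡 M.dim) γ (A.rho v) (Set.Icc 0 1) ∧ γ 0 = x ∧ γ 1 = y

/-- `j : O → M` is (the inclusion of) an orbit of `h ⊆ g`, with its structure of an immersed
submanifold of `M` whose tangent spaces are spanned by the vector fields `ρ(v)`, `v ∈ h`. -/
structure LieAct.IsOrbit (A : LieAct g M) (h : Submodule ℝ g) {O : Mfd.{u}} (j : O → M) :
    Prop where
  immersed : IsInjImmersion j
  tangent : ∀ a, LinearMap.range (tmap j a : O.T a →ₗ[ℝ] M.T (j a)) = h.map (A.at (j a))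
  orbit : ∃ x, Set.range j = {y | A.SameOrbit h x y}

/-- The action is transitive: `M` is a single orbit, with `T M` spanned by the action. -/
def LieAct.IsTransitive (A : LieAct g M) : Prop :=
  (∀ x, Function.Surjective (A.at x)) ∧ ∀ x y, A.SameOrbit ⊤ x y

/-- Let `j : X → M` be an immersed submanifold which is a union of `h`-orbits. `p : X → B`
exhibits the manifold `B` as the quotient `X/h`: it is a surjective submersion whose fibres are
the `h`-orbits, the tangent spaces of the fibres being spanned by the vector fields `ρ(v)`,
`v ∈ h`. -/
structure LieAct.IsQuotient (A : LieAct g M) (h : Submodule ℝ g) {X B : Mfd.{u}}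
    (j : X → M) (p : X → B) : Prop where
  surjSubmersion : IsSurjSubmersion p
  fibres : ∀ a b, p a = p b ↔ A.SameOrbit h (j a) (j b)
  tangent : ∀ (a : X) (ξ : X.T a), tmap p a ξ = 0 ↔ tmap j a ξ ∈ h.map (A.at (j a))

/-- `g`-equivariant maps. -/
def Equivariant {N : Mfd.{u}} (A : LieAct g M) (B : LieAct g N) (F : M → N) : Prop :=
  ∀ v x, tmap F x (A.rho v x) = B.rho v (F x)

/-- Let `j : X → M` be an immersed submanifold preserved by the subalgebra `c ⊆ g`, so that the
vector fields `ρ(v)`, `v ∈ c`, restrict to `X`. The map `p : X → B` intertwines the action of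
`c` on `X` with the action of `c/c^⊥` on `B`. -/
def EquivariantRed (t : InvTensor g) (c : LieSubalgebra ℝ g) (A : LieAct g M) {X B : Mfd.{u}}
    (j : X → M) (A' : LieAct (t.RedAlg c) B) (p : X → B) : Prop :=
  ∀ (v : c) (a : X) (ξ : X.T a), tmap j a ξ = A.rho (v : g) (j a) →
    tmap p a ξ = A'.rho (t.redMk c v) (p a)

end Actions

/-! ## Quasi-Poisson manifolds -/

/-- A family of bilinear forms on the cotangent spaces of `M` (an element of `T_xM ⊗ T_xM` for
every `x`). -/
abbrev Bitensor (M : Mfd.{u}) : Type u :=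
  (x : M) → M.coT x →ₗ[ℝ] M.coT x →ₗ[ℝ] ℝ

/-- `{f, k} = π(df, dk)`. -/
def Bitensor.bracket {M : Mfd.{u}} (π : Bitensor M) (f k : M → ℝ) : M → ℝ :=
  fun x => π x (diff f x) (diff k x)

/-- `F_* π = π'`. -/
def PushesForward {M N : Mfd.{u}} (F : M → N) (π : Bitensor M) (π' : Bitensor N) : Prop :=
  ∀ (x : M) (α β : N.coT (F x)), π x (α.comp (tmap F x)) (β.comp (tmap F x)) = π' (F x) α β

/-- A `g`-quasi-Poisson structure on `M`: an action `ρ` of `g` and a smooth `g`-invariant bivector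
field `π` with `[π, π]/2 = ρ^{⊗3}(φ)`.

Smoothness, invariance and the last identity are expressed on differentials of smooth functions.
`([π, π]/2)(df, dk, dl)` is the cyclic sum of `{f, {k, l}}`, for the Schouten bracket that extends
the Lie bracket of vector fields as a graded derivation. -/
structure QPoisson {g : Type*} [LieRing g] [LieAlgebra ℝ g] (t : InvTensor g) (M : Mfd.{u})
    extends LieAct g M where
  pi : Bitensor M
  skew : ∀ x α β, pi x α β = - pi x β α
  smooth_pi : ∀ f k : M → ℝ, SmoothFun f → SmoothFun k → SmoothFun (pi.bracket f k)
  invariant : ∀ (v : g) (f k : M → ℝ), SmoothFun f → SmoothFun k → ∀ x,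
    diff (pi.bracket f k) x (rho v x) =
      pi.bracket (fun y => diff f y (rho v y)) k x + pi.bracket f (fun y => diff k y (rho v y)) x
  jacobi : ∀ f k l : M → ℝ, SmoothFun f → SmoothFun k → SmoothFun l → ∀ x,
    pi.bracket f (pi.bracket k l) x + pi.bracket k (pi.bracket l f) x
        + pi.bracket l (pi.bracket f k) x =
      t.phi (toLieAct.coat x (diff f x)) (toLieAct.coat x (diff k x)) (toLieAct.coat x (diff l x))

section QuasiPoisson

variable {g : Type*} [LieRing g] [LieAlgebra ℝ g] {t : InvTensor g} {M N : Mfd.{u}}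

/-- `σ = π + ρ^{⊗2}(t)/2`. -/
def QPoisson.sigma (P : QPoisson t M) (x : M) (α β : M.coT x) : ℝ :=
  P.pi x α β + (1 / 2) * P.coat x β (t.sharp (P.coat x α))

/-- Quasi-Poisson-commutative manifolds. -/
def QPoisson.IsCommutative (P : QPoisson t M) : Prop := ∀ x α β, P.sigma x α β = 0

/-- `f` is left-central: `σ(df, ·) = 0`. -/
def QPoisson.LeftCentral (P : QPoisson t M) (f : M → ℝ) : Prop :=
  ∀ x β, P.sigma x (diff f x) β = 0

/-- `f` is right-central: `σ(·, df) = 0`. -/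
def QPoisson.RightCentral (P : QPoisson t M) (f : M → ℝ) : Prop :=
  ∀ x β, P.sigma x β (diff f x) = 0

/-- `T^{big} M = T M`, where `T^{big} M` consists of the vectors `ρ(v) + π(α, ·)`. -/
def QPoisson.BigTangentEqTop (P : QPoisson t M) : Prop :=
  ∀ (x : M) (ξ : M.T x), ∃ (v : g) (α : M.coT x),
    ∀ β : M.coT x, β ξ = β (P.rho v x) + P.pi x α β

/-- Quasi-Poisson maps: smooth, equivariant, with `F_* π_M = π_N`. -/
structure IsQPMap (P : QPoisson t M) (P' : QPoisson t N) (F : M → N) : Prop where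
  smooth : Smooth F
  equivariant : Equivariant P.toLieAct P'.toLieAct F
  pushforward : PushesForward F P.pi P'.pi

/-- `N_L ←μL- M -μR→ N_R` is a central pair: `M` is quasi-Poisson, `N_L` and `N_R` are
quasi-Poisson-commutative, `μL` is a left-central map and `μR` is a right-central map. -/
structure IsCentralPair {NL NR : Mfd.{u}} (P : QPoisson t M) (PL : QPoisson t NL)
    (PR : QPoisson t NR) (μL : M → NL) (μR : M → NR) : Prop where
  commL : PL.IsCommutative
  commR : PR.IsCommutative
  smoothL : Smooth μL
  smoothR : Smooth μR
  equivariantL : Equivariant P.toLieAct PL.toLieAct μL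
  equivariantR : Equivariant P.toLieAct PR.toLieAct μR
  centralL : ∀ f : NL → ℝ, SmoothFun f → P.LeftCentral (f ∘ μL)
  centralR : ∀ f : NR → ℝ, SmoothFun f → P.RightCentral (f ∘ μR)

/-- Split-symplectic central pairs. -/
structure IsSplitSymplecticPair {NL NR : Mfd.{u}} (P : QPoisson t M) (PL : QPoisson t NL)
    (PR : QPoisson t NR) (μL : M → NL) (μR : M → NR) : Prop
    extends IsCentralPair P PL PR μL μR where
  nondegenerate : t.Nondegenerate
  big : P.BigTangentEqTop
  transitiveL : PL.IsTransitive
  transitiveR : PR.IsTransitive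
  lagrangianL : ∀ y, t.IsLagrangian (PL.stabilizer y)
  lagrangianR : ∀ y, t.IsLagrangian (PR.stabilizer y)

end QuasiPoisson

/-! ## Preimages of pairs of submanifolds -/

section Preimage

variable {M NL NR OL OR : Mfd.{u}}

/-- The underlying element of the model space of a tangent vector (Mathlib's tangent spaces are
copies of the model space); it serves to compare vectors in `T_y N` and `T_{y'} N` when `y = y'`. -/
def vec {N : Mfd.{u}} {y : N} (ξ : N.T y) : EuclideanSpace ℝ (Fin N.dim) := ξ

/-- `μL × μR : M → NL × NR` is transverse to the immersed submanifold
`jL × jR : OL × OR → NL × NR`. -/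
def TransversePair (μL : M → NL) (μR : M → NR) (jL : OL → NL) (jR : OR → NR) : Prop :=
  ∀ (x : M) (a : OL) (b : OR), μL x = jL a → μR x = jR b →
    ∀ (y : EuclideanSpace ℝ (Fin NL.dim)) (z : EuclideanSpace ℝ (Fin NR.dim)),
      ∃ (ξ : M.T x) (η : OL.T a) (ζ : OR.T b),
        vec (tmap μL x ξ) + vec (tmap jL a η) = y ∧ vec (tmap μR x ξ) + vec (tmap jR b ζ) = z

/-- The immersed submanifold `iM : S → M` is `μL⁻¹(OL) ∩ μR⁻¹(OR)`, with its structure of a fibre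
product: `(iM, iL, iR)` embeds `S` onto
`{(x, a, b) | μL x = jL a, μR x = jR b} ⊆ M × OL × OR`. -/
structure IsPreimage (μL : M → NL) (μR : M → NR) (jL : OL → NL) (jR : OR → NR)
    {S : Mfd.{u}} (iM : S → M) (iL : S → OL) (iR : S → OR) : Prop where
  immersed : IsInjImmersion iM
  smoothL : Smooth iL
  smoothR : Smooth iR
  embedding : Topology.IsEmbedding fun s => (iM s, iL s, iR s)
  range_eq : Set.range (fun s => (iM s, iL s, iR s)) =
    {p : M × OL × OR | μL p.1 = jL p.2.1 ∧ μR p.1 = jR p.2.2}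

end Preimage

end QuasiPoisson

end

open QuasiPoisson

set_option linter.unusedSectionVars false

noncomputable section

namespace QuasiPoisson

open Set Filter Topology Function

/-! ## The inverse function theorem on manifolds -/

section InverseFunction

variable {E F : Type*} [NormedAddCommGroup E] [NormedSpace ℝ E] [FiniteDimensional ℝ E]
  [NormedAddCommGroup F] [NormedSpace ℝ F] [FiniteDimensional ℝ F]

/-! Everything turns on the form σ = π + ½ρ⊗ρ(t). Since π is skew, σ(α,β) + σ(β,α) = t(ρ*α, ρ*β).
Pullbacks along μL lie in the left kernel of σ and pullbacks along μR in the right kernel, so the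
values that remain, σ(β, μL*l) and σ(μR*k, β), are t-pairings of ρ*β with ρ*l or ρ*k. If l and k
vanish on the directions of c, then t♯ρ*l and t♯ρ*k lie in c^⊥, and these pairings vanish for every
β killing c^⊥, that is, for every covector pulled back from M/c^⊥.

Let S be the preimage of OL × OR. By transversality it is a submanifold whose tangent spaces are the
preimages of those of the orbits, so a covector vanishing on TS is a sum μL*l + μR*k with l and k as
above. Hence π pairs it to zero with covectors from M/c^⊥ (`IsCentralPair.pi_eq_zero`), which says
that the bivector of M/c^⊥ is tangent to M'. The same computation, with only one of l, k
constrained, makes the reduced maps central (`IsCentralPair.leftCentral_reduced`,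
`IsCentralPair.rightCentral_reduced`).

That T^big M' is all of TM' is a converse (`IsSplitSymplecticPair.exists_eq_add`): a covector b that
kills ρ(c) and is π-orthogonal to all covectors killing c^⊥ is such a sum. Here π(·,b) must be
ρ(t♯η) with η in Ann c; centrality of μL and its Lagrangian stabilizers produce l, those of μR
produce k, and b − μL*l − μR*k vanishes because T^big M = TM.

On the orbit quotients the bivector is zero, and the stabilizers are ((L + c^⊥) ∩ c)/c^⊥ for
Lagrangian L, hence Lagrangian again (`InvTensor.IsLagrangian.reduced`).

Finally, M' is a manifold because S → M/c^⊥ has constant rank (its kernels ρ(c^⊥) lie in TS) and its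
fibres, being c^⊥-orbits, are path connected. A constant rank map with path connected fibres factors
as a surjective submersion followed by an injective immersion (`exists_quotient_of_constantRank`).
-/

theorem exists_openPartialHomeomorph_of_contDiffAt {f : E → F} {x : E} {f' : E ≃L[ℝ] F}
    (hf : ∀ᶠ y in 𝓝 x, ContDiffAt ℝ ∞ f y) (hf' : HasFDerivAt f (f' : E →L[ℝ] F) x) :
    ∃ e : OpenPartialHomeomorph E F, x ∈ e.source ∧ ⇑e = f ∧
      (∀ y ∈ e.source, ContDiffAt ℝ ∞ f y) ∧ ∀ z ∈ e.target, ContDiffAt ℝ ∞ e.symm z := by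
  have : CompleteSpace E := FiniteDimensional.complete ℝ E
  have hfx := hf.self_of_nhds
  -- Invertible linear maps form an open set. Shrinking to where the derivative is invertible makes
  -- the inverse smooth on the whole target, not only at the image of `x`.
  have hinv : ∀ᶠ y in 𝓝 x, ∃ g : E ≃L[ℝ] F, (g : E →L[ℝ] F) = fderiv ℝ f y := by
    have hc : ContinuousAt (fderiv ℝ f) x :=
      (hfx.fderiv_right (m := 0) (by simp)).continuousAt
    have hn := ContinuousLinearEquiv.nhds f'
    rw [← hf'.fderiv] at hn
    exact hc.eventually hn
  obtain ⟨U, hU, hUo, hxU⟩ := eventually_nhds_iff.1 (hf.and hinv)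
  let e₀ := hfx.toOpenPartialHomeomorph f hf' (by simp)
  have he₀ : ⇑e₀ = f := hfx.toOpenPartialHomeomorph_coe hf' (by simp)
  refine ⟨e₀.restrOpen U hUo, ?_, ?_, ?_, ?_⟩
  · exact ⟨hfx.mem_toOpenPartialHomeomorph_source hf' (by simp), hxU⟩
  · exact he₀
  · exact fun y hy => (hU y hy.2).1
  · intro z hz
    have hs := (e₀.restrOpen U hUo).map_target hz
    obtain ⟨h1, g, hg⟩ := hU _ hs.2
    refine (e₀.restrOpen U hUo).contDiffAt_symm (f₀' := g) hz ?_ ?_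
    · have h2 := (h1.differentiableAt (by simp)).hasFDerivAt
      rw [← hg] at h2
      exact he₀ ▸ h2
    · exact he₀ ▸ h1

variable {H : Type*} [TopologicalSpace H] {I : ModelWithCorners ℝ E H} [I.Boundaryless]
  {X : Type*} [TopologicalSpace X] [ChartedSpace H X]

variable (I) in
/-- The extended chart of a manifold without boundary, as an open partial homeomorphism. -/
def extChart (x : X) : OpenPartialHomeomorph X E where
  toPartialEquiv := extChartAt I x
  open_source := isOpen_extChartAt_source x
  open_target := isOpen_extChartAt_target x
  continuousOn_toFun := continuousOn_extChartAt x
  continuousOn_invFun := continuousOn_extChartAt_symm x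

theorem mem_extChart_source (x : X) : x ∈ (extChart I x).source := mem_extChartAt_source x

section

variable [IsManifold I ∞ X]

theorem contMDiffAt_extChart {x y : X} (hy : y ∈ (extChart I x).source) :
    ContMDiffAt I 𝓘(ℝ, E) ∞ (extChart I x) y :=
  contMDiffAt_extChartAt' (by simpa [extChart] using hy)

theorem contMDiffAt_extChart_symm {x : X} {z : E} (hz : z ∈ (extChart I x).target) :
    ContMDiffAt 𝓘(ℝ, E) I ∞ (extChart I x).symm z :=
  ((contMDiffOn_extChartAt_symm x) z hz).contMDiffAt ((isOpen_extChartAt_target x).mem_nhds hz)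

theorem hasFDerivAt_comp_extChart_symm {f : X → F} {x : X} {f' : E →L[ℝ] F}
    (hf : HasMFDerivAt I 𝓘(ℝ, F) f x f') :
    HasFDerivAt (f ∘ (extChart I x).symm) f' (extChart I x x) := by
  have h : HasFDerivWithinAt (f ∘ (extChart I x).symm) f' (range I) (extChart I x x) := hf.2
  rwa [I.range_eq_univ, hasFDerivWithinAt_univ] at h

theorem exists_openPartialHomeomorph_of_contMDiffAt {f : X → F} {x : X} {f' : E ≃L[ℝ] F}
    (hf : ∀ᶠ y in 𝓝 x, ContMDiffAt I 𝓘(ℝ, F) ∞ f y)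
    (hf' : HasMFDerivAt I 𝓘(ℝ, F) f x (f' : E →L[ℝ] F)) :
    ∃ e : OpenPartialHomeomorph X F, x ∈ e.source ∧ EqOn e f e.source ∧
      (∀ y ∈ e.source, ContMDiffAt I 𝓘(ℝ, F) ∞ e y) ∧
      ∀ z ∈ e.target, ContMDiffAt 𝓘(ℝ, F) I ∞ e.symm z := by
  have hx := mem_extChart_source (I := I) x
  have hx' := (extChart I x).map_source hx
  have h1 : ∀ᶠ z in 𝓝 (extChart I x x), ContDiffAt ℝ ∞ (f ∘ (extChart I x).symm) z := by
    have hc : Tendsto (extChart I x).symm (𝓝 (extChart I x x)) (𝓝 x) := by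
      have := (extChart I x).symm.continuousAt hx'
      rwa [ContinuousAt, (extChart I x).left_inv hx] at this
    filter_upwards [hc.eventually hf, (extChart I x).open_target.mem_nhds hx'] with z hz hz'
    exact (hz.comp z (contMDiffAt_extChart_symm hz')).contDiffAt
  obtain ⟨e, he, hef, hes, het⟩ :=
    exists_openPartialHomeomorph_of_contDiffAt h1 (hasFDerivAt_comp_extChart_symm hf')
  refine ⟨(extChart I x).trans e, ⟨hx, he⟩, ?_, ?_, ?_⟩
  · intro y hy
    simp only [OpenPartialHomeomorph.coe_trans, comp_apply, hef]
    rw [(extChart I x).left_inv hy.1]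
  · intro y hy
    have h2 := hes _ hy.2
    rw [← hef] at h2
    exact h2.contMDiffAt.comp y (contMDiffAt_extChart hy.1)
  · intro z hz
    exact (contMDiffAt_extChart_symm hz.2).comp z (het z hz.1).contMDiffAt

/-- The tangent space at `x` is identified with the model space through this very chart, so the
derivative is the identity. This lets tangent maps be used directly as Fréchet derivatives. -/
theorem hasMFDerivAt_extChart_self (x : X) :
    HasMFDerivAt I 𝓘(ℝ, E) (extChart I x) x (ContinuousLinearMap.id ℝ E) := by
  have h := (contMDiffAt_extChart (mem_extChart_source (I := I) x)).mdifferentiableAt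
    (by simp) |>.hasMFDerivAt
  rw [show mfderiv I 𝓘(ℝ, E) (extChart I x) x = ContinuousLinearMap.id ℝ E from
    mfderiv_extChartAt_self] at h
  exact h

theorem exists_continuous_leftInverse {f : E →L[ℝ] F} (hf : Injective f) :
    ∃ g : F →L[ℝ] E, ∀ x, g (f x) = x := by
  obtain ⟨g, hg⟩ := (f : E →ₗ[ℝ] F).exists_leftInverse_of_injective (LinearMap.ker_eq_bot.2 hf)
  exact ⟨LinearMap.toContinuousLinearMap g, fun x => LinearMap.congr_fun hg x⟩

/-- In suitable coordinates a submersion is a projection. -/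
theorem exists_submersion_chart {f : X → F} {x : X} {f' : E →L[ℝ] F} {d : ℕ}
    (hf : ∀ᶠ y in 𝓝 x, ContMDiffAt I 𝓘(ℝ, F) ∞ f y)
    (hf' : HasMFDerivAt I 𝓘(ℝ, F) f x f') (hs : Surjective f')
    (hd : Module.finrank ℝ E = Module.finrank ℝ F + d) :
    ∃ e : OpenPartialHomeomorph X (F × EuclideanSpace ℝ (Fin d)), x ∈ e.source ∧
      (∀ y ∈ e.source, (e y).1 = f y) ∧
      (∀ y ∈ e.source, ContMDiffAt I 𝓘(ℝ, F × EuclideanSpace ℝ (Fin d)) ∞ e y) ∧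
      ∀ z ∈ e.target, ContMDiffAt 𝓘(ℝ, F × EuclideanSpace ℝ (Fin d)) I ∞ e.symm z := by
  have hr : LinearMap.range (f' : E →ₗ[ℝ] F) = ⊤ := LinearMap.range_eq_top.2 hs
  have hk : Module.finrank ℝ (LinearMap.ker (f' : E →ₗ[ℝ] F)) = d := by
    have := LinearMap.finrank_range_add_finrank_ker (f' : E →ₗ[ℝ] F)
    rw [hr, finrank_top] at this
    omega
  -- Completing `f'` by a projection onto its kernel gives an isomorphism, so the inverse function
  -- theorem applies to `f` paired with that projection in a chart.
  obtain ⟨P, hP⟩ := Submodule.exists_isCompl (LinearMap.ker (f' : E →ₗ[ℝ] F))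
  let ε : LinearMap.ker (f' : E →ₗ[ℝ] F) ≃ₗ[ℝ] EuclideanSpace ℝ (Fin d) :=
    LinearEquiv.ofFinrankEq _ _ (by simp [hk])
  let p : E →L[ℝ] EuclideanSpace ℝ (Fin d) :=
    LinearMap.toContinuousLinearMap (ε.toLinearMap ∘ₗ Submodule.projectionOnto _ P hP)
  have hinj : Injective (f'.prod p) := by
    rw [injective_iff_map_eq_zero]
    intro v hv
    have h1 : f' v = 0 := congrArg Prod.fst hv
    have h2 : p v = 0 := congrArg Prod.snd hv
    have h3 : p v = ε ⟨v, h1⟩ := by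
      exact congrArg ε (Submodule.projectionOnto_apply_left hP ⟨v, h1⟩)
    rw [h3] at h2
    simpa using congrArg Subtype.val (ε.map_eq_zero_iff.1 h2)
  have hdim : Module.finrank ℝ E = Module.finrank ℝ (F × EuclideanSpace ℝ (Fin d)) := by
    simp [hd]
  let L : E ≃L[ℝ] F × EuclideanSpace ℝ (Fin d) :=
    (LinearEquiv.ofInjectiveOfFinrankEq (f'.prod p : E →ₗ[ℝ] _) hinj hdim).toContinuousLinearEquiv
  have hL : (L : E →L[ℝ] F × EuclideanSpace ℝ (Fin d)) = f'.prod p := by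
    ext v <;> rfl
  have hxs := mem_extChart_source (I := I) x
  have h1 : ∀ᶠ y in 𝓝 x, ContMDiffAt I 𝓘(ℝ, F × EuclideanSpace ℝ (Fin d)) ∞
      (fun y => (f y, p (extChart I x y))) y := by
    filter_upwards [hf, (extChart I x).open_source.mem_nhds hxs] with y hy hy'
    exact hy.prodMk_space (p.contMDiff.contMDiffAt.comp y (contMDiffAt_extChart hy'))
  have h2 : HasMFDerivAt I 𝓘(ℝ, F × EuclideanSpace ℝ (Fin d))
      (fun y => (f y, p (extChart I x y))) x (L : E →L[ℝ] F × EuclideanSpace ℝ (Fin d)) := by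
    rw [hL]
    have h3 : HasMFDerivAt I 𝓘(ℝ, EuclideanSpace ℝ (Fin d)) (fun y => p (extChart I x y)) x p :=
      p.hasMFDerivAt.comp x (hasMFDerivAt_extChart_self x)
    exact ⟨hf'.1.prodMk h3.1, HasFDerivWithinAt.prodMk hf'.2 h3.2⟩
  obtain ⟨e, he, hef, hes, het⟩ := exists_openPartialHomeomorph_of_contMDiffAt h1 h2
  exact ⟨e, he, fun y hy => by rw [hef hy], hes, het⟩

variable {E' : Type*} [NormedAddCommGroup E'] [NormedSpace ℝ E'] [FiniteDimensional ℝ E']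
  {H' : Type*} [TopologicalSpace H'] {J : ModelWithCorners ℝ E' H'} [J.Boundaryless]
  {Y : Type*} [TopologicalSpace Y] [ChartedSpace H' Y] [IsManifold J ∞ Y]

/-- A smooth map with injective tangent map has a smooth local retraction. -/
theorem exists_local_retraction {j : X → Y} {x : X} (hj : ∀ᶠ y in 𝓝 x, ContMDiffAt I J ∞ j y)
    (hj' : Injective (mfderiv I J j x)) :
    ∃ r : Y → X, (∀ᶠ y in 𝓝 (j x), ContMDiffAt J I ∞ r y) ∧ ∀ᶠ y in 𝓝 x, r (j y) = y := by
  have hjx : HasMFDerivAt I J j x (mfderiv I J j x) :=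
    (hj.self_of_nhds.mdifferentiableAt (by simp)).hasMFDerivAt
  -- With `g` a linear left inverse of the tangent map, `g` after a chart after `j` has derivative
  -- the identity at `x`. Its local inverse, applied after `g` and the chart, is the retraction.
  obtain ⟨g, hg⟩ := exists_continuous_leftInverse (E := E) (F := E') (f := mfderiv I J j x) hj'
  have hs := mem_extChart_source (I := J) (j x)
  have hd : HasMFDerivAt I 𝓘(ℝ, E) (fun y => g (extChart J (j x) (j y))) x
      ((ContinuousLinearEquiv.refl ℝ E : E ≃L[ℝ] E) : E →L[ℝ] E) := by
    have h1 : HasMFDerivAt I 𝓘(ℝ, E) (fun y => g (extChart J (j x) (j y))) x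
      (g.comp ((ContinuousLinearMap.id ℝ E').comp (mfderiv I J j x : E →L[ℝ] E'))) :=
      g.hasMFDerivAt.comp x ((hasMFDerivAt_extChart_self (j x)).comp x hjx)
    have h2 : g.comp ((ContinuousLinearMap.id ℝ E').comp (mfderiv I J j x : E →L[ℝ] E')) =
        ((ContinuousLinearEquiv.refl ℝ E : E ≃L[ℝ] E) : E →L[ℝ] E) :=
      ContinuousLinearMap.ext hg
    rwa [h2] at h1
  have hev : ∀ᶠ y in 𝓝 x, j y ∈ (extChart J (j x)).source :=
    hj.self_of_nhds.continuousAt.eventually ((extChart J (j x)).open_source.mem_nhds hs)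
  obtain ⟨e, he, hef, hes, het⟩ := exists_openPartialHomeomorph_of_contMDiffAt (I := I) (x := x)
    (f := fun y => g (extChart J (j x) (j y))) (f' := ContinuousLinearEquiv.refl ℝ E) (by
      filter_upwards [hj, hev] with y hy hy'
      exact g.contMDiff.contMDiffAt.comp y ((contMDiffAt_extChart hy').comp y hy)) hd
  have hex : e x = g (extChart J (j x) (j x)) := hef he
  refine ⟨fun y => e.symm (g (extChart J (j x) y)), ?_, ?_⟩
  · have h1 : ContinuousAt (fun y => g (extChart J (j x) y)) (j x) :=
      g.continuous.continuousAt.comp ((extChart J (j x)).continuousAt hs)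
    have h2 := h1.eventually (e.open_target.mem_nhds
      (show g (extChart J (j x) (j x)) ∈ _ from hex ▸ e.map_source he))
    filter_upwards [h2, (extChart J (j x)).open_source.mem_nhds hs] with y hy hy'
    exact (het _ hy).comp y (g.contMDiff.contMDiffAt.comp y (contMDiffAt_extChart hy'))
  · filter_upwards [e.open_source.mem_nhds he] with y hy
    have h1 : e y = g (extChart J (j x) (j y)) := hef hy
    rw [← h1, e.left_inv hy]

/-- A smooth map with surjective tangent map has smooth local sections. -/
theorem exists_local_section {q : X → Y} {x : X} (hq : ∀ᶠ y in 𝓝 x, ContMDiffAt I J ∞ q y)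
    (hq' : Surjective (mfderiv I J q x)) :
    ∃ s : Y → X, (∀ᶠ y in 𝓝 (q x), ContMDiffAt J I ∞ s y) ∧ (∀ᶠ y in 𝓝 (q x), q (s y) = y) ∧
      s (q x) = x := by
  have hqx : HasMFDerivAt I J q x (mfderiv I J q x) :=
    (hq.self_of_nhds.mdifferentiableAt (by simp)).hasMFDerivAt
  have hs := mem_extChart_source (I := J) (q x)
  have hev : ∀ᶠ y in 𝓝 x, q y ∈ (extChart J (q x)).source :=
    hq.self_of_nhds.continuousAt.eventually ((extChart J (q x)).open_source.mem_nhds hs)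
  let f' : E →L[ℝ] E' := mfderiv I J q x
  have hle : Module.finrank ℝ E' ≤ Module.finrank ℝ E :=
    LinearMap.finrank_le_finrank_of_surjective (f := (f' : E →ₗ[ℝ] E')) hq'
  obtain ⟨d, hd⟩ := Nat.exists_eq_add_of_le hle
  obtain ⟨e, he, hef, hes, het⟩ := exists_submersion_chart (I := I) (x := x)
    (f := fun y => extChart J (q x) (q y)) (f' := mfderiv I J q x) (d := d) (by
      filter_upwards [hq, hev] with y hy hy'
      exact (contMDiffAt_extChart hy').comp y hy)
    ((hasMFDerivAt_extChart_self (q x)).comp x hqx) hq' hd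
  -- The section freezes the fibre coordinate at its value at `x`.
  have hc : ContinuousAt (fun y => (extChart J (q x) y, (e x).2)) (q x) :=
    ((extChart J (q x)).continuousAt hs).prodMk continuousAt_const
  have hex : (extChart J (q x) (q x), (e x).2) = e x := Prod.ext (hef x he).symm rfl
  have hmem : (extChart J (q x) (q x), (e x).2) ∈ e.target := by rw [hex]; exact e.map_source he
  have ht : ∀ᶠ y in 𝓝 (q x), (extChart J (q x) y, (e x).2) ∈ e.target :=
    hc.eventually (e.open_target.mem_nhds hmem)
  have hsx : e.symm (extChart J (q x) (q x), (e x).2) = x := by rw [hex, e.left_inv he]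
  refine ⟨fun y => e.symm (extChart J (q x) y, (e x).2), ?_, ?_, hsx⟩
  · filter_upwards [ht, (extChart J (q x)).open_source.mem_nhds hs] with y hy hy'
    exact (het _ hy).comp y ((contMDiffAt_extChart hy').prodMk_space contMDiffAt_const)
  · have hc2 : ContinuousAt (fun y => e.symm (extChart J (q x) y, (e x).2)) (q x) := by
      have h0 : ContinuousAt e.symm (extChart J (q x) (q x), (e x).2) :=
        e.symm.continuousAt hmem
      exact ContinuousAt.comp (f := fun y => (extChart J (q x) y, (e x).2)) h0 hc
    have hc3 : Tendsto (fun y => e.symm (extChart J (q x) y, (e x).2)) (𝓝 (q x)) (𝓝 x) := by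
      rw [ContinuousAt, hsx] at hc2
      exact hc2
    have hev2 := hc3.eventually hev
    filter_upwards [ht, hev2, (extChart J (q x)).open_source.mem_nhds hs] with y hy hy2 hy3
    refine (extChart J (q x)).injOn hy2 hy3 ?_
    rw [← hef _ (e.map_target hy), e.right_inv hy]

end

end InverseFunction

/-! ## Smooth functions, tangent maps and vector fields -/

section Calculus

variable {M N B : Mfd.{u}}

theorem Smooth.mdifferentiableAt {F : M → N} (hF : Smooth F) (x : M) :
    MDifferentiableAt (𝓡 M.dim) (𝓡 N.dim) F x := (hF x).mdifferentiableAt (by simp)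

theorem SmoothFun.mdifferentiableAt {f : M → ℝ} (hf : SmoothFun f) (x : M) :
    MDifferentiableAt (𝓡 M.dim) 𝓘(ℝ, ℝ) f x := (hf x).mdifferentiableAt (by simp)

theorem Smooth.comp {G : N → B} {F : M → N} (hG : Smooth G) (hF : Smooth F) : Smooth (G ∘ F) :=
  ContMDiff.comp hG hF

theorem SmoothFun.comp {f : N → ℝ} {F : M → N} (hf : SmoothFun f) (hF : Smooth F) :
    SmoothFun (f ∘ F) :=
  ContMDiff.comp hf hF

theorem diff_comp_of_mdifferentiableAt {f : N → ℝ} {F : M → N} {x : M}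
    (hf : MDifferentiableAt (𝓡 N.dim) 𝓘(ℝ, ℝ) f (F x))
    (hF : MDifferentiableAt (𝓡 M.dim) (𝓡 N.dim) F x) :
    diff (f ∘ F) x = (diff f (F x)).comp (tmap F x) :=
  mvfderiv_comp x hf hF

theorem diff_comp {f : N → ℝ} {F : M → N} (hf : SmoothFun f) (hF : Smooth F) (x : M) :
    diff (f ∘ F) x = (diff f (F x)).comp (tmap F x) :=
  diff_comp_of_mdifferentiableAt (hf.mdifferentiableAt _) (hF.mdifferentiableAt x)

theorem diff_comp_apply {f : N → ℝ} {F : M → N} (hf : SmoothFun f) (hF : Smooth F) (x : M)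
    (ξ : M.T x) : diff (f ∘ F) x ξ = diff f (F x) (tmap F x ξ) := by
  rw [diff_comp hf hF]; rfl

theorem tmap_comp {G : N → B} {F : M → N} (hG : Smooth G) (hF : Smooth F) (x : M) :
    tmap (G ∘ F) x = (tmap G (F x)).comp (tmap F x) :=
  mfderiv_comp x (hG.mdifferentiableAt _) (hF.mdifferentiableAt x)

theorem tmap_comp_apply {G : N → B} {F : M → N} (hG : Smooth G) (hF : Smooth F) (x : M)
    (ξ : M.T x) : tmap (G ∘ F) x ξ = tmap G (F x) (tmap F x ξ) := by
  rw [tmap_comp hG hF]; rfl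

theorem tmap_id (x : M) (ξ : M.T x) : tmap (id : M → M) x ξ = ξ := by
  change mfderiv (𝓡 M.dim) (𝓡 M.dim) id x ξ = ξ
  rw [mfderiv_id]; rfl

theorem smooth_id : Smooth (id : M → M) := contMDiff_id

theorem diff_congr {f k : M → ℝ} {x : M} (h : f =ᶠ[𝓝 x] k) : diff f x = diff k x := by
  have h1 := h.mfderiv_eq (I := 𝓡 M.dim) (I' := 𝓘(ℝ, ℝ))
  ext ξ
  exact congrArg (fun L : EuclideanSpace ℝ (Fin M.dim) →L[ℝ] ℝ => L ξ) h1

/-- A smooth germ is the germ of a smooth function. -/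
theorem exists_smoothFun_eventuallyEq {f : M → ℝ} {x : M}
    (hf : ∀ᶠ y in 𝓝 x, ContMDiffAt (𝓡 M.dim) 𝓘(ℝ, ℝ) ∞ f y) :
    ∃ k : M → ℝ, SmoothFun k ∧ k =ᶠ[𝓝 x] f := by
  -- The bump function is supported where `f` is smooth, so its product with `f` is smooth
  -- everywhere.
  obtain ⟨b, -, hb⟩ := (SmoothBumpFunction.nhds_basis_tsupport (I := 𝓡 M.dim) x).mem_iff.1 hf
  refine ⟨fun y => b y * f y, ?_, ?_⟩
  · refine contMDiff_of_tsupport fun y hy => ?_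
    have hy' : y ∈ tsupport b := closure_mono (support_mul_subset_left _ _) hy
    exact b.contMDiffAt.mul (hb hy')
  · filter_upwards [b.eventuallyEq_one] with y hy
    simp [hy]

/-- A linear function in a chart, cut off. It converts between axioms stated on functions and
identities stated on covectors. -/
theorem exists_smoothFun_diff_eq (x : M) (α : M.coT x) : ∃ f : M → ℝ, SmoothFun f ∧ diff f x = α := by
  have hα : ∀ᶠ y in 𝓝 x, ContMDiffAt (𝓡 M.dim) 𝓘(ℝ, ℝ) ∞
      (fun y => (α : EuclideanSpace ℝ (Fin M.dim) →L[ℝ] ℝ) (extChart (𝓡 M.dim) x y)) y := by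
    filter_upwards [(extChart (𝓡 M.dim) x).open_source.mem_nhds (mem_extChart_source x)] with y hy
    exact (ContinuousLinearMap.contMDiff (E := EuclideanSpace ℝ (Fin M.dim)) α).contMDiffAt.comp y
      (contMDiffAt_extChart hy)
  obtain ⟨k, hk, hk'⟩ := exists_smoothFun_eventuallyEq hα
  refine ⟨k, hk, ?_⟩
  rw [diff_congr hk']
  have h := (ContinuousLinearMap.hasMFDerivAt (E := EuclideanSpace ℝ (Fin M.dim)) α).comp x
    (hasMFDerivAt_extChart_self (I := 𝓡 M.dim) x)
  exact h.mfderiv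

theorem tangent_ext {x : M} {ξ η : M.T x}
    (h : ∀ f : M → ℝ, SmoothFun f → diff f x ξ = diff f x η) : ξ = η := by
  have h1 : ∀ α : EuclideanSpace ℝ (Fin M.dim) →L[ℝ] ℝ, α ξ = α η := by
    intro α
    obtain ⟨f, hf, hα⟩ := exists_smoothFun_diff_eq x α
    have h2 := h f hf
    rw [hα] at h2
    exact h2
  obtain h2 | ⟨α, hα⟩ := or_iff_not_imp_left.2 (fun h3 : ¬ ξ = η =>
    SeparatingDual.exists_separating_of_ne (R := ℝ) (V := EuclideanSpace ℝ (Fin M.dim)) h3)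
  · exact h2
  · exact absurd (h1 α) hα

/-- The model vector space of a manifold. -/
abbrev Mfd.Model (M : Mfd.{u}) : Type := EuclideanSpace ℝ (Fin M.dim)

/-- Smooth vector fields. -/
abbrev SmoothField (X : (x : M) → M.T x) : Prop :=
  ContMDiff (𝓡 M.dim) (𝓡 M.dim).tangent ∞ (fun x => (⟨x, X x⟩ : TangentBundle (𝓡 M.dim) M))

theorem SmoothField.apply {X : (x : M) → M.T x} (hX : SmoothField X) {f : M → ℝ}
    (hf : SmoothFun f) : SmoothFun (fun x => diff f x (X x)) := by
  have h1 : ContMDiff (𝓡 M.dim).tangent 𝓘(ℝ, ℝ).tangent ∞ (tangentMap (𝓡 M.dim) 𝓘(ℝ, ℝ) f) :=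
    ContMDiff.contMDiff_tangentMap hf (by simp)
  exact (contMDiff_snd_tangentBundle_modelSpace ℝ 𝓘(ℝ, ℝ)).comp (h1.comp hX)

theorem smoothField_of_apply {X : (x : M) → M.T x}
    (h : ∀ f : M → ℝ, SmoothFun f → SmoothFun (fun x => diff f x (X x))) : SmoothField X := by
  intro x₀
  rw [Bundle.contMDiffAt_section]
  set φ := extChart (𝓡 M.dim) x₀ with hφ
  let D : M → EuclideanSpace ℝ (Fin M.dim) := fun x => mfderiv (𝓡 M.dim) (𝓡 M.dim) φ x (X x)
  -- The components of the field in the chart are its derivatives of the coordinate functions, which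
  -- a cutoff extends to smooth functions on `M` without changing their germs.
  have key : ∀ i : Fin M.dim, ContMDiffAt (𝓡 M.dim) 𝓘(ℝ, ℝ) ∞ (fun x => D x i) x₀ := by
    intro i
    let p : EuclideanSpace ℝ (Fin M.dim) →L[ℝ] ℝ := EuclideanSpace.proj i
    obtain ⟨k, hk, hk'⟩ := exists_smoothFun_eventuallyEq (x := x₀) (f := fun y => p (φ y)) (by
      filter_upwards [φ.open_source.mem_nhds (mem_extChart_source x₀)] with y hy
      exact p.contMDiff.contMDiffAt.comp y (contMDiffAt_extChart hy))
    refine (h k hk x₀).congr_of_eventuallyEq ?_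
    filter_upwards [hk'.eventually_nhds, φ.open_source.mem_nhds (mem_extChart_source x₀)]
      with y hy hys
    rw [diff_congr hy]
    have h2 := p.hasMFDerivAt.comp y
      ((contMDiffAt_extChart hys).mdifferentiableAt (by simp)).hasMFDerivAt
    have h3 := h2.mfderiv
    exact (congrArg (fun L : EuclideanSpace ℝ (Fin M.dim) →L[ℝ] ℝ => L (X y)) h3).symm
  have key2 : ContMDiffAt (𝓡 M.dim) (𝓡 M.dim) ∞ D x₀ := by
    have h4 : ContMDiffAt (𝓡 M.dim) 𝓘(ℝ, Fin M.dim → ℝ) ∞ (fun x i => D x i) x₀ :=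
      contMDiffAt_pi_space.2 key
    exact ((EuclideanSpace.equiv (Fin M.dim) ℝ).symm.contDiff.contMDiff.contMDiffAt).comp x₀ h4
  refine key2.congr_of_eventuallyEq ?_
  filter_upwards [φ.open_source.mem_nhds (mem_extChart_source x₀)] with y hy
  have hy' : y ∈ (chartAt (EuclideanSpace ℝ (Fin M.dim)) x₀).source := by
    simpa [hφ, extChart] using hy
  have h5 := TangentBundle.continuousLinearMapAt_trivializationAt (I := 𝓡 M.dim) hy'
  have h6 := congrArg (fun L : EuclideanSpace ℝ (Fin M.dim) →L[ℝ] EuclideanSpace ℝ (Fin M.dim) =>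
    L (X y)) h5
  refine Eq.trans ?_ h6
  exact (Bundle.Trivialization.continuousLinearMapAt_apply_of_mem (R := ℝ)
    (trivializationAt (EuclideanSpace ℝ (Fin M.dim)) (TangentSpace (𝓡 M.dim)) x₀) hy' (X y)).symm

theorem inverse_apply_of_eq_id {E : Type*} [NormedAddCommGroup E] [NormedSpace ℝ E]
    {L : E →L[ℝ] E} (h : L = ContinuousLinearMap.id ℝ E) (v : E) : L.inverse v = v := by
  rw [h, ContinuousLinearMap.inverse_id]; rfl

/-- In a chart, the second-order terms of X(Yf) − Y(Xf) cancel by symmetry of the second derivative.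
All later statements on brackets of fields go through this description as commutators of
derivations. -/
theorem diff_mlieBracket {X Y : (x : M) → M.T x} (hX : SmoothField X) (hY : SmoothField Y)
    {f : M → ℝ} (hf : SmoothFun f) (x : M) :
    diff f x (VectorField.mlieBracket (𝓡 M.dim) X Y x) =
      diff (fun y => diff f y (Y y)) x (X x) - diff (fun y => diff f y (X y)) x (Y x) := by
  set φ := extChart (𝓡 M.dim) x with hφ
  have hxs : x ∈ φ.source := mem_extChart_source x
  have hxt : φ x ∈ φ.target := φ.map_source hxs
  -- The coordinate expression of a vector field in the chart at `x`; at `φ x` it has the value of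
  -- the field at `x`.
  let hat : ((y : M) → M.T y) → M.Model → M.Model :=
    VectorField.mpullbackWithin 𝓘(ℝ, M.Model) (𝓡 M.dim) φ.symm (s := range (𝓡 M.dim))
  have hd : ∀ {Z : (y : M) → M.T y}, SmoothField Z → DifferentiableAt ℝ (hat Z) (φ x) := by
    intro Z hZ
    have h1 := MDifferentiableWithinAt.differentiableWithinAt_mpullbackWithin_vectorField
      (((hZ x).mdifferentiableAt (by simp)).mdifferentiableWithinAt (s := univ))
    rw [preimage_univ, univ_inter, (𝓡 M.dim).range_eq_univ] at h1
    have h2 := h1.differentiableAt univ_mem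
    simp only [hat, (𝓡 M.dim).range_eq_univ]
    exact h2
  have hz : ∀ z ∈ φ.target, ∀ (Z : (y : M) → M.T y) (k : M → ℝ), SmoothFun k →
      diff k (φ.symm z) (Z (φ.symm z)) = fderiv ℝ (k ∘ φ.symm) z (hat Z z) := by
    intro z hz Z k hk
    have hA := isInvertible_mfderivWithin_extChartAt_symm (I := 𝓡 M.dim) (x := x) hz
    let A : M.Model →L[ℝ] M.Model := mfderiv 𝓘(ℝ, M.Model) (𝓡 M.dim) φ.symm z
    let κ : M.Model →L[ℝ] ℝ := diff k (φ.symm z)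
    have h1 : HasMFDerivAt 𝓘(ℝ, M.Model) 𝓘(ℝ, ℝ) (k ∘ φ.symm) z (κ.comp A) :=
      (hk.mdifferentiableAt (φ.symm z)).hasMFDerivAt.comp z
        ((contMDiffAt_extChart_symm hz).mdifferentiableAt (by simp)).hasMFDerivAt
    have h2 : HasFDerivAt (k ∘ φ.symm) (κ.comp A) z := by
      have h3 : HasFDerivWithinAt (k ∘ φ.symm) (κ.comp A) univ z := by
        have h4 := h1.2
        rwa [(𝓘(ℝ, M.Model)).range_eq_univ] at h4
      exact hasFDerivWithinAt_univ.1 h3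
    rw [h2.fderiv]
    rw [(𝓡 M.dim).range_eq_univ, mfderivWithin_univ] at hA
    have h3 : mfderiv 𝓘(ℝ, M.Model) (𝓡 M.dim) φ.symm z (hat Z z) = Z (φ.symm z) := by
      simp only [hat, VectorField.mpullbackWithin_apply, (𝓡 M.dim).range_eq_univ,
        mfderivWithin_univ]
      exact hA.self_apply_inverse _
    exact (congrArg (diff k (φ.symm z)) h3).symm
  have hdv : ∀ (k : M → ℝ), SmoothFun k → ∀ v : M.Model,
      diff k x v = fderiv ℝ (k ∘ φ.symm) (φ x) v := by
    intro k hk v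
    have h1 := hasFDerivAt_comp_extChart_symm (I := 𝓡 M.dim) (f := k) (x := x) (f' := diff k x)
      (hk.mdifferentiableAt x).hasMFDerivAt
    rw [h1.fderiv]
    rfl
  have hx : ∀ Z : (y : M) → M.T y, hat Z (φ x) = Z x := by
    intro Z
    have h1 : hat Z (φ x) = (mfderivWithin 𝓘(ℝ, M.Model) (𝓡 M.dim) φ.symm (range (𝓡 M.dim))
      (φ x)).inverse (Z (φ.symm (φ x))) := rfl
    have h2 := mfderivWithin_range_extChartAt_symm (I := 𝓡 M.dim) (x := x)
    rw [h1]
    have h4 : φ.symm (φ x) = x := φ.left_inv hxs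
    refine (inverse_apply_of_eq_id (E := M.Model) h2 _).trans ?_
    rw [h4]
  have hbr : VectorField.mlieBracket (𝓡 M.dim) X Y x =
      VectorField.lieBracket ℝ (hat X) (hat Y) (φ x) := by
    have h1 := VectorField.mlieBracketWithin_apply (I := 𝓡 M.dim) (V := X) (W := Y) (s := univ)
      (x₀ := x)
    rw [preimage_univ, univ_inter, mfderiv_extChartAt_self] at h1
    refine h1.trans ?_
    refine (inverse_apply_of_eq_id (E := M.Model) rfl _).trans ?_
    change VectorField.lieBracketWithin ℝ (hat X) (hat Y) (range (𝓡 M.dim)) (φ x) = _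
    rw [(𝓡 M.dim).range_eq_univ, VectorField.lieBracketWithin_univ]
  have hff : ContDiffAt ℝ ∞ (f ∘ φ.symm) (φ x) :=
    ((hf _).comp (φ x) (contMDiffAt_extChart_symm hxt)).contDiffAt
  have hsym : IsSymmSndFDerivAt ℝ (f ∘ φ.symm) (φ x) := hff.isSymmSndFDerivAt (by
    rw [minSmoothness_of_isRCLikeNormedField]; exact WithTop.coe_le_coe.2 le_top)
  have hf2 : DifferentiableAt ℝ (fderiv ℝ (f ∘ φ.symm)) (φ x) :=
    (hff.fderiv_right (m := 1) (by
      exact WithTop.coe_le_coe.2 le_top)).differentiableAt one_ne_zero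
  have hsec : ∀ {Z : (y : M) → M.T y}, SmoothField Z → ∀ v : M.Model,
      diff (fun y => diff f y (Z y)) x v =
        fderiv ℝ (fderiv ℝ (f ∘ φ.symm)) (φ x) v (hat Z (φ x)) +
          fderiv ℝ (f ∘ φ.symm) (φ x) (fderiv ℝ (hat Z) (φ x) v) := by
    intro Z hZ v
    rw [hdv _ (hZ.apply hf)]
    have h1 : (fun y => diff f y (Z y)) ∘ φ.symm =ᶠ[𝓝 (φ x)]
        fun z => fderiv ℝ (f ∘ φ.symm) z (hat Z z) := by
      filter_upwards [φ.open_target.mem_nhds hxt] with z hz'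
      exact hz z hz' Z f hf
    rw [h1.fderiv_eq, (hf2.hasFDerivAt.clm_apply (hd hZ).hasFDerivAt).fderiv]
    exact add_comm _ _
  have h3 := hsec hY (X x)
  have h4 := hsec hX (Y x)
  have h5 := hdv f hf (VectorField.mlieBracket (𝓡 M.dim) X Y x)
  rw [hbr] at h5
  have h6 : fderiv ℝ (f ∘ φ.symm) (φ x) (VectorField.lieBracket ℝ (hat X) (hat Y) (φ x)) =
    fderiv ℝ (f ∘ φ.symm) (φ x) (fderiv ℝ (hat Y) (φ x) (hat X (φ x))) -
      fderiv ℝ (f ∘ φ.symm) (φ x) (fderiv ℝ (hat X) (φ x) (hat Y (φ x))) := map_sub _ _ _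
  have h7 := hsym.eq (hat X (φ x)) (hat Y (φ x))
  rw [hbr, h5, h6, h3, h4]
  rw [hx X, hx Y] at h7
  simp only [hx]
  refine Eq.trans ?_ (congrArg (fun a => a + _ - _) h7.symm)
  exact (add_sub_add_left_eq_sub _ _ _).symm

end Calculus

/-! ## Submersions and immersions -/

section Maps

variable {M N B : Mfd.{u}}

theorem IsSurjSubmersion.exists_section {q : M → B} (hq : IsSurjSubmersion q) (x : M) :
    ∃ s : B → M, (∀ᶠ y in 𝓝 (q x), ContMDiffAt (𝓡 B.dim) (𝓡 M.dim) ∞ s y) ∧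
      (∀ᶠ y in 𝓝 (q x), q (s y) = y) ∧ s (q x) = x :=
  exists_local_section (Eventually.of_forall hq.smooth) (hq.submersion x)

/-- Near each point `f` is `f ∘ q` composed with a smooth local section of `q`. -/
theorem IsSurjSubmersion.smoothFun_of_comp {q : M → B} (hq : IsSurjSubmersion q) {f : B → ℝ}
    (hf : SmoothFun (f ∘ q)) : SmoothFun f := by
  intro b
  obtain ⟨x, rfl⟩ := hq.surjective b
  obtain ⟨s, hs, hqs, -⟩ := hq.exists_section x
  refine ((hf (s (q x))).comp (q x) hs.self_of_nhds).congr_of_eventuallyEq ?_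
  filter_upwards [hqs] with y hy
  simp [hy]

theorem IsSurjSubmersion.smooth_of_comp {q : M → B} (hq : IsSurjSubmersion q) {f : B → N}
    (hf : Smooth (f ∘ q)) : Smooth f := by
  intro b
  obtain ⟨x, rfl⟩ := hq.surjective b
  obtain ⟨s, hs, hqs, -⟩ := hq.exists_section x
  refine ((hf (s (q x))).comp (q x) hs.self_of_nhds).congr_of_eventuallyEq ?_
  filter_upwards [hqs] with y hy
  simp [hy]

theorem IsSurjSubmersion.isOpenMap {q : M → B} (hq : IsSurjSubmersion q) : IsOpenMap q := by
  rw [isOpenMap_iff_nhds_le]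
  intro x
  obtain ⟨s, hs, hqs, hsx⟩ := hq.exists_section x
  have h1 : Tendsto s (𝓝 (q x)) (𝓝 x) := by
    have := hs.self_of_nhds.continuousAt
    rwa [ContinuousAt, hsx] at this
  calc 𝓝 (q x) = map id (𝓝 (q x)) := map_id.symm
    _ = map (q ∘ s) (𝓝 (q x)) := map_congr (hqs.mono fun y hy => hy.symm)
    _ = map q (map s (𝓝 (q x))) := map_map.symm
    _ ≤ map q (𝓝 x) := map_mono h1

theorem exists_retraction_of_injective {j : M → N} (hj : Smooth j) {x : M}
    (hx : Injective (tmap j x)) :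
    ∃ r : N → M, (∀ᶠ y in 𝓝 (j x), ContMDiffAt (𝓡 N.dim) (𝓡 M.dim) ∞ r y) ∧
      ∀ᶠ y in 𝓝 x, r (j y) = y :=
  exists_local_retraction (Eventually.of_forall hj) hx

/-- A continuous map into an immersed submanifold is smooth if it is smooth as a map into the
ambient manifold. -/
theorem IsInjImmersion.smooth_of_comp {j : M → N} (hj : IsInjImmersion j) {f : B → M}
    (hf : Continuous f) (hjf : Smooth (j ∘ f)) : Smooth f := by
  intro b
  obtain ⟨r, hr, hrj⟩ := exists_retraction_of_injective hj.smooth (hj.immersion (f b))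
  have h1 := hr.self_of_nhds
  refine (ContMDiffAt.comp b (g := r) h1 (hjf b)).congr_of_eventuallyEq ?_
  filter_upwards [hf.continuousAt.eventually hrj] with y hy
  simp [hy]

/-- Smooth functions on an immersed submanifold extend locally. -/
theorem IsInjImmersion.exists_extension {j : M → N} (hj : IsInjImmersion j) {f : M → ℝ}
    (hf : SmoothFun f) (x : M) : ∃ k : N → ℝ, SmoothFun k ∧ k ∘ j =ᶠ[𝓝 x] f := by
  obtain ⟨r, hr, hrj⟩ := exists_retraction_of_injective hj.smooth (hj.immersion x)
  obtain ⟨k, hk, hk'⟩ := exists_smoothFun_eventuallyEq (x := j x) (f := f ∘ r) (by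
    filter_upwards [hr] with y hy
    exact (hf _).comp y hy)
  refine ⟨k, hk, ?_⟩
  filter_upwards [(hj.smooth x).continuousAt.eventually hk', hrj] with y hy hy'
  simp only [comp_apply] at hy ⊢
  rw [hy, hy']

end Maps

/-! ## Construction of manifolds -/

section Construction

variable {E : Type*} [NormedAddCommGroup E] [NormedSpace ℝ E]
  {H : Type*} [TopologicalSpace H] {I : ModelWithCorners ℝ E H}
  {X : Type*} [TopologicalSpace X] [ChartedSpace H X]

/-- A space `Z` with a map `i : Z → X` to a manifold becomes a manifold immersed by `i`, if it has
local homeomorphisms `ψ` to `ℝ^d` such that `i ∘ ψ⁻¹` is smooth and `ψ = l ∘ i` for some smooth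
map `l`. -/
theorem exists_mfd_of_charts {Z : Type u} [TopologicalSpace Z] [T2Space Z]
    [SecondCountableTopology Z] (d : ℕ) (i : Z → X)
    (h : ∀ z, ∃ (ψ : OpenPartialHomeomorph Z (EuclideanSpace ℝ (Fin d)))
      (l : X → EuclideanSpace ℝ (Fin d)), z ∈ ψ.source ∧
      (∀ w ∈ ψ.target, ContMDiffAt (𝓡 d) I ∞ (i ∘ ψ.symm) w) ∧
      ∀ w ∈ ψ.source, ContMDiffAt I (𝓡 d) ∞ l (i w) ∧ l (i w) = ψ w) :
    ∃ (S : Mfd.{u}) (e : S ≃ₜ Z), S.dim = d ∧ ContMDiff (𝓡 S.dim) I ∞ (i ∘ e) ∧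
      ∀ s, Injective (mfderiv (𝓡 S.dim) I (i ∘ e) s) := by
  choose ψ l hz hi hl using h
  let cs : ChartedSpace (EuclideanSpace ℝ (Fin d)) Z :=
    { atlas := range ψ
      chartAt := ψ
      mem_chart_source := hz
      chart_mem_atlas := fun z => mem_range_self z }
  -- A transition map is `l z'` applied to `i ∘ (ψ z).symm`, hence smooth: the coordinates extend to
  -- the ambient manifold.
  have hm : IsManifold (𝓡 d) ∞ Z := by
    apply isManifold_of_contDiffOn
    rintro _ _ ⟨z, rfl⟩ ⟨z', rfl⟩
    intro w hw
    have hw1 : w ∈ (ψ z).target := by simpa using hw.1.1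
    have hw2 : (ψ z).symm w ∈ (ψ z').source := by simpa using hw.1.2
    have h1 : ContMDiffAt (𝓡 d) (𝓡 d) ∞ (l z' ∘ (i ∘ (ψ z).symm)) w :=
      (hl z' _ hw2).1.comp w (hi z w hw1)
    have h2 : ContDiffAt ℝ ∞ (ψ z' ∘ (ψ z).symm) w := by
      refine h1.contDiffAt.congr_of_eventuallyEq ?_
      filter_upwards [((ψ z).symm.continuousAt hw1).preimage_mem_nhds
        ((ψ z').open_source.mem_nhds hw2)] with y hy
      exact ((hl z' _ hy).2).symm
    exact h2.contDiffWithinAt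
  have hs : ContMDiff (𝓡 d) I ∞ i := by
    intro z
    have h1 : ContMDiffAt (𝓡 d) (𝓡 d) ∞ (ψ z) z :=
      (contMDiffOn_chart (I := 𝓡 d) (x := z)).contMDiffAt ((ψ z).open_source.mem_nhds (hz z))
    refine ((hi z _ ((ψ z).map_source (hz z))).comp z h1).congr_of_eventuallyEq ?_
    filter_upwards [(ψ z).open_source.mem_nhds (hz z)] with y hy
    simp [(ψ z).left_inv hy]
  refine ⟨{ dim := d, carrier := Z }, Homeomorph.refl Z, rfl, hs, ?_⟩
  intro z
  have h1 : ContMDiffAt (𝓡 d) (𝓡 d) ∞ (ψ z) z :=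
      (contMDiffOn_chart (I := 𝓡 d) (x := z)).contMDiffAt ((ψ z).open_source.mem_nhds (hz z))
  have h2 : ContMDiffAt (𝓡 d) (𝓡 d) ∞ (ψ z).symm (ψ z z) :=
      (contMDiffOn_chart_symm (I := 𝓡 d) (x := z)).contMDiffAt
        ((ψ z).open_target.mem_nhds ((ψ z).map_source (hz z)))
  -- This local left inverse of `i` makes its tangent map injective.
  have h3 : ((ψ z).symm ∘ (l z ∘ i)) =ᶠ[𝓝 z] id := by
    filter_upwards [(ψ z).open_source.mem_nhds (hz z)] with y hy
    simp [(hl z y hy).2, (ψ z).left_inv hy]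
  have h4 := h3.mfderiv_eq (I := 𝓡 d) (I' := 𝓡 d)
  have hlz : l z (i z) = ψ z z := (hl z z (hz z)).2
  have hli : MDifferentiableAt (𝓡 d) (𝓡 d) (l z ∘ i) z :=
    ((hl z z (hz z)).1.comp z (hs z)).mdifferentiableAt (by simp)
  have h5 : mfderiv (𝓡 d) (𝓡 d) ((ψ z).symm ∘ (l z ∘ i)) z =
      (mfderiv (𝓡 d) (𝓡 d) (ψ z).symm (l z (i z))).comp (mfderiv (𝓡 d) (𝓡 d) (l z ∘ i) z) :=
    mfderiv_comp z ((hlz ▸ h2).mdifferentiableAt (by simp)) hli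
  have h6 : mfderiv (𝓡 d) (𝓡 d) (l z ∘ i) z =
      (mfderiv I (𝓡 d) (l z) (i z)).comp (mfderiv (𝓡 d) I i z) :=
    mfderiv_comp z ((hl z z (hz z)).1.mdifferentiableAt (by simp))
      ((hs z).mdifferentiableAt (by simp))
  rw [h4, h6, mfderiv_id] at h5
  intro v w hvw
  have hvw' : mfderiv (𝓡 d) I i z v = mfderiv (𝓡 d) I i z w := hvw
  have hv := congrArg (fun L : EuclideanSpace ℝ (Fin d) →L[ℝ] EuclideanSpace ℝ (Fin d) => L v) h5
  have hw := congrArg (fun L : EuclideanSpace ℝ (Fin d) →L[ℝ] EuclideanSpace ℝ (Fin d) => L w) h5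
  refine hv.trans (Eq.trans ?_ hw.symm)
  exact congrArg (fun t => mfderiv (𝓡 d) (𝓡 d) (ψ z).symm (l z (i z))
    (mfderiv I (𝓡 d) (l z) (i z) t)) hvw'

end Construction

/-! ### Submanifolds cut out by submersions -/

section ZeroLocus

variable {E : Type*} [NormedAddCommGroup E] [NormedSpace ℝ E] [FiniteDimensional ℝ E]
  {F : Type*} [NormedAddCommGroup F] [NormedSpace ℝ F] [FiniteDimensional ℝ F]
  {H : Type*} [TopologicalSpace H] {I : ModelWithCorners ℝ E H} [I.Boundaryless]
  {X : Type u} [TopologicalSpace X] [ChartedSpace H X] [IsManifold I ∞ X] [T2Space X]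
  [SecondCountableTopology X]

/-- A subset of a manifold, locally cut out by submersions, is a submanifold. -/
theorem exists_mfd_of_zeroLocus (Z : Set X) (d : ℕ)
    (hd : Z.Nonempty → Module.finrank ℝ E = Module.finrank ℝ F + d)
    (h : ∀ z ∈ Z, ∃ (G : X → F) (f' : E →L[ℝ] F), (∀ᶠ y in 𝓝 z, ContMDiffAt I 𝓘(ℝ, F) ∞ G y) ∧
      HasMFDerivAt I 𝓘(ℝ, F) G z f' ∧ Surjective f' ∧ ∀ᶠ y in 𝓝 z, y ∈ Z ↔ G y = 0) :
    ∃ (S : Mfd.{u}) (i : S → X), S.dim = d ∧ IsEmbedding i ∧ range i = Z ∧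
      ContMDiff (𝓡 S.dim) I ∞ i ∧ (∀ s, Injective (mfderiv (𝓡 S.dim) I i s)) ∧
      ∀ s, ∀ (G : X → F) (f' : E →L[ℝ] F), HasMFDerivAt I 𝓘(ℝ, F) G (i s) f' → Surjective f' →
        (∀ᶠ y in 𝓝 (i s), y ∈ Z → G y = 0) → ∀ v, f' v = 0 →
          v ∈ range (mfderiv (𝓡 S.dim) I i s) := by
  have hcharts : ∀ z : Z, ∃ (ψ : OpenPartialHomeomorph Z (EuclideanSpace ℝ (Fin d)))
      (l : X → EuclideanSpace ℝ (Fin d)), z ∈ ψ.source ∧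
      (∀ w ∈ ψ.target, ContMDiffAt (𝓡 d) I ∞ (Subtype.val ∘ ψ.symm) w) ∧
      ∀ w ∈ ψ.source, ContMDiffAt I (𝓡 d) ∞ l w ∧ l w = ψ w := by
    rintro ⟨z, hz⟩
    obtain ⟨G, f', hG, hG', hs, hZ⟩ := h z hz
    obtain ⟨e₀, he₀, hfst₀, hsm₀, hsm'₀⟩ := exists_submersion_chart hG hG' hs (hd ⟨z, hz⟩)
    obtain ⟨U, hU, hUo, hzU⟩ := eventually_nhds_iff.1 hZ
    obtain ⟨e, he, hfst, hsm, hsm', hZe⟩ : ∃ e : OpenPartialHomeomorph X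
        (F × EuclideanSpace ℝ (Fin d)), z ∈ e.source ∧ (∀ y ∈ e.source, (e y).1 = G y) ∧
        (∀ y ∈ e.source, ContMDiffAt I 𝓘(ℝ, F × EuclideanSpace ℝ (Fin d)) ∞ e y) ∧
        (∀ w ∈ e.target, ContMDiffAt 𝓘(ℝ, F × EuclideanSpace ℝ (Fin d)) I ∞ e.symm w) ∧
        ∀ y ∈ e.source, y ∈ Z ↔ G y = 0 := by
      refine ⟨e₀.restrOpen U hUo, ⟨he₀, hzU⟩, fun y hy => hfst₀ y hy.1, fun y hy => hsm₀ y hy.1,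
        fun w hw => ?_, fun y hy => hU y hy.2⟩
      exact hsm'₀ w hw.1
    have hinv : ∀ w : EuclideanSpace ℝ (Fin d), ((0 : F), w) ∈ e.target →
        e.symm (0, w) ∈ Z := by
      intro w hw
      have h1 := e.map_target hw
      rw [hZe _ h1, ← hfst _ h1, e.right_inv hw]
    have he2 : ∀ y ∈ e.source, y ∈ Z → e y = (0, (e y).2) := fun y hy hyZ =>
      Prod.ext (by rw [hfst y hy]; exact (hZe y hy).1 hyZ) rfl
    classical
    -- The inverse chart is the slice of `e.symm` at first coordinate 0. Its value off the target is
    -- an arbitrary point of `Z` and plays no role.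
    let g : EuclideanSpace ℝ (Fin d) → Z := fun w =>
      if hw : ((0 : F), w) ∈ e.target then ⟨e.symm (0, w), hinv w hw⟩ else ⟨z, hz⟩
    have hg : ∀ w, ((0 : F), w) ∈ e.target → (g w : X) = e.symm (0, w) := by
      intro w hw
      simp only [g, dif_pos hw]
    have hto : IsOpen {w : EuclideanSpace ℝ (Fin d) | ((0 : F), w) ∈ e.target} :=
      e.open_target.preimage (by fun_prop)
    have hcont : ∀ w : EuclideanSpace ℝ (Fin d), ((0 : F), w) ∈ e.target →
        ContMDiffAt (𝓡 d) I ∞ (Subtype.val ∘ g) w := by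
      intro w hw
      have h1 : ContMDiffAt (𝓡 d) I ∞ (fun w => e.symm ((0 : F), w)) w :=
        (hsm' _ hw).comp w (contMDiffAt_const.prodMk_space contMDiffAt_id)
      refine h1.congr_of_eventuallyEq ?_
      filter_upwards [hto.mem_nhds hw] with y hy
      exact hg y hy
    let ψ : OpenPartialHomeomorph Z (EuclideanSpace ℝ (Fin d)) :=
      { toFun := fun y => (e y).2
        invFun := g
        source := Subtype.val ⁻¹' e.source
        target := {w | ((0 : F), w) ∈ e.target}
        map_source' := by
          intro y hy
          change (0, (e y).2) ∈ e.target
          rw [← he2 y hy y.2]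
          exact e.map_source hy
        map_target' := by
          intro w hw
          change (g w : X) ∈ e.source
          rw [hg w hw]
          exact e.map_target hw
        left_inv' := by
          intro y hy
          apply Subtype.ext
          have h1 := he2 y hy y.2
          rw [hg _ (by rw [← h1]; exact e.map_source hy), ← h1, e.left_inv hy]
        right_inv' := by
          intro w hw
          rw [hg w hw, e.right_inv hw]
        open_source := e.open_source.preimage continuous_subtype_val
        open_target := hto
        continuousOn_toFun := fun y hy => ContinuousAt.continuousWithinAt
          (continuousAt_snd.comp ((e.continuousAt hy).comp continuousAt_subtype_val))
        continuousOn_invFun := fun w hw => ContinuousAt.continuousWithinAt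
          (IsInducing.subtypeVal.continuousAt_iff.2 (hcont w hw).continuousAt) }
    refine ⟨ψ, fun y => (e y).2, he, hcont, fun w hw => ⟨?_, rfl⟩⟩
    exact contDiff_snd.contMDiff.contMDiffAt.comp _ (hsm w hw)
  obtain ⟨S, e, hdim, hsm, himm⟩ := exists_mfd_of_charts d (Subtype.val : Z → X) hcharts
  refine ⟨S, Subtype.val ∘ e, hdim, IsEmbedding.subtypeVal.comp e.isEmbedding, ?_, hsm, himm, ?_⟩
  · rw [range_comp, e.surjective.range_eq, image_univ, Subtype.range_val]
  · intro s G f' hG hf' hGZ v hv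
    have hi := ((hsm s).mdifferentiableAt (by simp)).hasMFDerivAt
    let A : S.Model →L[ℝ] E := mfderiv (𝓡 S.dim) I (Subtype.val ∘ e) s
    have hA : Injective A := himm s
    have hcomp : ∀ w : S.Model, f' (A w) = 0 := by
      have h1 := hG.comp s hi
      have h2 : (G ∘ (Subtype.val ∘ e)) =ᶠ[𝓝 s] fun _ => (0 : F) := by
        have := (hsm s).continuousAt.eventually hGZ
        filter_upwards [this] with y hy
        exact hy (e y).2
      have h3 := h1.mfderiv
      rw [h2.mfderiv_eq, mfderiv_const] at h3
      intro w
      exact (congrArg (fun L : S.Model →L[ℝ] F => L w) h3).symm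
    -- `G` vanishes on `Z`, so the tangent space lies in the kernel of `f'`; both have dimension
    -- `d`.
    have hle : LinearMap.range (A : S.Model →ₗ[ℝ] E) ≤ LinearMap.ker (f' : E →ₗ[ℝ] F) := by
      rintro _ ⟨w, rfl⟩
      exact hcomp w
    have heq := Submodule.eq_of_le_of_finrank_eq hle (by
      rw [LinearMap.finrank_range_of_inj hA]
      have h1 := LinearMap.finrank_range_add_finrank_ker (f' : E →ₗ[ℝ] F)
      rw [LinearMap.range_eq_top.2 hf', finrank_top] at h1
      have h2 := hd ⟨_, (e s).2⟩
      have h3 : Module.finrank ℝ S.Model = S.dim := by simp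
      omega)
    have hv' : v ∈ LinearMap.range (A : S.Model →ₗ[ℝ] E) := by rw [heq]; exact hv
    exact hv'

end ZeroLocus

/-! ## Quotients by the fibres of a map of constant rank -/

section ConstantRank

variable {S Q : Mfd.{u}} {F : S → Q}

theorem hasFDerivAt_of_hasMFDerivAt {V W : Type*} [NormedAddCommGroup V] [NormedSpace ℝ V]
    [NormedAddCommGroup W] [NormedSpace ℝ W] {f : V → W} {f' : V →L[ℝ] W} {x : V}
    (h : HasMFDerivAt 𝓘(ℝ, V) 𝓘(ℝ, W) f x f') : HasFDerivAt f f' x :=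
  hasMFDerivAt_iff_hasFDerivAt.1 h

/-- The first coordinate factors through `F`, so the derivative of `e` maps the kernel of the
tangent map of `F` into the second factor. It does so injectively, and both spaces have dimension
`k`; hence the second factor is exactly the image of the kernel. This is where constancy of the rank
enters. -/
theorem tmap_mfderiv_symm_apply_eq_zero (hF : Smooth F) {k m : ℕ}
    (hk : ∀ s, Module.finrank ℝ (LinearMap.ker (tmap F s : S.T s →ₗ[ℝ] Q.T (F s))) = k)
    (e : OpenPartialHomeomorph S (EuclideanSpace ℝ (Fin m) × EuclideanSpace ℝ (Fin k)))
    (hsm' : ∀ w ∈ e.target, ContMDiffAt 𝓘(ℝ, EuclideanSpace ℝ (Fin m) ×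
        EuclideanSpace ℝ (Fin k)) (𝓡 S.dim) ∞ e.symm w)
    (hsm : ∀ y ∈ e.source, ContMDiffAt (𝓡 S.dim) 𝓘(ℝ, EuclideanSpace ℝ (Fin m) ×
      EuclideanSpace ℝ (Fin k)) ∞ e y)
    (l : Q → EuclideanSpace ℝ (Fin m))
    (hl : ∀ y ∈ e.source, ContMDiffAt (𝓡 Q.dim) (𝓡 m) ∞ l (F y))
    (hfst : ∀ y ∈ e.source, (e y).1 = l (F y)) :
    ∀ w ∈ e.target, ∀ v : EuclideanSpace ℝ (Fin k),
      tmap F (e.symm w) (mfderiv 𝓘(ℝ, EuclideanSpace ℝ (Fin m) × EuclideanSpace ℝ (Fin k))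
        (𝓡 S.dim) e.symm w ((0 : EuclideanSpace ℝ (Fin m)), v)) = 0 := by
  intro w hw
  obtain ⟨y, hy, rfl⟩ : ∃ y ∈ e.source, e y = w := ⟨e.symm w, e.map_target hw, e.right_inv hw⟩
  rw [e.left_inv hy]
  let A : S.Model →L[ℝ] EuclideanSpace ℝ (Fin m) × EuclideanSpace ℝ (Fin k) :=
    mfderiv (𝓡 S.dim) 𝓘(ℝ, EuclideanSpace ℝ (Fin m) × EuclideanSpace ℝ (Fin k)) e y
  let B : EuclideanSpace ℝ (Fin m) × EuclideanSpace ℝ (Fin k) →L[ℝ] S.Model :=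
    mfderiv 𝓘(ℝ, EuclideanSpace ℝ (Fin m) × EuclideanSpace ℝ (Fin k)) (𝓡 S.dim) e.symm (e y)
  have hA : HasMFDerivAt (𝓡 S.dim) 𝓘(ℝ, EuclideanSpace ℝ (Fin m) ×
      EuclideanSpace ℝ (Fin k)) e y A := ((hsm y hy).mdifferentiableAt (by simp)).hasMFDerivAt
  have hB : HasMFDerivAt 𝓘(ℝ, EuclideanSpace ℝ (Fin m) × EuclideanSpace ℝ (Fin k)) (𝓡 S.dim)
      e.symm (e y) B := ((hsm' _ hw).mdifferentiableAt (by simp)).hasMFDerivAt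
  have hBA : ∀ v, B (A v) = v := by
    have h1 : HasMFDerivAt (𝓡 S.dim) (𝓡 S.dim) (e.symm ∘ e) y (B.comp A) := hB.comp y hA
    have h2 : (e.symm ∘ e) =ᶠ[𝓝 y] id := by
      filter_upwards [e.open_source.mem_nhds hy] with x hx
      exact e.left_inv hx
    have h3 := h1.mfderiv
    rw [h2.mfderiv_eq, mfderiv_id] at h3
    intro v
    exact (congrArg (fun L : S.Model →L[ℝ] S.Model => L v) h3).symm
  let Fy : S.Model →L[ℝ] Q.Model := tmap F y
  have hFy : HasMFDerivAt (𝓡 S.dim) (𝓡 Q.dim) F y Fy := (hF.mdifferentiableAt y).hasMFDerivAt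
  have hA1 : ∀ v, Fy v = 0 → (A v).1 = 0 := by
    intro v hv
    have h1 : HasMFDerivAt (𝓡 S.dim) (𝓡 m) (fun x => (e x).1) y
        ((ContinuousLinearMap.fst ℝ (EuclideanSpace ℝ (Fin m))
          (EuclideanSpace ℝ (Fin k))).comp A) :=
      (ContinuousLinearMap.fst ℝ (EuclideanSpace ℝ (Fin m))
        (EuclideanSpace ℝ (Fin k))).hasMFDerivAt.comp y hA
    let L : Q.Model →L[ℝ] EuclideanSpace ℝ (Fin m) := mfderiv (𝓡 Q.dim) (𝓡 m) l (F y)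
    have h2 : HasMFDerivAt (𝓡 S.dim) (𝓡 m) (l ∘ F) y (L.comp Fy) :=
      ((hl y hy).mdifferentiableAt (by simp)).hasMFDerivAt.comp y hFy
    have h3 : (fun x => (e x).1) =ᶠ[𝓝 y] l ∘ F := by
      filter_upwards [e.open_source.mem_nhds hy] with x hx
      exact hfst x hx
    have h4 := h1.mfderiv.symm.trans (h3.mfderiv_eq.trans h2.mfderiv)
    refine (congrArg (fun L : S.Model →L[ℝ] EuclideanSpace ℝ (Fin m) => L v) h4).trans ?_
    change L (Fy v) = 0
    rw [hv, map_zero]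
  let K := LinearMap.ker (Fy : S.Model →ₗ[ℝ] Q.Model)
  have hKk : Module.finrank ℝ K = k := hk y
  let A2 : K →ₗ[ℝ] EuclideanSpace ℝ (Fin k) :=
    LinearMap.snd ℝ (EuclideanSpace ℝ (Fin m)) (EuclideanSpace ℝ (Fin k)) ∘ₗ A.toLinearMap ∘ₗ K.subtype
  have hA2 : Injective A2 := by
    rw [injective_iff_map_eq_zero]
    rintro ⟨v, hv⟩ h0
    have h1 : A v = 0 := Prod.ext (hA1 v hv) h0
    have h2 := hBA v
    rw [h1, map_zero] at h2
    exact Subtype.ext h2.symm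
  have hA2s : Surjective A2 :=
    (LinearMap.injective_iff_surjective_of_finrank_eq_finrank (by simp [hKk])).1 hA2
  intro v
  obtain ⟨⟨x, hx⟩, hxv⟩ := hA2s v
  have h1 : A x = (0, v) := Prod.ext (hA1 x hx) hxv
  have h2 := hBA x
  rw [h1] at h2
  change Fy (B (0, v)) = 0
  rw [h2]
  exact hx

/-- A ball of a product is a product of balls, so the slices of the target are convex, and a map
with zero derivative on a convex set is constant. The chart at `q` brings `F` into a vector space.
-/
theorem comp_symm_eq_of_tmap_eq_zero (hF : Smooth F) {k m : ℕ}
    (e : OpenPartialHomeomorph S (EuclideanSpace ℝ (Fin m) × EuclideanSpace ℝ (Fin k)))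
    {z : S} {r : ℝ} (het : e.target = Metric.ball (e z) r) (q : Q)
    (hφ : ∀ y ∈ e.source, F y ∈ (extChart (𝓡 Q.dim) q).source)
    (hsm' : ∀ w ∈ e.target, ContMDiffAt 𝓘(ℝ, EuclideanSpace ℝ (Fin m) ×
        EuclideanSpace ℝ (Fin k)) (𝓡 S.dim) ∞ e.symm w)
    (hkill : ∀ w ∈ e.target, ∀ v : EuclideanSpace ℝ (Fin k),
      tmap F (e.symm w) (mfderiv 𝓘(ℝ, EuclideanSpace ℝ (Fin m) × EuclideanSpace ℝ (Fin k))
        (𝓡 S.dim) e.symm w ((0 : EuclideanSpace ℝ (Fin m)), v)) = 0) :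
    ∀ (a : EuclideanSpace ℝ (Fin m)) (b b' : EuclideanSpace ℝ (Fin k)),
      (a, b) ∈ e.target → (a, b') ∈ e.target → F (e.symm (a, b)) = F (e.symm (a, b')) := by
  intro a b b' hb hb'
  have hmem : ∀ x, (a, x) ∈ e.target ↔ a ∈ Metric.ball (e z).1 r ∧ x ∈ Metric.ball (e z).2 r := by
    intro x
    rw [het, ← ball_prod_same]
    rfl
  have hder : ∀ x ∈ Metric.ball (e z).2 r,
      HasFDerivAt (fun x => extChart (𝓡 Q.dim) q (F (e.symm (a, x))))
        (0 : EuclideanSpace ℝ (Fin k) →L[ℝ] Q.Model) x := by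
    intro x hx
    have hxt : (a, x) ∈ e.target := (hmem x).2 ⟨((hmem b).1 hb).1, hx⟩
    let B : EuclideanSpace ℝ (Fin m) × EuclideanSpace ℝ (Fin k) →L[ℝ] S.Model :=
      mfderiv 𝓘(ℝ, EuclideanSpace ℝ (Fin m) × EuclideanSpace ℝ (Fin k)) (𝓡 S.dim) e.symm (a, x)
    let ι : EuclideanSpace ℝ (Fin k) →L[ℝ] EuclideanSpace ℝ (Fin m) × EuclideanSpace ℝ (Fin k) :=
      ContinuousLinearMap.inr ℝ (EuclideanSpace ℝ (Fin m)) (EuclideanSpace ℝ (Fin k))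
    let Fy : S.Model →L[ℝ] Q.Model := tmap F (e.symm (a, x))
    let D : Q.Model →L[ℝ] Q.Model :=
      mfderiv (𝓡 Q.dim) (𝓡 Q.dim) (extChart (𝓡 Q.dim) q) (F (e.symm (a, x)))
    have h0 : HasMFDerivAt (𝓡 k) 𝓘(ℝ, EuclideanSpace ℝ (Fin m) × EuclideanSpace ℝ (Fin k))
        (fun x => (a, x)) x ι :=
      hasMFDerivAt_iff_hasFDerivAt.2 (hasFDerivAt_prodMk_right a x)
    have h1 : HasMFDerivAt (𝓡 k) (𝓡 S.dim) (fun x => e.symm (a, x)) x (B.comp ι) :=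
      ((hsm' _ hxt).mdifferentiableAt (by simp)).hasMFDerivAt.comp x h0
    have h2 : HasMFDerivAt (𝓡 k) (𝓡 Q.dim) (fun x => F (e.symm (a, x))) x
        (Fy.comp (B.comp ι)) := (hF.mdifferentiableAt _).hasMFDerivAt.comp x h1
    have h3 : HasMFDerivAt (𝓡 k) (𝓡 Q.dim) (fun x => extChart (𝓡 Q.dim) q (F (e.symm (a, x)))) x
        (D.comp (Fy.comp (B.comp ι))) :=
      ((contMDiffAt_extChart (hφ _ (e.map_target hxt))).mdifferentiableAt
        (by simp)).hasMFDerivAt.comp x h2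
    have h4 : D.comp (Fy.comp (B.comp ι)) = 0 := by
      refine ContinuousLinearMap.ext fun v => ?_
      have h5 : Fy (B (ι v)) = 0 := hkill _ hxt v
      exact (congrArg D h5).trans (map_zero D)
    exact h4 ▸ hasFDerivAt_of_hasMFDerivAt h3
  have hc := (convex_ball (e z).2 r).is_const_of_fderivWithin_eq_zero (𝕜 := ℝ)
    (f := fun x => extChart (𝓡 Q.dim) q (F (e.symm (a, x))))
    (fun x hx => (hder x hx).differentiableAt.differentiableWithinAt) (by
      intro x hx
      rw [fderivWithin_of_isOpen Metric.isOpen_ball hx, (hder x hx).fderiv])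
    ((hmem b).1 hb).2 ((hmem b').1 hb').2
  exact (extChart (𝓡 Q.dim) q).injOn (hφ _ (e.map_target hb)) (hφ _ (e.map_target hb')) hc

/-- The constant rank theorem. -/
theorem exists_constantRank_chart (hF : Smooth F) {k : ℕ}
    (hk : ∀ s, Module.finrank ℝ (LinearMap.ker (tmap F s : S.T s →ₗ[ℝ] Q.T (F s))) = k) (z : S) :
    ∃ (e : OpenPartialHomeomorph S
        (EuclideanSpace ℝ (Fin (S.dim - k)) × EuclideanSpace ℝ (Fin k)))
      (l : Q → EuclideanSpace ℝ (Fin (S.dim - k))), z ∈ e.source ∧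
      (∃ ε, e.target = Metric.ball (e z) ε) ∧
      (∀ w ∈ e.target, ContMDiffAt 𝓘(ℝ, EuclideanSpace ℝ (Fin (S.dim - k)) ×
        EuclideanSpace ℝ (Fin k)) (𝓡 S.dim) ∞ e.symm w) ∧
      (∀ y ∈ e.source, ContMDiffAt (𝓡 Q.dim) (𝓡 (S.dim - k)) ∞ l (F y) ∧ l (F y) = (e y).1) ∧
      ∀ y ∈ e.source, ∀ y' ∈ e.source, (e y).1 = (e y').1 → F y = F y' := by
  set m := S.dim - k with hm
  let F' : S.Model →L[ℝ] Q.Model := tmap F z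
  have hFz : HasMFDerivAt (𝓡 S.dim) (𝓡 Q.dim) F z F' := (hF.mdifferentiableAt z).hasMFDerivAt
  have hrk := LinearMap.finrank_range_add_finrank_ker (F' : S.Model →ₗ[ℝ] Q.Model)
  have hkz : Module.finrank ℝ (LinearMap.ker (F' : S.Model →ₗ[ℝ] Q.Model)) = k := hk z
  have hdim : Module.finrank ℝ S.Model = S.dim := by simp
  -- Projecting in a chart onto the image of the tangent map at `z`, whose dimension is `S.dim - k`,
  -- turns `F` into a submersion near `z`.
  obtain ⟨W, hW⟩ := Submodule.exists_isCompl (LinearMap.range (F' : S.Model →ₗ[ℝ] Q.Model))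
  let ε : LinearMap.range (F' : S.Model →ₗ[ℝ] Q.Model) ≃ₗ[ℝ] EuclideanSpace ℝ (Fin m) :=
    LinearEquiv.ofFinrankEq _ _ (by
      have : Module.finrank ℝ (EuclideanSpace ℝ (Fin m)) = m := by simp
      omega)
  let p : Q.Model →L[ℝ] EuclideanSpace ℝ (Fin m) :=
    LinearMap.toContinuousLinearMap (ε.toLinearMap ∘ₗ Submodule.projectionOnto _ W hW)
  have hp : Surjective (p.comp F') := by
    intro w
    obtain ⟨v, hv⟩ := (ε.symm w).2
    refine ⟨v, ?_⟩
    have h1 : Submodule.projectionOnto _ W hW (F' v) = ε.symm w := by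
      rw [show F' v = ((ε.symm w : LinearMap.range (F' : S.Model →ₗ[ℝ] Q.Model)) : Q.Model)
        from hv]
      exact Submodule.projectionOnto_apply_left hW _
    change ε (Submodule.projectionOnto _ W hW (F' v)) = w
    rw [h1, ε.apply_symm_apply]
  set φ := extChart (𝓡 Q.dim) (F z) with hφ
  have hφs : F z ∈ φ.source := mem_extChart_source _
  let l : Q → EuclideanSpace ℝ (Fin m) := fun x => p (φ x)
  have hl : ∀ x ∈ φ.source, ContMDiffAt (𝓡 Q.dim) (𝓡 m) ∞ l x := fun x hx =>
    p.contMDiff.contMDiffAt.comp x (contMDiffAt_extChart hx)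
  have hU : IsOpen (F ⁻¹' φ.source) := φ.open_source.preimage hF.continuous
  have hlF : HasMFDerivAt (𝓡 S.dim) (𝓡 m) (l ∘ F) z (p.comp F') :=
    p.hasMFDerivAt.comp z ((hasMFDerivAt_extChart_self (F z)).comp z hFz)
  obtain ⟨e₀, he₀, hfst₀, hsm₀, hsm'₀⟩ := exists_submersion_chart (I := 𝓡 S.dim) (d := k)
    (f := l ∘ F) (x := z) (by
      filter_upwards [hU.mem_nhds hφs] with y hy
      exact (hl _ hy).comp y (hF y)) hlF hp (by
      have h1 : Module.finrank ℝ (EuclideanSpace ℝ (Fin m)) = m := by simp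
      have h2 : Module.finrank ℝ (EuclideanSpace ℝ (Fin S.dim)) = S.dim := by simp
      have h3 : Module.finrank ℝ S.Model = S.dim := by simp
      omega)
  let e₁ := e₀.restrOpen _ hU
  have he₁ : z ∈ e₁.source := ⟨he₀, hφs⟩
  -- The target is shrunk to a ball so that its slices are convex.
  obtain ⟨r, hr, hball⟩ := Metric.isOpen_iff.1 e₁.open_target _ (e₁.map_source he₁)
  let e := (e₁.symm.restrOpen (Metric.ball (e₁ z) r) Metric.isOpen_ball).symm
  have het : e.target = Metric.ball (e z) r := by
    change e₁.target ∩ Metric.ball (e₁ z) r = Metric.ball (e₁ z) r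
    exact inter_eq_right.2 hball
  have hes : ∀ y ∈ e.source, y ∈ e₀.source ∧ F y ∈ φ.source := by
    intro y hy
    have h1 : y ∈ e₁.source := by
      have := e.map_source hy
      have h2 := e₁.map_target (hball (het ▸ this))
      have h3 : e₁.symm (e y) = y := e.left_inv hy
      rwa [h3] at h2
    exact ⟨h1.1, h1.2⟩
  have hze : z ∈ e.source := by
    have h1 := e.map_target (x := e z) (by rw [het]; exact Metric.mem_ball_self hr)
    have h2 : e.symm (e z) = z := e₁.left_inv he₁
    rwa [h2] at h1
  have hsm' : ∀ w ∈ e.target, ContMDiffAt 𝓘(ℝ, EuclideanSpace ℝ (Fin m) ×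
        EuclideanSpace ℝ (Fin k)) (𝓡 S.dim) ∞ e.symm w := by
    intro w hw
    exact hsm'₀ w (hball (het ▸ hw)).1
  have hfst : ∀ y ∈ e.source, (e y).1 = l (F y) := fun y hy => hfst₀ y (hes y hy).1
  refine ⟨e, l, hze, ⟨r, het⟩, hsm', fun y hy => ⟨hl _ (hes y hy).2, (hfst y hy).symm⟩, ?_⟩
  have hsm : ∀ y ∈ e.source, ContMDiffAt (𝓡 S.dim) 𝓘(ℝ, EuclideanSpace ℝ (Fin m) ×
      EuclideanSpace ℝ (Fin k)) ∞ e y := fun y hy => hsm₀ y (hes y hy).1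
  have hconst := comp_symm_eq_of_tmap_eq_zero hF e het (F z) (fun y hy => (hes y hy).2) hsm'
    (tmap_mfderiv_symm_apply_eq_zero hF hk e hsm' hsm l (fun y hy => hl _ (hes y hy).2) hfst)
  intro y hy y' hy' h
  have h1 := hconst (e y).1 (e y).2 (e y').2 (e.map_source hy) (by rw [h]; exact e.map_source hy')
  rw [Prod.mk.eta, e.left_inv hy] at h1
  rw [h1, h, Prod.mk.eta, e.left_inv hy']

/-- Points near `a` can be moved along the fibres of `F` to points near `b`. -/
def FibreTransport (F : S → Q) (a b : S) : Prop := ∀ V ∈ 𝓝 b, F ⁻¹' (F '' V) ∈ 𝓝 a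

theorem FibreTransport.refl (F : S → Q) (a : S) : FibreTransport F a a := fun V hV =>
  mem_of_superset hV (subset_preimage_image F V)

theorem FibreTransport.trans {a b c : S} (h : FibreTransport F a b) (h' : FibreTransport F b c) :
    FibreTransport F a c := by
  intro V hV
  refine mem_of_superset (h _ (h' V hV)) ?_
  rintro x ⟨y, ⟨z, hz, hzy⟩, hyx⟩
  exact ⟨z, hz, hzy.trans hyx⟩

/-- In a constant rank chart, replacing the second coordinate by that of the destination moves
points continuously without changing `F`. -/
theorem eventually_fibreTransport (hF : Smooth F) {k : ℕ}
    (hk : ∀ s, Module.finrank ℝ (LinearMap.ker (tmap F s : S.T s →ₗ[ℝ] Q.T (F s))) = k) (z : S) :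
    ∀ᶠ y in 𝓝 z, F y = F z → FibreTransport F y z ∧ FibreTransport F z y := by
  obtain ⟨e, l, hz, ⟨r, het⟩, hsm, hl, he⟩ := exists_constantRank_chart hF hk z
  have key : ∀ y ∈ e.source, ∀ y' ∈ e.source, F y = F y' → FibreTransport F y y' := by
    intro y hy y' hy' h V hV
    have hprod : ∀ x ∈ e.source, ((e x).1, (e y').2) ∈ e.target := by
      intro x hx
      have h1 := e.map_source hx
      have h2 := e.map_source hy'
      rw [het, ← ball_prod_same] at h1 h2 ⊢
      exact ⟨h1.1, h2.2⟩
    have h1 : ((e y).1, (e y').2) = e y' :=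
      Prod.ext (by rw [← (hl y hy).2, ← (hl y' hy').2, h]) rfl
    have h2 : Tendsto (fun x => e.symm ((e x).1, (e y').2)) (𝓝 y) (𝓝 y') := by
      have h3 : ContinuousAt e.symm ((e y).1, (e y').2) := e.symm.continuousAt (hprod y hy)
      have h4 : ContinuousAt (fun x => ((e x).1, (e y').2)) y :=
        (continuousAt_fst.comp (e.continuousAt hy)).prodMk continuousAt_const
      have h5 := ContinuousAt.comp (f := fun x => ((e x).1, (e y').2)) h3 h4
      rw [ContinuousAt, comp_apply, h1, e.left_inv hy'] at h5
      exact h5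
    filter_upwards [h2.eventually hV, e.open_source.mem_nhds hy] with x hx hxs
    refine ⟨_, hx, ?_⟩
    have hxt := hprod x hxs
    refine he _ (e.map_target hxt) _ hxs ?_
    rw [e.right_inv hxt]
  filter_upwards [e.open_source.mem_nhds hz] with y hy h
  exact ⟨key y hy z hz h, key z hz y hy h.symm⟩

/-- Transport is transitive and, along a path in one fibre, holds locally in both directions;
connectedness of the interval does the rest. -/
theorem fibreTransport_of_path (hF : Smooth F) {k : ℕ}
    (hk : ∀ s, Module.finrank ℝ (LinearMap.ker (tmap F s : S.T s →ₗ[ℝ] Q.T (F s))) = k)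
    {γ : ℝ → S} (hγ : ContinuousOn γ (Icc 0 1))
    (hγF : ∀ τ ∈ Icc (0 : ℝ) 1, ∀ τ' ∈ Icc (0 : ℝ) 1, F (γ τ) = F (γ τ')) :
    FibreTransport F (γ 0) (γ 1) := by
  refine isPreconnected_Icc.induction₂' (s := Icc (0 : ℝ) 1)
    (fun a b => FibreTransport F (γ a) (γ b)) ?_ ?_ (left_mem_Icc.2 zero_le_one)
    (right_mem_Icc.2 zero_le_one)
  · intro x hx
    filter_upwards [(hγ x hx).eventually (eventually_fibreTransport hF hk (γ x)),
      self_mem_nhdsWithin] with y hy hyI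
    exact (hy (hγF y hyI x hx)).symm
  · intro x y z _ _ _ h h'
    exact h.trans h'

/-- The quotient of a manifold by the fibres of a map of constant rank with path connected
fibres. -/
theorem exists_quotient_of_constantRank (hF : Smooth F) {k : ℕ}
    (hk : ∀ s, Module.finrank ℝ (LinearMap.ker (tmap F s : S.T s →ₗ[ℝ] Q.T (F s))) = k)
    (hpath : ∀ a b, F a = F b → Relation.ReflTransGen (fun x y => ∃ γ : ℝ → S,
      ContinuousOn γ (Icc 0 1) ∧ (∀ τ ∈ Icc (0 : ℝ) 1, ∀ τ' ∈ Icc (0 : ℝ) 1, F (γ τ) = F (γ τ')) ∧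
        γ 0 = x ∧ γ 1 = y) a b) :
    ∃ (M' : Mfd.{u}) (r : S → M') (ι : M' → Q), IsSurjSubmersion r ∧ IsInjImmersion ι ∧
      ∀ s, ι (r s) = F s := by
  have htr : ∀ a b, F a = F b → FibreTransport F a b := by
    intro a b hab
    have hab' := hpath a b hab
    clear hab
    induction hab' with
    | refl => exact FibreTransport.refl F a
    | tail _ h2 ih =>
      obtain ⟨γ, hγ, hγF, rfl, rfl⟩ := h2
      exact ih.trans (fibreTransport_of_path hF hk hγ hγF)
  let Z := Quotient (Setoid.ker F)
  let mk : S → Z := Quotient.mk _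
  let i : Z → Q := Quotient.lift F (fun _ _ h => h)
  have himk : ∀ s, i (mk s) = F s := fun s => rfl
  have hinj : Injective i := by
    intro a b
    induction a using Quotient.inductionOn
    induction b using Quotient.inductionOn
    intro h
    exact Quotient.sound h
  have hmkc : Continuous mk := continuous_quot_mk
  have hic : Continuous i := hF.continuous.quotient_lift _
  -- Transport along fibres shows that the saturation of an open set is open; path connectedness of
  -- the fibres is used only here.
  have hopen : IsOpenMap mk := by
    intro V hV
    have h1 : IsOpen (mk ⁻¹' (mk '' V)) := by
      rw [isOpen_iff_mem_nhds]
      rintro a ⟨b, hb, hab⟩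
      have hFab : F a = F b := congrArg i hab.symm
      refine mem_of_superset (htr a b hFab V (hV.mem_nhds hb)) ?_
      rintro x ⟨y, hy, hyx⟩
      exact ⟨y, hy, Quotient.sound hyx⟩
    exact h1
  have hT2 : T2Space Z := T2Space.of_injective_continuous hinj hic
  have hsc : SecondCountableTopology Z :=
    (isQuotientMap_quot_mk (X := S)).secondCountableTopology hopen
  -- The first coordinate of a constant rank chart is a chart of the quotient, with inverse given by
  -- the slice through `z`.
  have hcharts : ∀ ζ : Z, ∃ (ψ : OpenPartialHomeomorph Z (EuclideanSpace ℝ (Fin (S.dim - k))))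
      (l : Q → EuclideanSpace ℝ (Fin (S.dim - k))), ζ ∈ ψ.source ∧
      (∀ w ∈ ψ.target, ContMDiffAt (𝓡 (S.dim - k)) (𝓡 Q.dim) ∞ (i ∘ ψ.symm) w) ∧
      ∀ w ∈ ψ.source, ContMDiffAt (𝓡 Q.dim) (𝓡 (S.dim - k)) ∞ l (i w) ∧ l (i w) = ψ w := by
    intro ζ
    obtain ⟨z, rfl⟩ : ∃ z, mk z = ζ := Quotient.exists_rep ζ
    obtain ⟨e, l, hz, ⟨r, het⟩, hsm, hl, he⟩ := exists_constantRank_chart hF hk z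
    have hto : IsOpen {w : EuclideanSpace ℝ (Fin (S.dim - k)) | (w, (e z).2) ∈ e.target} :=
      e.open_target.preimage (by fun_prop)
    have hprod : ∀ x ∈ e.source, ((e x).1, (e z).2) ∈ e.target := by
      intro x hx
      have h1 := e.map_source hx
      have h2 := e.map_source hz
      rw [het, ← ball_prod_same] at h1 h2 ⊢
      exact ⟨h1.1, h2.2⟩
    have hsmg : ∀ w : EuclideanSpace ℝ (Fin (S.dim - k)), (w, (e z).2) ∈ e.target →
        ContMDiffAt (𝓡 (S.dim - k)) (𝓡 S.dim) ∞ (fun w => e.symm (w, (e z).2)) w := fun w hw =>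
      (hsm _ hw).comp w (contMDiffAt_id.prodMk_space contMDiffAt_const)
    let ψ : OpenPartialHomeomorph Z (EuclideanSpace ℝ (Fin (S.dim - k))) :=
      { toFun := fun ζ => l (i ζ)
        invFun := fun w => mk (e.symm (w, (e z).2))
        source := mk '' e.source
        target := {w | (w, (e z).2) ∈ e.target}
        map_source' := by
          rintro _ ⟨y, hy, rfl⟩
          change (l (F y), (e z).2) ∈ e.target
          rw [(hl y hy).2]
          exact hprod y hy
        map_target' := fun w hw => ⟨_, e.map_target hw, rfl⟩
        left_inv' := by
          rintro _ ⟨y, hy, rfl⟩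
          apply hinj
          change F (e.symm (l (F y), (e z).2)) = F y
          rw [(hl y hy).2]
          refine he _ (e.map_target (hprod y hy)) _ hy ?_
          rw [e.right_inv (hprod y hy)]
        right_inv' := by
          intro w hw
          change l (F (e.symm (w, (e z).2))) = w
          rw [(hl _ (e.map_target hw)).2, e.right_inv hw]
        open_source := hopen _ e.open_source
        open_target := hto
        continuousOn_toFun := by
          rintro _ ⟨y, hy, rfl⟩
          exact ContinuousAt.continuousWithinAt
            (ContinuousAt.comp (f := i) (hl y hy).1.continuousAt hic.continuousAt)
        continuousOn_invFun := fun w hw => ContinuousAt.continuousWithinAt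
          (hmkc.continuousAt.comp (hsmg w hw).continuousAt) }
    refine ⟨ψ, l, mem_image_of_mem mk hz, ?_, ?_⟩
    · intro w hw
      exact (hF _).comp w (hsmg w hw)
    · rintro _ ⟨y, hy, rfl⟩
      exact ⟨(hl y hy).1, rfl⟩
  obtain ⟨M', e, hdim, hsm, himm⟩ := exists_mfd_of_charts (S.dim - k) i hcharts
  have hι : IsInjImmersion (N := Q) (i ∘ e) := ⟨hsm, hinj.comp e.injective, himm⟩
  have hcomp : (i ∘ e) ∘ (e.symm ∘ mk) = F := by
    funext s
    simp [himk]
  have hr : Smooth (N := M') (e.symm ∘ mk) :=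
    hι.smooth_of_comp (e.symm.continuous.comp hmkc) (by rw [hcomp]; exact hF)
  refine ⟨M', e.symm ∘ mk, i ∘ e, ⟨hr, e.symm.surjective.comp Quotient.mk_surjective, ?_⟩, hι,
    fun s => congrFun hcomp s⟩
  intro s
  let R : S.Model →L[ℝ] M'.Model := tmap (e.symm ∘ mk) s
  let Fs : S.Model →L[ℝ] Q.Model := tmap F s
  -- Since the tangent maps of `i ∘ e` are injective, the projection and `F` have the same kernels;
  -- counting dimensions then makes the projection a submersion.
  have hker : LinearMap.ker (R : S.Model →ₗ[ℝ] M'.Model) =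
      LinearMap.ker (Fs : S.Model →ₗ[ℝ] Q.Model) := by
    ext v
    have h1 := tmap_comp_apply hι.smooth hr s v
    have h2 : Fs v = tmap ((i ∘ e) ∘ (e.symm ∘ mk)) s v := by
      simp only [Fs]
      rw [hcomp]
      rfl
    rw [LinearMap.mem_ker, LinearMap.mem_ker]
    change R v = 0 ↔ Fs v = 0
    rw [h2, h1]
    constructor
    · intro h
      exact (congrArg _ h).trans (map_zero _)
    · intro h
      exact hι.immersion _ (h.trans (map_zero _).symm)
  have h1 := LinearMap.finrank_range_add_finrank_ker (R : S.Model →ₗ[ℝ] M'.Model)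
  have h2 : Module.finrank ℝ (LinearMap.ker (Fs : S.Model →ₗ[ℝ] Q.Model)) = k := hk s
  rw [hker, h2] at h1
  have h3 : Module.finrank ℝ S.Model = S.dim := by simp
  have h4 : Module.finrank ℝ M'.Model = M'.dim := by simp
  have h5 : LinearMap.range (R : S.Model →ₗ[ℝ] M'.Model) = ⊤ :=
    Submodule.eq_top_of_finrank_eq (by omega)
  exact LinearMap.range_eq_top.1 h5

end ConstantRank

/-! ## Integral curves and orbits -/

section Curves

variable {M N O : Mfd.{u}}

theorem IsMIntegralCurveOn.map {X : (x : M) → M.T x} {Y : (x : N) → N.T x} {F : M → N}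
    (hF : Smooth F) (hXY : ∀ x, tmap F x (X x) = Y (F x)) {γ : ℝ → M} {s : Set ℝ}
    (hγ : IsMIntegralCurveOn (I := 𝓡 M.dim) γ X s) :
    IsMIntegralCurveOn (I := 𝓡 N.dim) (F ∘ γ) Y s := by
  intro τ hτ
  have h := HasMFDerivAt.comp_hasMFDerivWithinAt τ
    (hF.mdifferentiableAt (γ τ)).hasMFDerivAt (hγ τ hτ)
  refine h.congr_mfderiv ?_
  let A : M.Model →L[ℝ] N.Model := tmap F (γ τ)
  have h1 : A.comp ((1 : ℝ →L[ℝ] ℝ).smulRight (X (γ τ) : M.Model)) =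
      (1 : ℝ →L[ℝ] ℝ).smulRight (A (X (γ τ) : M.Model)) := by
    refine ContinuousLinearMap.ext fun a => ?_
    exact map_smul A a (X (γ τ) : M.Model)
  exact h1.trans (congrArg (fun z : N.Model => (1 : ℝ →L[ℝ] ℝ).smulRight z) (hXY (γ τ)))

theorem hasMFDerivWithinAt_field_congr {X : (x : M) → M.T x} {γ γ' : ℝ → M} {s : Set ℝ} {τ : ℝ}
    (h : HasMFDerivWithinAt 𝓘(ℝ, ℝ) (𝓡 M.dim) γ s τ ((1 : ℝ →L[ℝ] ℝ).smulRight (X (γ τ))))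
    (h1 : γ' =ᶠ[𝓝[s] τ] γ) (h2 : γ' τ = γ τ) :
    HasMFDerivWithinAt 𝓘(ℝ, ℝ) (𝓡 M.dim) γ' s τ ((1 : ℝ →L[ℝ] ℝ).smulRight (X (γ' τ))) := by
  refine (h.congr_of_eventuallyEq h1 h2).congr_mfderiv ?_
  have := congrArg (fun y => ((1 : ℝ →L[ℝ] ℝ).smulRight (X y : M.Model) : ℝ →L[ℝ] M.Model)) h2
  exact this.symm

theorem IsMIntegralCurveOn.congr {X : (x : M) → M.T x} {γ γ' : ℝ → M} {s : Set ℝ}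
    (h : IsMIntegralCurveOn (I := 𝓡 M.dim) γ X s) (he : EqOn γ' γ s) :
    IsMIntegralCurveOn (I := 𝓡 M.dim) γ' X s := fun τ hτ =>
  hasMFDerivWithinAt_field_congr (h τ hτ) (he.eventuallyEq_of_mem self_mem_nhdsWithin) (he hτ)

/-- At `a` the two one-sided derivatives both equal the value of the field, so they combine into a
derivative within `s`. -/
theorem IsMIntegralCurveOn.glue {X : (x : M) → M.T x} {γ₁ γ₂ : ℝ → M} {s : Set ℝ} {a : ℝ}
    (h₁ : IsMIntegralCurveOn (I := 𝓡 M.dim) γ₁ X (s ∩ Iic a))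
    (h₂ : IsMIntegralCurveOn (I := 𝓡 M.dim) γ₂ X (s ∩ Ici a)) (ha : γ₁ a = γ₂ a) :
    IsMIntegralCurveOn (I := 𝓡 M.dim) (fun τ => if τ ≤ a then γ₁ τ else γ₂ τ) X s := by
  have e₁ : EqOn (fun τ => if τ ≤ a then γ₁ τ else γ₂ τ) γ₁ (s ∩ Iic a) := fun τ hτ => by
    have := hτ.2; simp only [mem_Iic] at this; simp [this]
  have e₂ : EqOn (fun τ => if τ ≤ a then γ₁ τ else γ₂ τ) γ₂ (s ∩ Ici a) := fun τ hτ => by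
    have h := hτ.2
    simp only [mem_Ici] at h
    rcases h.eq_or_lt with rfl | h
    · simp [ha]
    · simp [not_le.2 h]
  replace h₁ := IsMIntegralCurveOn.congr h₁ e₁
  replace h₂ := IsMIntegralCurveOn.congr h₂ e₂
  intro τ hτ
  rcases lt_trichotomy τ a with h | h | h
  · exact (hasMFDerivWithinAt_inter (Iic_mem_nhds h)).1 (h₁ τ ⟨hτ, h.le⟩)
  · have := (h₁ τ ⟨hτ, h.le⟩).union (h₂ τ ⟨hτ, h.ge⟩)
    rwa [← inter_union_distrib_left, Iic_union_Ici, inter_univ] at this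
  · exact (hasMFDerivWithinAt_inter (Ici_mem_nhds h)).1 (h₂ τ ⟨hτ, h.le⟩)

theorem SmoothField.exists_integralCurve {X : (x : M) → M.T x} (hX : SmoothField X) (x : M) (a : ℝ) :
    ∃ γ : ℝ → M, γ a = x ∧ IsMIntegralCurveAt (I := 𝓡 M.dim) γ X a :=
  exists_isMIntegralCurveAt_of_contMDiffAt_boundaryless a
    ((hX x).of_le (WithTop.coe_le_coe.2 le_top))

theorem SmoothField.eventuallyEq {X : (x : M) → M.T x} (hX : SmoothField X) {γ γ' : ℝ → M} {a : ℝ}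
    (h : IsMIntegralCurveAt (I := 𝓡 M.dim) γ X a) (h' : IsMIntegralCurveAt (I := 𝓡 M.dim) γ' X a)
    (ha : γ a = γ' a) : γ =ᶠ[𝓝 a] γ' :=
  isMIntegralCurveAt_eventuallyEq_of_contMDiffAt_boundaryless
    ((hX _).of_le (WithTop.coe_le_coe.2 le_top)) h h' ha

/-- Integral curves on `[0, 1]` extend to a neighbourhood of `[0, 1]`. -/
theorem SmoothField.exists_extension {X : (x : M) → M.T x} (hX : SmoothField X) {γ : ℝ → M}
    (hγ : IsMIntegralCurveOn (I := 𝓡 M.dim) γ X (Icc 0 1)) :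
    ∃ γ' : ℝ → M, EqOn γ' γ (Icc 0 1) ∧
      ∀ τ ∈ Icc (0 : ℝ) 1, IsMIntegralCurveAt (I := 𝓡 M.dim) γ' X τ := by
  -- Local integral curves through the endpoints are glued onto both ends, because the uniqueness
  -- statement concerns curves defined on both sides of a time.
  obtain ⟨δ, hδ, hδ'⟩ := hX.exists_integralCurve (γ 0) 0
  obtain ⟨η, hη, hη'⟩ := hX.exists_integralCurve (γ 1) 1
  obtain ⟨ε, hε, hδ'⟩ := isMIntegralCurveAt_iff'.1 hδ'
  obtain ⟨ε', hε', hη'⟩ := isMIntegralCurveAt_iff'.1 hη'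
  have h1 : IsMIntegralCurveOn (I := 𝓡 M.dim) (fun τ => if τ ≤ 1 then γ τ else η τ) X
      (Ico 0 (1 + ε')) := by
    refine IsMIntegralCurveOn.glue (hγ.mono fun τ hτ => ⟨hτ.1.1, hτ.2⟩)
      (hη'.mono fun τ hτ => ?_) hη.symm
    have h1 := hτ.1.2; have h2 : 1 ≤ τ := hτ.2
    rw [Metric.mem_ball, Real.dist_eq, abs_lt]; constructor <;> linarith
  have h2 : IsMIntegralCurveOn (I := 𝓡 M.dim)
      (fun τ => if τ ≤ 0 then δ τ else if τ ≤ 1 then γ τ else η τ) X (Ioo (-ε) (1 + ε')) := by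
    refine IsMIntegralCurveOn.glue (hδ'.mono fun τ hτ => ?_)
      (h1.mono fun τ hτ => ⟨hτ.2, hτ.1.2⟩) (by simp [hδ])
    have h1 := hτ.1.1; have h2 : τ ≤ 0 := hτ.2
    rw [Metric.mem_ball, Real.dist_eq, abs_lt]; constructor <;> linarith
  refine ⟨_, fun τ hτ => ?_, fun τ hτ => h2.isMIntegralCurveAt (Ioo_mem_nhds ?_ ?_)⟩
  · rcases hτ.1.eq_or_lt with rfl | h
    · simp [hδ]
    · simp [not_le.2 h, hτ.2]
  · linarith [hτ.1]
  · linarith [hτ.2]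

/-- An integral curve of a vector field on `N` with values in an immersed submanifold to which the
vector field is tangent is an integral curve in the submanifold. -/
theorem IsInjImmersion.exists_lift {j : O → N} (hj : IsInjImmersion j) {Y : (x : O) → O.T x}
    {X : (x : N) → N.T x} (hY : SmoothField Y) (hX : SmoothField X)
    (hYX : ∀ a, tmap j a (Y a) = X (j a)) {γ : ℝ → N}
    (hγ : IsMIntegralCurveOn (I := 𝓡 N.dim) γ X (Icc 0 1))
    (hr : ∀ τ ∈ Icc (0 : ℝ) 1, γ τ ∈ range j) :
    ∃ γ' : ℝ → O, IsMIntegralCurveOn (I := 𝓡 O.dim) γ' Y (Icc 0 1) ∧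
      ∀ τ ∈ Icc (0 : ℝ) 1, j (γ' τ) = γ τ := by
  obtain ⟨γ₁, hγ₁, hγ₁'⟩ := hX.exists_extension hγ
  have hne : Nonempty O := (hr 0 (by simp)).nonempty
  refine ⟨fun τ => invFun j (γ τ), fun τ hτ => ?_, fun τ hτ => invFun_eq (hr τ hτ)⟩
  -- Continuity of the lift is not known in advance. The image under `j` of an integral curve of `Y`
  -- agrees with the given curve near `τ` by uniqueness, and injectivity of `j` identifies it with
  -- the lift.
  obtain ⟨δ, hδ, hδ'⟩ := hY.exists_integralCurve (invFun j (γ τ)) τ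
  have h1 : IsMIntegralCurveAt (I := 𝓡 N.dim) (j ∘ δ) X τ := by
    obtain ⟨s, hs, h⟩ := isMIntegralCurveAt_iff.1 hδ'
    exact isMIntegralCurveAt_iff.2 ⟨s, hs, IsMIntegralCurveOn.map hj.smooth hYX h⟩
  have h2 : γ₁ =ᶠ[𝓝 τ] j ∘ δ := hX.eventuallyEq (hγ₁' τ hτ) h1 (by
    rw [hγ₁ hτ, comp_apply, hδ]; exact (invFun_eq (hr τ hτ)).symm)
  refine hasMFDerivWithinAt_field_congr (γ := δ) hδ'.hasMFDerivAt.hasMFDerivWithinAt ?_ hδ.symm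
  filter_upwards [h2.filter_mono nhdsWithin_le_nhds, self_mem_nhdsWithin] with σ hσ hσ'
  apply hj.injective
  rw [invFun_eq (hr σ hσ'), ← hγ₁ hσ', hσ]; rfl

theorem comp_eq_of_diff_eq_zero {X : (x : M) → M.T x} {f : M → ℝ} (hf : SmoothFun f)
    (h : ∀ x, diff f x (X x) = 0) {γ : ℝ → M}
    (hγ : IsMIntegralCurveOn (I := 𝓡 M.dim) γ X (Icc 0 1)) : f (γ 0) = f (γ 1) := by
  have key : ∀ τ ∈ Icc (0 : ℝ) 1, HasDerivWithinAt (f ∘ γ) 0 (Icc 0 1) τ := by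
    intro τ hτ
    have h1 := HasMFDerivAt.comp_hasMFDerivWithinAt τ
      (hf.mdifferentiableAt (γ τ)).hasMFDerivAt (hγ τ hτ)
    let A : M.Model →L[ℝ] ℝ := diff f (γ τ)
    let ξ : M.Model := X (γ τ)
    have h2 : HasFDerivWithinAt (f ∘ γ) (A.comp ((1 : ℝ →L[ℝ] ℝ).smulRight ξ)) (Icc 0 1) τ :=
      hasMFDerivWithinAt_iff_hasFDerivWithinAt.1 h1
    refine h2.hasDerivWithinAt.congr_deriv ?_
    refine Eq.trans ?_ (h (γ τ))
    change A ((1 : ℝ) • ξ) = A ξ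
    rw [one_smul]
  refine (constant_of_derivWithin_zero (fun τ hτ => (key τ hτ).differentiableWithinAt)
    (fun τ hτ => ?_) 1 (by simp)).symm
  exact (key τ ⟨hτ.1, hτ.2.le⟩).derivWithin (uniqueDiffOn_Icc zero_lt_one τ ⟨hτ.1, hτ.2.le⟩)

end Curves

/-! ### Orbits under equivariant maps and in submanifolds -/

section Orbits

variable {g : Type*} [LieRing g] [LieAlgebra ℝ g] {M N O : Mfd.{u}}

theorem LieAct.SameOrbit.symm (A : LieAct g M) {h : Submodule ℝ g} {x y : M}
    (hxy : A.SameOrbit h x y) : A.SameOrbit h y x := by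
  refine (@Relation.ReflTransGen.stdSymm _ _ ⟨?_⟩).symm _ _ hxy
  rintro x y ⟨v, hv, γ, hγ, rfl, rfl⟩
  -- The reversed curve τ ↦ γ(1 − τ) follows the field of `-v`.
  refine ⟨-v, h.neg_mem hv, γ ∘ (· + 1) ∘ (· * (-1)), ?_, by simp, by simp⟩
  have h1 := (hγ.comp_add 1).comp_mul (-1)
  have h2 : A.rho (-v) = (-1 : ℝ) • A.rho v := by rw [map_neg]; simp
  rw [h2]
  refine h1.mono fun τ hτ => ?_
  simp only [mem_ofPred_eq, mem_Icc] at hτ ⊢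
  constructor <;> linarith [hτ.1, hτ.2]

/-- Stopping at time `τ` amounts to following the field of `τ • v` for unit time. -/
theorem LieAct.sameOrbit_of_integralCurve (A : LieAct g M) {h : Submodule ℝ g} {v : g} (hv : v ∈ h)
    {γ : ℝ → M} (hγ : IsMIntegralCurveOn (I := 𝓡 M.dim) γ (A.rho v) (Icc 0 1)) {τ : ℝ}
    (hτ : τ ∈ Icc (0 : ℝ) 1) : A.SameOrbit h (γ 0) (γ τ) := by
  refine Relation.ReflTransGen.single ⟨τ • v, h.smul_mem τ hv, γ ∘ (· * τ), ?_, by simp, by simp⟩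
  rw [map_smul]
  refine (hγ.comp_mul τ).mono fun σ hσ => ?_
  exact ⟨mul_nonneg hσ.1 hτ.1, mul_le_one₀ hσ.2 hτ.1 hτ.2⟩

theorem LieAct.SameOrbit.mono (A : LieAct g M) {h h' : Submodule ℝ g} (hh : h ≤ h') {x y : M}
    (hxy : A.SameOrbit h x y) : A.SameOrbit h' x y :=
  Relation.ReflTransGen.mono (fun _ _ ⟨v, hv, γ, hγ⟩ => ⟨v, hh hv, γ, hγ⟩) _ _ hxy

/-- An infinitesimally invariant function is constant along each integral curve. Descent of actions
and of bivectors to quotients rests on this. -/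
theorem LieAct.SameOrbit.eq_of_diff_eq_zero (A : LieAct g M) {h : Submodule ℝ g} {f : M → ℝ}
    (hf : SmoothFun f) (hfh : ∀ v ∈ h, ∀ x, diff f x (A.rho v x) = 0) {x y : M}
    (hxy : A.SameOrbit h x y) : f x = f y := by
  induction hxy with
  | refl => rfl
  | tail _ h1 ih =>
    obtain ⟨v, hv, γ, hγ, rfl, rfl⟩ := h1
    exact ih.trans (comp_eq_of_diff_eq_zero hf (hfh v hv) hγ)

/-- Equivariant maps send orbits to orbits, for compatible Lie algebras. -/
theorem LieAct.SameOrbit.map {g' : Type*} [LieRing g'] [LieAlgebra ℝ g'] {A : LieAct g M}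
    {B : LieAct g' N} {h : Submodule ℝ g} {h' : Submodule ℝ g'} {F : M → N} (hF : Smooth F)
    (e : g → g') (he : ∀ v ∈ h, e v ∈ h')
    (hAB : ∀ v ∈ h, ∀ x, tmap F x (A.rho v x) = B.rho (e v) (F x)) {x y : M}
    (hxy : A.SameOrbit h x y) : B.SameOrbit h' (F x) (F y) := by
  refine Relation.ReflTransGen.lift F ?_ _ _ hxy
  rintro x y ⟨v, hv, γ, hγ, rfl, rfl⟩
  exact ⟨e v, he v hv, F ∘ γ, IsMIntegralCurveOn.map hF (hAB v hv) hγ, rfl, rfl⟩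

/-- Orbits in an immersed invariant submanifold. -/
theorem LieAct.SameOrbit.lift {g' : Type*} [LieRing g'] [LieAlgebra ℝ g'] {A : LieAct g N}
    {B : LieAct g' O} {h : Submodule ℝ g} {h' : Submodule ℝ g'} {j : O → N}
    (hj : IsInjImmersion j) (e : g → g') (he : ∀ v ∈ h, e v ∈ h')
    (hAB : ∀ v ∈ h, ∀ x, tmap j x (B.rho (e v) x) = A.rho v (j x))
    (hr : ∀ a y, A.SameOrbit h (j a) y → y ∈ range j) {a b : O}
    (hab : A.SameOrbit h (j a) (j b)) : B.SameOrbit h' a b := by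
  -- The intermediate points of the chain are not given as points of `O`, so the induction also
  -- produces their lifts.
  suffices H : ∀ y, A.SameOrbit h (j a) y → ∃ b, j b = y ∧ B.SameOrbit h' a b by
    obtain ⟨b', hb, h⟩ := H _ hab
    rwa [hj.injective hb] at h
  intro y hy
  induction hy with
  | refl => exact ⟨a, rfl, Relation.ReflTransGen.refl⟩
  | tail _ h1 ih =>
    obtain ⟨v, hv, γ, hγ, h0, rfl⟩ := h1
    obtain ⟨b, hb, hab⟩ := ih
    obtain ⟨γ', hγ', hj'⟩ := hj.exists_lift (B.smooth (e v)) (A.smooth v) (hAB v hv) hγ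
      fun τ hτ => hr b _ (by
        rw [hb, ← h0]
        exact A.sameOrbit_of_integralCurve hv hγ hτ)
    have hb' : γ' 0 = b := hj.injective (by rw [hj' 0 (by simp), h0, hb])
    exact ⟨γ' 1, hj' 1 (by simp), hab.tail ⟨e v, he v hv, γ', hγ', hb', rfl⟩⟩

theorem LieAct.IsOrbit.mem_range {A : LieAct g N} {h : Submodule ℝ g} {j : O → N}
    (hj : A.IsOrbit h j) {a : O} {y : N} (hy : A.SameOrbit h (j a) y) : y ∈ range j := by
  obtain ⟨x, hx⟩ := hj.orbit
  have h1 : j a ∈ range j := mem_range_self a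
  rw [hx] at h1 ⊢
  exact h1.trans hy

theorem LieAct.IsOrbit.sameOrbit {A : LieAct g N} {h : Submodule ℝ g} {j : O → N}
    (hj : A.IsOrbit h j) (a b : O) : A.SameOrbit h (j a) (j b) := by
  obtain ⟨x, hx⟩ := hj.orbit
  have h1 : j a ∈ range j := mem_range_self a
  have h2 : j b ∈ range j := mem_range_self b
  rw [hx] at h1 h2
  exact (LieAct.SameOrbit.symm A h1).trans h2

end Orbits

/-! ## Restriction and descent of actions -/

section RelatedFields

variable {M N : Mfd.{u}}

/-- Related fields are intertwined by pullback of functions, hence so are their commutators as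
derivations. -/
theorem tmap_mlieBracket {F : M → N} (hF : Smooth F) {Y₁ Y₂ : (x : M) → M.T x}
    {X₁ X₂ : (x : N) → N.T x} (hY₁ : SmoothField Y₁) (hY₂ : SmoothField Y₂)
    (hX₁ : SmoothField X₁) (hX₂ : SmoothField X₂) (h₁ : ∀ a, tmap F a (Y₁ a) = X₁ (F a))
    (h₂ : ∀ a, tmap F a (Y₂ a) = X₂ (F a)) (a : M) :
    tmap F a (VectorField.mlieBracket (𝓡 M.dim) Y₁ Y₂ a) =
      VectorField.mlieBracket (𝓡 N.dim) X₁ X₂ (F a) := by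
  refine tangent_ext fun f hf => ?_
  have e₁ : (fun y => diff (f ∘ F) y (Y₁ y)) = (fun y => diff f y (X₁ y)) ∘ F :=
    funext fun y => by rw [diff_comp_apply hf hF, h₁]; rfl
  have e₂ : (fun y => diff (f ∘ F) y (Y₂ y)) = (fun y => diff f y (X₂ y)) ∘ F :=
    funext fun y => by rw [diff_comp_apply hf hF, h₂]; rfl
  rw [← diff_comp_apply hf hF, diff_mlieBracket hY₁ hY₂ (hf.comp hF), diff_mlieBracket hX₁ hX₂ hf,
    e₁, e₂, diff_comp_apply (hX₁.apply hf) hF, diff_comp_apply (hX₂.apply hf) hF, h₁, h₂]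

end RelatedFields

/-! ### Actions restricted to submanifolds and descended to quotients -/

section Actions

variable {g : Type*} [LieRing g] [LieAlgebra ℝ g] {g' : Type*} [LieRing g'] [LieAlgebra ℝ g']
  {M N O X B : Mfd.{u}}

theorem LieAct.field (A : LieAct g M) (v : g) : SmoothField (A.rho v) := A.smooth v

/-- Restriction of an action to an invariant immersed submanifold. -/
theorem LieAct.exists_restrict (A : LieAct g N) (e : g' →ₗ[ℝ] g)
    (he : ∀ v w, e ⁅v, w⁆ = ⁅e v, e w⁆) {j : O → N} (hj : IsInjImmersion j)
    (h : ∀ v a, ∃ ξ : O.T a, tmap j a ξ = A.rho (e v) (j a)) :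
    ∃ B : LieAct g' O, ∀ v a, tmap j a (B.rho v a) = A.rho (e v) (j a) := by
  choose Y hY using h
  -- A function on the submanifold extends locally to the ambient manifold, and its derivative along
  -- `Y v` is the restriction of an ambient derivative.
  have hs : ∀ v, SmoothField (Y v) := by
    refine fun v => smoothField_of_apply fun f hf => ?_
    intro a
    obtain ⟨k, hk, hkf⟩ := hj.exists_extension hf a
    refine ((((A.field (e v)).apply hk).comp hj.smooth) a).congr_of_eventuallyEq ?_
    filter_upwards [hkf.eventuallyEq_nhds] with b hb
    rw [← diff_congr hb, diff_comp_apply hk hj.smooth, hY]; rfl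
  refine ⟨⟨⟨⟨Y, fun v w => funext fun a => hj.immersion a ?_⟩,
    fun r v => funext fun a => hj.immersion a ?_⟩, hs, fun v w a => hj.immersion a ?_⟩, hY⟩
  · refine (hY _ a).trans (Eq.trans ?_ (map_add (tmap j a) _ _).symm)
    rw [hY, hY, map_add, map_add]; rfl
  · refine (hY _ a).trans (Eq.trans ?_ (map_smul (tmap j a) _ _).symm)
    rw [hY, map_smul, map_smul]; rfl
  · refine (hY _ a).trans ?_
    rw [he, A.lie]
    exact (tmap_mlieBracket hj.smooth (hs v) (hs w) (A.field _) (A.field _) (hY v) (hY w) a).symm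

theorem LieAct.diff_lie (A : LieAct g M) (v w : g) {f : M → ℝ} (hf : SmoothFun f) (x : M) :
    diff f x (A.rho ⁅v, w⁆ x) =
      diff (fun y => diff f y (A.rho w y)) x (A.rho v x) -
        diff (fun y => diff f y (A.rho v y)) x (A.rho w x) := by
  rw [A.lie, diff_mlieBracket (A.field v) (A.field w) hf]

theorem diff_zero_fun (x : M) (ξ : M.T x) : diff (fun _ : M => (0 : ℝ)) x ξ = 0 := by
  have h : HasMFDerivAt (𝓡 M.dim) 𝓘(ℝ, ℝ) (fun _ : M => (0 : ℝ)) x 0 := hasMFDerivAt_const _ _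
  exact congrArg (fun L : M.Model →L[ℝ] ℝ => L ξ) h.mfderiv

theorem LieAct.lie_mem_stabilizer (A : LieAct g M) {x : M} {v w : g} (hv : A.rho v x = 0)
    (hw : A.rho w x = 0) : A.rho ⁅v, w⁆ x = 0 := by
  refine tangent_ext fun f hf => ?_
  rw [A.diff_lie v w hf, hv, hw]
  exact (sub_eq_zero.2 ((map_zero _).trans (map_zero _).symm)).trans (map_zero _).symm

/-- Descent of an action along a surjective submersion whose fibres are orbits. -/
theorem LieAct.exists_descend (A : LieAct g X) {p : X → B} (hp : IsSurjSubmersion p)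
    (e : g →ₗ[ℝ] g') (he : Surjective e) (hlie : ∀ v w, e ⁅v, w⁆ = ⁅e v, e w⁆)
    (hker : ∀ w, e w = 0 → ∀ a, tmap p a (A.rho w a) = 0)
    (hfib : ∀ a b, p a = p b → A.SameOrbit (LinearMap.ker e) a b) :
    ∃ A' : LieAct g' B, ∀ v a, tmap p a (A.rho v a) = A'.rho (e v) (p a) := by
  obtain ⟨s, hs⟩ := hp.surjective.hasRightInverse
  have hker' : ∀ w, e w = 0 → ∀ f : B → ℝ, SmoothFun f →
      (fun a => diff (f ∘ p) a (A.rho w a)) = fun _ => 0 := fun w hw f hf => funext fun a => by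
    rw [diff_comp_apply hf hp.smooth, hker w hw]; exact map_zero _
  -- For w in the kernel of `e`, w(v(f∘p)) = [w,v](f∘p) + v(w(f∘p)), and both terms vanish because
  -- [w,v] is in the kernel too. So v(f∘p) is constant along the fibres.
  have hconst : ∀ v (f : B → ℝ), SmoothFun f → ∀ a b, p a = p b →
      diff (f ∘ p) a (A.rho v a) = diff (f ∘ p) b (A.rho v b) := by
    intro v f hf a b hab
    refine LieAct.SameOrbit.eq_of_diff_eq_zero A ((A.field v).apply (hf.comp hp.smooth))
      (fun w hw x => ?_) (hfib a b hab)
    have h1 := A.diff_lie w v (hf.comp hp.smooth) x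
    rw [hker' w hw f hf, diff_zero_fun, sub_zero] at h1
    rw [← h1]
    have h2 : e ⁅w, v⁆ = 0 := by rw [hlie, LinearMap.mem_ker.1 hw, zero_lie]
    exact congrFun (hker' _ h2 f hf) x
  -- The field is pushed forward at one chosen point of each fibre; constancy on fibres shows that
  -- any other point gives the same vector.
  let V : g → (y : B) → B.T y := fun v y => (tmap p (s y) (A.rho v (s y)) : B.Model)
  have hV : ∀ v a, tmap p a (A.rho v a) = V v (p a) := by
    intro v a
    refine tangent_ext fun f hf => ?_
    rw [← diff_comp_apply hf hp.smooth, hconst v f hf a (s (p a)) (hs (p a)).symm,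
      diff_comp_apply hf hp.smooth]
    exact congrArg (fun y => (diff f y : B.Model →L[ℝ] ℝ) (V v (p a))) (hs (p a))
  -- A linear splitting of `e` defines the action of `g'`. It need not respect brackets, since `V`
  -- depends only on the class modulo the kernel of `e`.
  obtain ⟨i, hi⟩ := e.exists_rightInverse_of_surjective (LinearMap.range_eq_top.2 he)
  have hi : ∀ w, e (i w) = w := LinearMap.congr_fun hi
  have hVi : ∀ v y, V (i (e v)) y = V v y := by
    intro v y
    have h1 := hker (i (e v) - v) (by rw [map_sub, hi, sub_self]) (s y)
    have h2 : A.rho (i (e v) - v) (s y) = A.rho (i (e v)) (s y) - A.rho v (s y) := by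
      rw [map_sub]; rfl
    rw [h2] at h1
    exact sub_eq_zero.1 ((map_sub (tmap p (s y)) _ _).symm.trans h1)
  have hadd : ∀ v w, V (v + w) = V v + V w := fun v w => funext fun y => by
    refine Eq.trans ?_ (map_add (tmap p (s y)) _ _)
    change tmap p (s y) (A.rho (v + w) (s y)) = _
    rw [map_add]; rfl
  have hsmul : ∀ (r : ℝ) v, V (r • v) = r • V v := fun r v => funext fun y => by
    refine Eq.trans ?_ (map_smul (tmap p (s y)) _ _)
    change tmap p (s y) (A.rho (r • v) (s y)) = _
    rw [map_smul]; rfl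
  have hsm : ∀ v, SmoothField (V v) := fun v => smoothField_of_apply fun f hf =>
    hp.smoothFun_of_comp <| by
      have h1 : (fun y => diff f y (V v y)) ∘ p = fun a => diff (f ∘ p) a (A.rho v a) :=
        funext fun a => by rw [diff_comp_apply hf hp.smooth, hV]; rfl
      rw [h1]
      exact (A.field v).apply (hf.comp hp.smooth)
  refine ⟨⟨⟨⟨fun w => V (i w), fun v w => ?_⟩, fun r v => ?_⟩, fun w => hsm (i w),
    fun v w y => ?_⟩, fun v a => (hV v a).trans (hVi v _).symm⟩
  · rw [map_add, hadd]
  · exact (congrArg V (map_smul i r v)).trans (hsmul r (i v))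
  · obtain ⟨a, rfl⟩ := hp.surjective y
    have h1 : ⁅v, w⁆ = e ⁅i v, i w⁆ := by rw [hlie, hi, hi]
    change V (i ⁅v, w⁆) (p a) = VectorField.mlieBracket (𝓡 B.dim) (V (i v)) (V (i w)) (p a)
    rw [h1, hVi, ← hV, A.lie]
    exact tmap_mlieBracket hp.smooth (A.field _) (A.field _) (hsm _) (hsm _) (hV _) (hV _) a

end Actions

/-! ### The action of c/c^⊥ on a quotient by c^⊥ -/

section Red

variable {g : Type*} [LieRing g] [LieAlgebra ℝ g] {N X B : Mfd.{u}}

theorem InvTensor.ker_redMk (t : InvTensor g) (c : LieSubalgebra ℝ g) (w : c) :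
    w ∈ LinearMap.ker (t.redMk c) ↔ (w : g) ∈ t.perp c.toSubmodule := by
  rw [LinearMap.mem_ker, t.redMk_eq_zero]

theorem LieAct.exists_restrict_subalgebra (A : LieAct g N) (c : LieSubalgebra ℝ g) {j : X → N}
    (hj : IsInjImmersion j) (h : ∀ v ∈ c, ∀ a, ∃ ξ : X.T a, tmap j a ξ = A.rho v (j a)) :
    ∃ A₁ : LieAct c X, ∀ (v : c) a, tmap j a (A₁.rho v a) = A.rho (v : g) (j a) :=
  A.exists_restrict (g' := c) (c.incl : c →ₗ[ℝ] g) (fun _ _ => rfl) hj fun v a => h v v.2 a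

/-- The action of `c / c^⊥` on `X / c^⊥`. -/
theorem LieAct.IsQuotient.exists_action (t : InvTensor g) (c : LieSubalgebra ℝ g)
    (hc : t.IsCoisotropic c.toSubmodule) {A : LieAct g N} {j : X → N} {p : X → B}
    (hj : IsInjImmersion j) (hp : A.IsQuotient (t.perp c.toSubmodule) j p)
    (h : ∀ v ∈ c, ∀ a, ∃ ξ : X.T a, tmap j a ξ = A.rho v (j a))
    (hr : ∀ a y, A.SameOrbit c.toSubmodule (j a) y → y ∈ range j) :
    ∃ A' : LieAct (t.RedAlg c) B, EquivariantRed t c A j A' p := by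
  classical
  have hle := t.perp_le_of_isCoisotropic hc
  obtain ⟨A₁, hA₁⟩ := A.exists_restrict_subalgebra c hj h
  obtain ⟨A', hA'⟩ := A₁.exists_descend hp.surjSubmersion (t.redMk c) (t.redMk_surjective c)
    (t.redMk_lie c)
    (fun w hw a => (hp.tangent a _).2 ⟨w, (t.redMk_eq_zero c w).1 hw, (hA₁ w a).symm⟩)
    (fun a b hab => by
      -- The map from `g` to `c` must be total; its value 0 outside `c` is never met, because c^⊥ is
      -- contained in `c`.
      refine LieAct.SameOrbit.lift (A := A) (h := t.perp c.toSubmodule) hj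
        (fun v => if hv : v ∈ c then ⟨v, hv⟩ else 0) (fun v hv => ?_) (fun v hv x => ?_)
        (fun a y hy => hr a y (LieAct.SameOrbit.mono A hle hy)) ((hp.fibres a b).1 hab)
      · have hv' : v ∈ c := hle hv
        rw [dif_pos hv', t.ker_redMk]; exact hv
      · have hv' : v ∈ c := hle hv
        rw [dif_pos hv']; exact hA₁ ⟨v, hv'⟩ x)
  refine ⟨A', fun v a ξ hξ => ?_⟩
  rw [← hA₁ v a] at hξ
  rw [hj.immersion a hξ, hA']

end Red

/-! ## Descent and restriction of quasi-Poisson structures -/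

section Bivectors

variable {g : Type*} [LieRing g] [LieAlgebra ℝ g] {t : InvTensor g} {M N Q : Mfd.{u}}

theorem PushesForward.bracket {F : M → N} {π : Bitensor M} {π' : Bitensor N}
    (h : PushesForward F π π') (hF : Smooth F) {f k : N → ℝ} (hf : SmoothFun f) (hk : SmoothFun k)
    (x : M) : π.bracket (f ∘ F) (k ∘ F) x = π'.bracket f k (F x) := by
  unfold Bitensor.bracket
  rw [diff_comp hf hF, diff_comp hk hF, h]

theorem Bitensor.bracket_congr (π : Bitensor M) {f f' k k' : M → ℝ} {x : M} (hf : f =ᶠ[𝓝 x] f')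
    (hk : k =ᶠ[𝓝 x] k') : π.bracket f k =ᶠ[𝓝 x] π.bracket f' k' := by
  filter_upwards [hf.eventuallyEq_nhds, hk.eventuallyEq_nhds] with y h1 h2
  unfold Bitensor.bracket
  rw [diff_congr h1, diff_congr h2]

theorem Bitensor.bracket_zero_left (π : Bitensor M) (k : M → ℝ) (x : M) :
    π.bracket (fun _ => 0) k x = 0 := by
  have h : diff (fun _ : M => (0 : ℝ)) x = 0 := ContinuousLinearMap.ext fun ξ => diff_zero_fun x ξ
  unfold Bitensor.bracket
  rw [h, map_zero]; rfl

theorem Bitensor.bracket_zero_right (π : Bitensor M) (k : M → ℝ) (x : M) :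
    π.bracket k (fun _ => 0) x = 0 := by
  have h : diff (fun _ : M => (0 : ℝ)) x = 0 := ContinuousLinearMap.ext fun ξ => diff_zero_fun x ξ
  unfold Bitensor.bracket
  rw [h, map_zero]

/-- The reduced sharp map is the class of `t.sharp` of any extension, and the bracket of c/c^⊥ is
induced from `c`. This transfers the quasi-Poisson identity to the quotient. -/
theorem InvTensor.reduced_phi (t : InvTensor g) (c : LieSubalgebra ℝ g)
    (hc : t.IsCoisotropic c.toSubmodule) {ξ η ζ : Module.Dual ℝ (t.RedAlg c)}
    {α β γ : Module.Dual ℝ g} (hα : ∀ u : c, α (u : g) = ξ (t.redMk c u))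
    (hβ : ∀ u : c, β (u : g) = η (t.redMk c u)) (hγ : ∀ u : c, γ (u : g) = ζ (t.redMk c u)) :
    (t.reduced c hc).phi ξ η ζ = t.phi α β γ := by
  have h1 : (t.reduced c hc).sharp ξ = _ := t.redSharp_apply c hc ξ α hα
  have h2 : (t.reduced c hc).sharp η = _ := t.redSharp_apply c hc η β hβ
  unfold InvTensor.phi
  rw [h1, h2, ← t.redMk_lie, ← hγ]; rfl

theorem InvTensor.reduced_apply (t : InvTensor g) (c : LieSubalgebra ℝ g)
    (hc : t.IsCoisotropic c.toSubmodule) {ξ η : Module.Dual ℝ (t.RedAlg c)}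
    {α β : Module.Dual ℝ g} (hα : ∀ u : c, α (u : g) = ξ (t.redMk c u))
    (hβ : ∀ u : c, β (u : g) = η (t.redMk c u)) :
    η ((t.reduced c hc).sharp ξ) = β (t.sharp α) := by
  have h1 : (t.reduced c hc).sharp ξ = _ := t.redSharp_apply c hc ξ α hα
  rw [h1, ← hβ]

/-- The quasi-Poisson structure on `M / c^⊥`. -/
theorem QPoisson.exists_descend (P : QPoisson t M) (c : LieSubalgebra ℝ g)
    (hc : t.IsCoisotropic c.toSubmodule) {q : M → Q}
    (hq : P.IsQuotient (t.perp c.toSubmodule) id q) :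
    ∃ PQ : QPoisson (t.reduced c hc) Q,
      EquivariantRed t c P.toLieAct id PQ.toLieAct q ∧ PushesForward q P.pi PQ.pi := by
  have hs := hq.surjSubmersion
  have hid : IsInjImmersion (id : M → M) := ⟨smooth_id, injective_id, fun x ξ η h => by
    rwa [tmap_id, tmap_id] at h⟩
  obtain ⟨A, hA⟩ := hq.exists_action t c hc hid (fun v _ a => ⟨P.rho v a, tmap_id _ _⟩)
    (fun a y _ => ⟨y, rfl⟩)
  have hA' : ∀ (v : c) a, tmap q a (P.rho (v : g) a) = A.rho (t.redMk c v) (q a) :=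
    fun v a => hA v a _ (tmap_id _ _)
  have hker : ∀ w ∈ t.perp c.toSubmodule, ∀ f : Q → ℝ, SmoothFun f →
      (fun a => diff (f ∘ q) a (P.rho w a)) = fun _ => 0 := fun w hw f hf => funext fun a => by
    rw [diff_comp_apply hf hs.smooth,
      (hq.tangent a (P.rho w a)).2 ⟨w, hw, (tmap_id a _).symm⟩]
    exact map_zero _
  -- By invariance, the derivative of the bracket along c^⊥ is a sum of brackets with the
  -- derivatives of f∘q and k∘q along c^⊥, which are zero.
  have hconst : ∀ f k : Q → ℝ, SmoothFun f → SmoothFun k → ∀ a b, q a = q b →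
      P.pi.bracket (f ∘ q) (k ∘ q) a = P.pi.bracket (f ∘ q) (k ∘ q) b := by
    intro f k hf hk a b hab
    refine LieAct.SameOrbit.eq_of_diff_eq_zero P.toLieAct
      (P.smooth_pi _ _ (hf.comp hs.smooth) (hk.comp hs.smooth)) (fun w hw x => ?_)
      ((hq.fibres a b).1 hab)
    rw [P.invariant w _ _ (hf.comp hs.smooth) (hk.comp hs.smooth), hker w hw f hf, hker w hw k hk,
      Bitensor.bracket_zero_left, Bitensor.bracket_zero_right, add_zero]
  obtain ⟨s, hsq⟩ := hs.surjective.hasRightInverse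
  let T : (y : Q) → Q.coT y →ₗ[ℝ] M.coT (s y) := fun y =>
    { toFun := fun α => (α : Q.Model →L[ℝ] ℝ).comp (tmap q (s y) : M.Model →L[ℝ] Q.Model)
      map_add' := fun _ _ => rfl
      map_smul' := fun _ _ => rfl }
  let πQ : Bitensor Q := fun y => (P.pi (s y)).compl₁₂ (T y) (T y)
  have hT : ∀ a (f : Q → ℝ), SmoothFun f → T (q a) (diff f (q a)) = diff (f ∘ q) (s (q a)) := by
    intro a f hf
    rw [diff_comp hf hs.smooth]
    exact congrArg (fun y => (diff f y : Q.Model →L[ℝ] ℝ).comp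
      (tmap q (s (q a)) : M.Model →L[ℝ] Q.Model)) (hsq (q a)).symm
  have hpush : PushesForward q P.pi πQ := by
    intro a α β
    obtain ⟨f, hf, rfl⟩ := exists_smoothFun_diff_eq (q a) α
    obtain ⟨k, hk, rfl⟩ := exists_smoothFun_diff_eq (q a) β
    rw [← diff_comp hf hs.smooth, ← diff_comp hk hs.smooth]
    refine (hconst f k hf hk a (s (q a)) (hsq (q a)).symm).trans ?_
    change _ = P.pi (s (q a)) (T (q a) (diff f (q a))) (T (q a) (diff k (q a)))
    rw [hT a f hf, hT a k hk]; rfl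
  have hbr : ∀ f k : Q → ℝ, SmoothFun f → SmoothFun k →
      πQ.bracket f k ∘ q = P.pi.bracket (f ∘ q) (k ∘ q) := fun f k hf hk =>
    funext fun a => (hpush.bracket hs.smooth hf hk a).symm
  have hsm : ∀ f k : Q → ℝ, SmoothFun f → SmoothFun k → SmoothFun (πQ.bracket f k) :=
    fun f k hf hk => hs.smoothFun_of_comp <| by
      rw [hbr f k hf hk]
      exact P.smooth_pi _ _ (hf.comp hs.smooth) (hk.comp hs.smooth)
  have hap : ∀ (v : c) (f : Q → ℝ), SmoothFun f →
      (fun y => diff f y (A.rho (t.redMk c v) y)) ∘ q = fun a => diff (f ∘ q) a (P.rho (v : g) a) :=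
    fun v f hf => funext fun a => by
      rw [diff_comp_apply hf hs.smooth, hA']; rfl
  have hco : ∀ a (f : Q → ℝ), SmoothFun f → ∀ u : c, P.coat a (diff (f ∘ q) a) (u : g) =
      A.coat (q a) (diff f (q a)) (t.redMk c u) := by
    intro a f hf u
    exact (diff_comp_apply hf hs.smooth a _).trans (congrArg (diff f (q a)) (hA' u a))
  refine ⟨⟨A, πQ, ?_, hsm, ?_, ?_⟩, hA, hpush⟩
  · intro y α β
    obtain ⟨a, rfl⟩ := hs.surjective y
    rw [← hpush, ← hpush, P.skew]
  · intro v f k hf hk y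
    obtain ⟨v, rfl⟩ := t.redMk_surjective c v
    obtain ⟨a, rfl⟩ := hs.surjective y
    rw [← hA', ← diff_comp_apply (hsm f k hf hk) hs.smooth, hbr f k hf hk,
      P.invariant _ _ _ (hf.comp hs.smooth) (hk.comp hs.smooth), ← hap v f hf, ← hap v k hk,
      hpush.bracket hs.smooth ((A.field _).apply hf) hk,
      hpush.bracket hs.smooth hf ((A.field _).apply hk)]
  · intro f k l hf hk hl y
    obtain ⟨a, rfl⟩ := hs.surjective y
    rw [t.reduced_phi c hc (hco a f hf) (hco a k hk) (hco a l hl),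
      ← P.jacobi _ _ _ (hf.comp hs.smooth) (hk.comp hs.smooth) (hl.comp hs.smooth),
      ← hbr k l hk hl, ← hbr l f hl hf, ← hbr f k hf hk,
      hpush.bracket hs.smooth hf (hsm k l hk hl), hpush.bracket hs.smooth hk (hsm l f hl hf),
      hpush.bracket hs.smooth hl (hsm f k hf hk)]

/-- Quasi-Poisson submanifolds. -/
theorem QPoisson.exists_restrict (P : QPoisson t N) {j : M → N} (hj : IsInjImmersion j)
    (hρ : ∀ v a, ∃ ξ : M.T a, tmap j a ξ = P.rho v (j a))
    (hπ : ∀ a (α β : N.coT (j a)), α.comp (tmap j a) = 0 → P.pi (j a) α β = 0) :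
    ∃ P' : QPoisson t M, IsQPMap P' P j := by
  obtain ⟨A, hA⟩ := P.toLieAct.exists_restrict (LinearMap.id) (fun _ _ => rfl) hj hρ
  have hA : ∀ v a, tmap j a (A.rho v a) = P.rho v (j a) := hA
  -- A left inverse of the tangent map extends covectors to the ambient manifold. By `hπ` and
  -- skewness the bivector does not see which extension is taken.
  have hL : ∀ a, ∃ L : N.Model →L[ℝ] M.Model, ∀ ξ : M.Model,
      L ((tmap j a : M.Model →L[ℝ] N.Model) ξ) = ξ := fun a =>
    exists_continuous_leftInverse (E := M.Model) (F := N.Model)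
      (f := (tmap j a : M.Model →L[ℝ] N.Model)) (hj.immersion a)
  choose L hL using hL
  let T : (a : M) → M.coT a →ₗ[ℝ] N.coT (j a) := fun a =>
    { toFun := fun α => (α : M.Model →L[ℝ] ℝ).comp (L a)
      map_add' := fun _ _ => rfl
      map_smul' := fun _ _ => rfl }
  let π' : Bitensor M := fun a => (P.pi (j a)).compl₁₂ (T a) (T a)
  have hT : ∀ a (α : N.coT (j a)), (T a (α.comp (tmap j a)) - α).comp (tmap j a) = 0 := by
    intro a α
    refine ContinuousLinearMap.ext fun ξ => ?_
    exact sub_eq_zero.2 (congrArg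
      (fun z => (α : N.Model →L[ℝ] ℝ) ((tmap j a : M.Model →L[ℝ] N.Model) z)) (hL a ξ))
  have hπl : ∀ a (α α' β : N.coT (j a)), (α - α').comp (tmap j a) = 0 →
      P.pi (j a) α β = P.pi (j a) α' β := by
    intro a α α' β h
    have h1 := hπ a _ β h
    rw [map_sub] at h1
    exact sub_eq_zero.1 h1
  have hπr : ∀ a (α β β' : N.coT (j a)), (β - β').comp (tmap j a) = 0 →
      P.pi (j a) α β = P.pi (j a) α β' := by
    intro a α β β' h
    rw [P.skew, hπl a β β' α h, ← P.skew]
  have hpush : PushesForward j π' P.pi := by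
    intro a α β
    exact (hπl a _ _ _ (hT a α)).trans (hπr a _ _ _ (hT a β))
  -- Brackets on the submanifold are computed by any local extensions, so every axiom is inherited
  -- from the ambient structure.
  have hbr : ∀ (f k : M → ℝ) (f' k' : N → ℝ) (a : M), SmoothFun f' → SmoothFun k' →
      f' ∘ j =ᶠ[𝓝 a] f → k' ∘ j =ᶠ[𝓝 a] k → π'.bracket f k =ᶠ[𝓝 a] P.pi.bracket f' k' ∘ j := by
    intro f k f' k' a hf' hk' hf hk
    filter_upwards [π'.bracket_congr hf hk] with b hb
    rw [← hb, hpush.bracket hj.smooth hf' hk']; rfl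
  have hap : ∀ v (f : M → ℝ) (f' : N → ℝ) (a : M), SmoothFun f' → f' ∘ j =ᶠ[𝓝 a] f →
      (fun y => diff f' y (P.rho v y)) ∘ j =ᶠ[𝓝 a] fun b => diff f b (A.rho v b) := by
    intro v f f' a hf' hf
    filter_upwards [hf.eventuallyEq_nhds] with b hb
    rw [← diff_congr hb, diff_comp_apply hf' hj.smooth, hA]; rfl
  have hco : ∀ a (f : M → ℝ) (f' : N → ℝ), SmoothFun f' → f' ∘ j =ᶠ[𝓝 a] f →
      A.coat a (diff f a) = P.coat (j a) (diff f' (j a)) := by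
    intro a f f' hf' hf
    refine LinearMap.ext fun v => ?_
    rw [← diff_congr hf]
    exact (diff_comp_apply hf' hj.smooth a _).trans (congrArg (diff f' (j a)) (hA v a))
  refine ⟨⟨A, π', ?_, ?_, ?_, ?_⟩, hj.smooth, hA, hpush⟩
  · intro a α β
    exact P.skew _ _ _
  · intro f k hf hk a
    obtain ⟨f', hf', hff⟩ := hj.exists_extension hf a
    obtain ⟨k', hk', hkk⟩ := hj.exists_extension hk a
    exact (((P.smooth_pi f' k' hf' hk').comp hj.smooth) a).congr_of_eventuallyEq
      (hbr f k f' k' a hf' hk' hff hkk)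
  · intro v f k hf hk a
    obtain ⟨f', hf', hff⟩ := hj.exists_extension hf a
    obtain ⟨k', hk', hkk⟩ := hj.exists_extension hk a
    rw [diff_congr (hbr f k f' k' a hf' hk' hff hkk),
      diff_comp_apply (P.smooth_pi f' k' hf' hk') hj.smooth, hA, P.invariant v f' k' hf' hk',
      (hbr _ _ _ _ a ((P.field v).apply hf') hk' (hap v f f' a hf' hff) hkk).self_of_nhds,
      (hbr _ _ _ _ a hf' ((P.field v).apply hk') hff (hap v k k' a hk' hkk)).self_of_nhds]
    rfl
  · intro f k l hf hk hl a
    obtain ⟨f', hf', hff⟩ := hj.exists_extension hf a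
    obtain ⟨k', hk', hkk⟩ := hj.exists_extension hk a
    obtain ⟨l', hl', hll⟩ := hj.exists_extension hl a
    have e := fun (f k : M → ℝ) (f' k' : N → ℝ) hf' hk' hff hkk =>
      (hbr f k f' k' a hf' hk' hff hkk).symm
    rw [hco a f f' hf' hff, hco a k k' hk' hkk, hco a l l' hl' hll, ← P.jacobi f' k' l' hf' hk' hl',
      (hbr _ _ _ _ a hf' (P.smooth_pi _ _ hk' hl') hff (e k l k' l' hk' hl' hkk hll)).self_of_nhds,
      (hbr _ _ _ _ a hk' (P.smooth_pi _ _ hl' hf') hkk (e l f l' f' hl' hf' hll hff)).self_of_nhds,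
      (hbr _ _ _ _ a hl' (P.smooth_pi _ _ hf' hk') hll (e f k f' k' hf' hk' hff hkk)).self_of_nhds]
    rfl

theorem cotangent_separates {x : M} {ξ : M.T x} (h : ∀ α : M.coT x, α ξ = 0) : ξ = 0 :=
  tangent_ext fun _ _ => (h _).trans (map_zero _).symm

/-- Actions with coisotropic stabilizers are quasi-Poisson-commutative with zero bivector. -/
theorem LieAct.exists_commutative (A : LieAct g M) (t : InvTensor g)
    (h : ∀ x (α β : M.coT x), A.coat x β (t.sharp (A.coat x α)) = 0) :
    ∃ P : QPoisson t M, P.toLieAct = A ∧ P.IsCommutative := by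
  have hb : ∀ f k : M → ℝ, Bitensor.bracket (fun x : M => (0 : M.coT x →ₗ[ℝ] M.coT x →ₗ[ℝ] ℝ)) f k =
      fun _ => 0 := fun _ _ => rfl
  refine ⟨⟨A, fun x => 0, fun x α β => by simp, fun _ _ _ _ => contMDiff_const, ?_, ?_⟩, rfl, ?_⟩
  · intro v f k _ _ x
    rw [hb, hb, hb, diff_zero_fun, add_zero]
  · intro f k l _ _ _ x
    rw [hb, hb, hb, add_zero, add_zero]
    -- The vectors t♯ρ*α lie in the stabilizer of x. The stabilizer is closed under brackets, so the
    -- φ-term vanishes, as does the bracket side.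
    have hs : ∀ α : M.coT x, A.rho (t.sharp (A.coat x α)) x = 0 := fun α =>
      cotangent_separates fun β => h x α β
    have h1 := A.lie_mem_stabilizer (hs (diff f x)) (hs (diff k x))
    have h2 : A.coat x (diff l x) ⁅t.sharp (A.coat x (diff f x)), t.sharp (A.coat x (diff k x))⁆ =
        0 := (congrArg (diff l x) h1).trans (map_zero _)
    unfold InvTensor.phi
    rw [h2, mul_zero]
  · intro x α β
    have h1 := h x α β
    change (0 : ℝ) + 1 / 2 * _ = 0
    rw [h1]; simp

end Bivectors

/-! ## Preimages of pairs of orbits -/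

section Equalizer

variable {E : Type*} [NormedAddCommGroup E] [NormedSpace ℝ E] [FiniteDimensional ℝ E]
  {H : Type*} [TopologicalSpace H] {I : ModelWithCorners ℝ E H} [I.Boundaryless]
  {X : Type u} [TopologicalSpace X] [ChartedSpace H X] [IsManifold I ∞ X] {N : Mfd.{u}}

/-- The difference of the two maps in the chart at their common value; that chart has identity
derivative there, so the derivative is the difference of the tangent maps. -/
theorem exists_equalizer_function {F₁ F₂ : X → N} (h₁ : ContMDiff I (𝓡 N.dim) ∞ F₁)
    (h₂ : ContMDiff I (𝓡 N.dim) ∞ F₂) {z : X} (h : F₁ z = F₂ z) :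
    ∃ G : X → N.Model, (∀ᶠ y in 𝓝 z, ContMDiffAt I 𝓘(ℝ, N.Model) ∞ G y) ∧
      (∀ A₁ A₂ : E →L[ℝ] N.Model, HasMFDerivAt I (𝓡 N.dim) F₁ z A₁ →
        HasMFDerivAt I (𝓡 N.dim) F₂ z A₂ → HasMFDerivAt I 𝓘(ℝ, N.Model) G z (A₁ - A₂)) ∧
      ∀ᶠ y in 𝓝 z, F₁ y = F₂ y ↔ G y = 0 := by
  let φ := extChart (𝓡 N.dim) (F₁ z)
  have hs : (F₁ z) ∈ φ.source := mem_extChart_source _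
  have e₁ : ∀ᶠ y in 𝓝 z, F₁ y ∈ φ.source :=
    (h₁ z).continuousAt.eventually (φ.open_source.mem_nhds hs)
  have e₂ : ∀ᶠ y in 𝓝 z, F₂ y ∈ φ.source :=
    (h₂ z).continuousAt.eventually (φ.open_source.mem_nhds (h ▸ hs))
  refine ⟨fun y => φ (F₁ y) - φ (F₂ y), ?_, ?_, ?_⟩
  · filter_upwards [e₁, e₂] with y hy₁ hy₂
    exact ((contMDiffAt_extChart hy₁).comp y (h₁ y)).sub ((contMDiffAt_extChart hy₂).comp y (h₂ y))
  · intro A₁ A₂ hA₁ hA₂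
    have h3 : HasMFDerivAt (𝓡 N.dim) 𝓘(ℝ, N.Model) φ (F₁ z) (ContinuousLinearMap.id ℝ N.Model) :=
      hasMFDerivAt_extChart_self _
    have h4 : HasMFDerivAt (𝓡 N.dim) 𝓘(ℝ, N.Model) φ (F₂ z) (ContinuousLinearMap.id ℝ N.Model) :=
      h ▸ h3
    exact (h3.comp z hA₁).sub (h4.comp z hA₂)
  · filter_upwards [e₁, e₂] with y hy₁ hy₂
    exact ⟨fun h => by rw [h, sub_self], fun h => φ.injOn hy₁ hy₂ (sub_eq_zero.1 h)⟩

end Equalizer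

/-- The tangent map as a map between model spaces. -/
def dmap {M N : Mfd.{u}} (F : M → N) (x : M) : M.Model →L[ℝ] N.Model := tmap F x

section Preimage

variable {M NL NR OL OR : Mfd.{u}}

/-- The preimage of a pair of immersed submanifolds under a transverse pair of maps. -/
theorem exists_isPreimage {μL : M → NL} {μR : M → NR} {jL : OL → NL} {jR : OR → NR}
    (hμL : Smooth μL) (hμR : Smooth μR) (hjL : IsInjImmersion jL) (hjR : IsInjImmersion jR)
    (htrans : TransversePair μL μR jL jR) :
    ∃ (S : Mfd.{u}) (iM : S → M) (iL : S → OL) (iR : S → OR),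
      IsPreimage μL μR jL jR iM iL iR ∧ Smooth iM ∧
      ∀ s (ξ : M.Model) (η : OL.Model) (ζ : OR.Model),
        (dmap μL (iM s)) ξ = (dmap jL (iL s)) η →
        (dmap μR (iM s)) ξ = (dmap jR (iR s)) ζ →
        ∃ v : S.T s, tmap iM s v = ξ := by
  let I := (𝓡 M.dim).prod ((𝓡 OL.dim).prod (𝓡 OR.dim))
  let E := M.Model × OL.Model × OR.Model
  let F := NL.Model × NR.Model
  let Z : Set (M × OL × OR) := {p | μL p.1 = jL p.2.1 ∧ μR p.1 = jR p.2.2}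
  let D : M × OL × OR → E →L[ℝ] F := fun p =>
    (((dmap μL p.1).comp (.fst ℝ M.Model (OL.Model × OR.Model)) -
      (dmap jL p.2.1).comp ((ContinuousLinearMap.fst ℝ OL.Model OR.Model).comp
        (.snd ℝ M.Model (OL.Model × OR.Model)))).prod
    ((dmap μR p.1).comp (.fst ℝ M.Model (OL.Model × OR.Model)) -
      (dmap jR p.2.2).comp ((ContinuousLinearMap.snd ℝ OL.Model OR.Model).comp
        (.snd ℝ M.Model (OL.Model × OR.Model)))))
  -- Transversality, with the signs of the orbit components reversed to match the differences in
  -- `D`.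
  have hsurj : ∀ p ∈ Z, Surjective (D p) := by
    rintro ⟨x, a, b⟩ ⟨hL, hR⟩ ⟨y, z⟩
    obtain ⟨ξ, η, ζ, h1, h2⟩ := htrans x a b hL hR y z
    refine ⟨((ξ : M.Model), -(η : OL.Model), -(ζ : OR.Model)), Prod.ext ?_ ?_⟩
    · refine Eq.trans ?_ h1
      exact (congrArg (fun w : NL.Model => dmap μL x ξ - w)
        (map_neg (dmap jL a) (η : OL.Model))).trans (sub_neg_eq_add _ _)
    · refine Eq.trans ?_ h2
      exact (congrArg (fun w : NR.Model => dmap μR x ξ - w)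
        (map_neg (dmap jR b) (ζ : OR.Model))).trans (sub_neg_eq_add _ _)
  have hloc : ∀ p ∈ Z, ∃ G : M × OL × OR → F, (∀ᶠ y in 𝓝 p, ContMDiffAt I 𝓘(ℝ, F) ∞ G y) ∧
      HasMFDerivAt I 𝓘(ℝ, F) G p (D p) ∧ ∀ᶠ y in 𝓝 p, y ∈ Z ↔ G y = 0 := by
    intro p hp
    have s1 : ContMDiff I (𝓡 M.dim) ∞ (Prod.fst : M × OL × OR → M) := contMDiff_fst
    have s2 : ContMDiff I (𝓡 OL.dim) ∞ (fun p : M × OL × OR => p.2.1) :=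
      contMDiff_fst.comp contMDiff_snd
    have s3 : ContMDiff I (𝓡 OR.dim) ∞ (fun p : M × OL × OR => p.2.2) :=
      contMDiff_snd.comp contMDiff_snd
    have d1 : HasMFDerivAt I (𝓡 M.dim) (Prod.fst : M × OL × OR → M) p
      (ContinuousLinearMap.fst ℝ M.Model (OL.Model × OR.Model)) := hasMFDerivAt_fst ..
    have d0 : HasMFDerivAt I ((𝓡 OL.dim).prod (𝓡 OR.dim)) (Prod.snd : M × OL × OR → OL × OR) p
      (ContinuousLinearMap.snd ℝ M.Model (OL.Model × OR.Model)) := hasMFDerivAt_snd ..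
    have d2 : HasMFDerivAt ((𝓡 OL.dim).prod (𝓡 OR.dim)) (𝓡 OL.dim) (Prod.fst : OL × OR → OL) p.2
      (ContinuousLinearMap.fst ℝ OL.Model OR.Model) := hasMFDerivAt_fst ..
    have d3 : HasMFDerivAt ((𝓡 OL.dim).prod (𝓡 OR.dim)) (𝓡 OR.dim) (Prod.snd : OL × OR → OR) p.2
      (ContinuousLinearMap.snd ℝ OL.Model OR.Model) := hasMFDerivAt_snd ..
    obtain ⟨Gl, hGl, hGl', hGl0⟩ := exists_equalizer_function (I := I) (z := p)
      (ContMDiff.comp (g := μL) hμL s1)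
      (ContMDiff.comp (g := jL) hjL.smooth s2) hp.1
    obtain ⟨Gr, hGr, hGr', hGr0⟩ := exists_equalizer_function (I := I) (z := p)
      (ContMDiff.comp (g := μR) hμR s1)
      (ContMDiff.comp (g := jR) hjR.smooth s3) hp.2
    have hL := hGl' _ _ ((hμL.mdifferentiableAt p.1).hasMFDerivAt.comp p d1)
      ((hjL.smooth.mdifferentiableAt p.2.1).hasMFDerivAt.comp p (d2.comp p d0))
    have hR := hGr' _ _ ((hμR.mdifferentiableAt p.1).hasMFDerivAt.comp p d1)
      ((hjR.smooth.mdifferentiableAt p.2.2).hasMFDerivAt.comp p (d3.comp p d0))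
    refine ⟨fun y => (Gl y, Gr y), ?_, ⟨hL.1.prodMk hR.1, HasFDerivWithinAt.prodMk hL.2 hR.2⟩, ?_⟩
    · filter_upwards [hGl, hGr] with y h1 h2
      exact h1.prodMk_space h2
    · filter_upwards [hGl0, hGr0] with y h1 h2
      rw [Prod.mk_eq_zero, ← h1, ← h2]; rfl
  -- The dimension is a truncated difference; it is the right one as soon as `Z` has a point,
  -- because `D` is surjective there.
  obtain ⟨S, i, -, hemb, hrange, hsm, himm, htan⟩ := exists_mfd_of_zeroLocus (I := I) (F := F) Z
    (Module.finrank ℝ E - Module.finrank ℝ F) (fun ⟨p, hp⟩ => by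
      exact (Nat.add_sub_cancel' (LinearMap.finrank_le_finrank_of_surjective
        (f := (D p : E →ₗ[ℝ] F)) (hsurj p hp))).symm) (fun p hp => by
      obtain ⟨G, h1, h2, h3⟩ := hloc p hp
      exact ⟨G, D p, h1, h2, hsurj p hp, h3⟩)
  have hiZ : ∀ s, i s ∈ Z := fun s => hrange ▸ mem_range_self s
  have hsM : ContMDiff (𝓡 S.dim) (𝓡 M.dim) ∞ (fun s => (i s).1) := contMDiff_fst.comp hsm
  have hsL : ContMDiff (𝓡 S.dim) (𝓡 OL.dim) ∞ (fun s => (i s).2.1) :=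
    contMDiff_fst.comp (contMDiff_snd.comp hsm)
  have hsR : ContMDiff (𝓡 S.dim) (𝓡 OR.dim) ∞ (fun s => (i s).2.2) :=
    contMDiff_snd.comp (contMDiff_snd.comp hsm)
  have hd : ∀ s (v : S.Model), (mfderiv (𝓡 S.dim) I i s : S.Model →L[ℝ] E) v =
      (dmap (M := S) (N := M) (fun s => (i s).1) s v,
        dmap (M := S) (N := OL) (fun s => (i s).2.1) s v,
        dmap (M := S) (N := OR) (fun s => (i s).2.2) s v) := by
    intro s v
    have h1 := (hsM.mdifferentiableAt (x := s) (by simp)).hasMFDerivAt.prodMk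
      ((hsL.mdifferentiableAt (x := s) (by simp)).hasMFDerivAt.prodMk
        (hsR.mdifferentiableAt (x := s) (by simp)).hasMFDerivAt)
    exact congrArg (fun L : S.Model →L[ℝ] E => L v) h1.mfderiv
  have hcL : (fun s => μL (i s).1) = fun s => jL (i s).2.1 := funext fun s => (hiZ s).1
  have hcR : (fun s => μR (i s).1) = fun s => jR (i s).2.2 := funext fun s => (hiZ s).2
  refine ⟨S, fun s => (i s).1, fun s => (i s).2.1, fun s => (i s).2.2,
    ⟨⟨hsM, fun s s' hss => hemb.injective (Prod.ext hss (Prod.ext ?_ ?_)), fun s v w hvw => ?_⟩,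
      hsL, hsR, hemb, hrange⟩, hsM, ?_⟩
  -- The points of the two orbits are determined by the point of `M`, since `jL` and `jR` are
  -- injective; the same argument on tangent vectors gives the immersion.
  · refine hjL.injective ?_
    rw [← (hiZ s).1, ← (hiZ s').1]; exact congrArg μL hss
  · refine hjR.injective ?_
    rw [← (hiZ s).2, ← (hiZ s').2]; exact congrArg μR hss
  · have hvw' : dmap (M := S) (N := M) (fun s => (i s).1) s v =
      dmap (M := S) (N := M) (fun s => (i s).1) s w := hvw
    have hL : ∀ u : S.Model, (dmap μL (i s).1)
        (dmap (M := S) (N := M) (fun s => (i s).1) s u) =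
        (dmap jL (i s).2.1)
          (dmap (M := S) (N := OL) (fun s => (i s).2.1) s u) := fun u =>
      (tmap_comp_apply hμL hsM s u).symm.trans
        ((congrArg (fun G : S → NL => dmap G s u) hcL).trans (tmap_comp_apply hjL.smooth hsL s u))
    have hR : ∀ u : S.Model, (dmap μR (i s).1)
        (dmap (M := S) (N := M) (fun s => (i s).1) s u) =
        (dmap jR (i s).2.2)
          (dmap (M := S) (N := OR) (fun s => (i s).2.2) s u) := fun u =>
      (tmap_comp_apply hμR hsM s u).symm.trans
        ((congrArg (fun G : S → NR => dmap G s u) hcR).trans (tmap_comp_apply hjR.smooth hsR s u))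
    refine himm s ((hd s v).trans (Eq.trans (Prod.ext hvw' (Prod.ext ?_ ?_)) (hd s w).symm))
    · exact hjL.immersion _ ((hL v).symm.trans ((congrArg _ hvw').trans (hL w)))
    · exact hjR.immersion _ ((hR v).symm.trans ((congrArg _ hvw').trans (hR w)))
  · intro s ξ η ζ hξ hζ
    obtain ⟨G, -, hG, hGZ⟩ := hloc (i s) (hiZ s)
    obtain ⟨v, hv⟩ := htan s G (D (i s)) hG (hsurj _ (hiZ s)) (hGZ.mono fun y hy => hy.1)
      ((ξ, η, ζ) : E) (Prod.ext (sub_eq_zero.2 hξ) (sub_eq_zero.2 hζ))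
    exact ⟨v, congrArg Prod.fst ((hd s v).symm.trans hv)⟩

end Preimage

/-! ## Quotients of invariant submanifolds -/

section InvariantSubmanifold

variable {g : Type*} [LieRing g] [LieAlgebra ℝ g] {M S Q : Mfd.{u}}

/-- The kernel of `L` lies in the image of `j`, so it is isomorphic to the kernel of the composite.
This gives the constant rank of the map from an invariant submanifold to the quotient. -/
theorem finrank_ker_dmap (L : M.Model →L[ℝ] Q.Model) (hL : Surjective L) (j : S.Model →L[ℝ] M.Model)
    (hj : Injective j) (h : ∀ ξ, L ξ = 0 → ∃ v, j v = ξ) :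
    Module.finrank ℝ (LinearMap.ker (L.comp j : S.Model →ₗ[ℝ] Q.Model)) = M.dim - Q.dim := by
  have h1 : (LinearMap.ker (L.comp j : S.Model →ₗ[ℝ] Q.Model)).map (j : S.Model →ₗ[ℝ] M.Model) =
      LinearMap.ker (L : M.Model →ₗ[ℝ] Q.Model) := by
    ext ξ
    constructor
    · rintro ⟨v, hv, rfl⟩; exact hv
    · intro hξ
      obtain ⟨v, rfl⟩ := h ξ hξ
      exact ⟨v, hξ, rfl⟩
  have h2 := (Submodule.equivMapOfInjective (j : S.Model →ₗ[ℝ] M.Model) hj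
    (LinearMap.ker (L.comp j : S.Model →ₗ[ℝ] Q.Model))).finrank_eq
  have h3 := LinearMap.finrank_range_add_finrank_ker (L : M.Model →ₗ[ℝ] Q.Model)
  rw [LinearMap.range_eq_top.2 hL, finrank_top, finrank_euclideanSpace_fin,
    finrank_euclideanSpace_fin] at h3
  rw [h2, h1]
  omega

/-- The quotient of an invariant submanifold by `c^⊥`. -/
theorem LieAct.IsQuotient.exists_submanifold (t : InvTensor g) (c : LieSubalgebra ℝ g)
    (hc : t.IsCoisotropic c.toSubmodule) {A : LieAct g M} {q : M → Q}
    (hq : A.IsQuotient (t.perp c.toSubmodule) id q) {i : S → M} (hi : IsInjImmersion i)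
    (hρ : ∀ v ∈ c, ∀ s, ∃ ξ : S.T s, tmap i s ξ = A.rho v (i s))
    (hr : ∀ s y, A.SameOrbit c.toSubmodule (i s) y → y ∈ range i) :
    ∃ (M' : Mfd.{u}) (r : S → M') (ι : M' → Q), A.IsQuotient (t.perp c.toSubmodule) i r ∧
      IsInjImmersion ι ∧ (∀ s, ι (r s) = q (i s)) ∧ (IsEmbedding i → IsEmbedding ι) := by
  classical
  have hle := t.perp_le_of_isCoisotropic hc
  have hs := hq.surjSubmersion
  have hF : Smooth (q ∘ i) := hs.smooth.comp hi.smooth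
  have htan : ∀ x (ξ : M.T x), tmap q x ξ = 0 ↔ ξ ∈ (t.perp c.toSubmodule).map (A.at x) := by
    intro x ξ
    rw [hq.tangent x ξ, tmap_id]; rfl
  have hfib : ∀ x y, q x = q y ↔ A.SameOrbit (t.perp c.toSubmodule) x y := hq.fibres
  obtain ⟨A₁, hA₁⟩ := A.exists_restrict_subalgebra c hi hρ
  have hlift : ∀ a b, q (i a) = q (i b) → A₁.SameOrbit (LinearMap.ker (t.redMk c)) a b := by
    intro a b hab
    refine LieAct.SameOrbit.lift (A := A) (h := t.perp c.toSubmodule) hi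
      (fun v => if hv : v ∈ c then ⟨v, hv⟩ else 0) (fun v hv => ?_) (fun v hv x => ?_)
      (fun a y hy => hr a y (LieAct.SameOrbit.mono A hle hy)) ((hfib _ _).1 hab)
    · have hv' : v ∈ c := hle hv
      rw [dif_pos hv', t.ker_redMk]; exact hv
    · have hv' : v ∈ c := hle hv
      rw [dif_pos hv']; exact hA₁ ⟨v, hv'⟩ x
  obtain ⟨M', r, ι, hr', hι, hιr⟩ := exists_quotient_of_constantRank hF (k := M.dim - Q.dim)
    (fun s => by
      have h1 := finrank_ker_dmap (dmap q (i s)) (hs.submersion (i s)) (dmap i s) (hi.immersion s)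
        (fun ξ hξ => by
          obtain ⟨w, hw, hwξ⟩ := (htan (i s) ξ).1 hξ
          obtain ⟨v, hv⟩ := hρ w (hle hw) s
          exact ⟨v, hv.trans hwξ⟩)
      have h2 : dmap (q ∘ i) s = (dmap q (i s)).comp (dmap i s) := tmap_comp hs.smooth hi.smooth s
      rw [← h2] at h1
      exact h1)
    (fun a b hab => by
      refine Relation.ReflTransGen.mono ?_ _ _ (hlift a b hab)
      rintro x y ⟨v, hv, γ, hγ, h0, h1⟩
      have hc0 : ∀ τ ∈ Icc (0 : ℝ) 1, q (i (γ 0)) = q (i (γ τ)) := fun τ hτ => by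
        rw [hfib]
        refine LieAct.SameOrbit.map (A := A₁) (h := LinearMap.ker (t.redMk c)) hi.smooth
          (fun v : c => (v : g)) (fun v hv => (t.ker_redMk c v).1 hv) (fun v _ x => hA₁ v x)
          (A₁.sameOrbit_of_integralCurve hv hγ hτ)
      exact ⟨γ, hγ.continuousOn, fun τ hτ τ' hτ' => (hc0 τ hτ).symm.trans (hc0 τ' hτ'), h0, h1⟩)
  have hιr : ∀ s, ι (r s) = q (i s) := hιr
  have hcomp : ι ∘ r = q ∘ i := funext hιr
  refine ⟨M', r, ι, ⟨hr', fun a b => ?_, fun a ξ => ?_⟩, hι, hιr, fun hemb => ?_⟩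
  · rw [← hfib, ← hιr, ← hιr, hι.injective.eq_iff]
  · rw [← htan]
    have h1 : dmap ι (r a) (dmap r a ξ) = dmap q (i a) (dmap i a ξ) :=
      (tmap_comp_apply hι.smooth hr'.smooth a ξ).symm.trans ((congrArg (fun G : S → Q =>
        dmap G a ξ) hcomp).trans (tmap_comp_apply hs.smooth hi.smooth a ξ))
    constructor
    · intro h
      exact h1.symm.trans ((congrArg (dmap ι (r a)) h).trans (map_zero (dmap ι (r a))))
    · intro h
      exact hι.immersion (r a) ((h1.trans h).trans (map_zero (dmap ι (r a))).symm)
  · refine ⟨⟨?_⟩, hι.injective⟩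
    refine le_antisymm hι.smooth.continuous.le_induced fun U hU => ?_
    -- `q` is open, and a point of `W` in the same fibre as a point of the submanifold lies in the
    -- submanifold by invariance. So the image of `W` cuts out exactly `U`.
    obtain ⟨W, hW, hWU⟩ := hemb.isInducing.isOpen_iff.1 (hU.preimage hr'.smooth.continuous)
    refine ⟨q '' W, hs.isOpenMap W hW, ?_⟩
    ext m
    obtain ⟨s, rfl⟩ := hr'.surjective m
    constructor
    · rintro ⟨w, hw, hws⟩
      rw [hιr] at hws
      obtain ⟨s', rfl⟩ := hr s w (LieAct.SameOrbit.mono A hle ((hfib _ _).1 hws.symm))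
      rw [← hιr, ← hιr] at hws
      rw [← hι.injective hws]
      exact hWU.subset hw
    · intro hm
      exact ⟨i s, hWU.symm.subset hm, (hιr s).symm⟩

end InvariantSubmanifold

/-! ### Invariance and topology of the preimage of two orbits -/

section Preimage

variable {g : Type*} [LieRing g] [LieAlgebra ℝ g] {M N O NL NR OL OR S : Mfd.{u}}

/-- The point `y` is separate from `j a` because the intended points `μL (iM s)` and `jL (iL s)` are
only provably equal; vectors are compared in the model space. -/
theorem LieAct.IsOrbit.exists_dmap_eq {A : LieAct g N} {h : Submodule ℝ g} {j : O → N}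
    (hj : A.IsOrbit h j) {a : O} {y : N} (hy : y = j a) {w : N.T y} (hw : w ∈ h.map (A.at y)) :
    ∃ η : O.Model, dmap j a η = w := by
  subst hy
  rw [← hj.tangent] at hw
  exact hw

theorem LieAct.IsOrbit.dmap_mem {A : LieAct g N} {h : Submodule ℝ g} {j : O → N}
    (hj : A.IsOrbit h j) {a : O} {y : N} (hy : y = j a) {w : N.T y} {η : O.Model}
    (hw : dmap j a η = w) : w ∈ h.map (A.at y) := by
  subst hy
  rw [← hj.tangent]
  exact ⟨η, hw⟩

variable {AL : LieAct g NL} {AR : LieAct g NR} {A : LieAct g M} {μL : M → NL} {μR : M → NR}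
  {jL : OL → NL} {jR : OR → NR} {iM : S → M} {iL : S → OL} {iR : S → OR} {h : Submodule ℝ g}

theorem IsPreimage.eqL (hS : IsPreimage μL μR jL jR iM iL iR) (s : S) : μL (iM s) = jL (iL s) :=
  (hS.range_eq.subset (mem_range_self s)).1

theorem IsPreimage.eqR (hS : IsPreimage μL μR jL jR iM iL iR) (s : S) : μR (iM s) = jR (iR s) :=
  (hS.range_eq.subset (mem_range_self s)).2

theorem IsPreimage.dmapL (hS : IsPreimage μL μR jL jR iM iL iR) (hμ : Smooth μL) (hj : Smooth jL)
    (s : S) (v : S.Model) : dmap μL (iM s) (dmap iM s v) = dmap jL (iL s) (dmap iL s v) :=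
  (tmap_comp_apply hμ hS.immersed.smooth s v).symm.trans ((congrArg (fun G : S → NL => dmap G s v)
    (funext hS.eqL)).trans (tmap_comp_apply hj hS.smoothL s v))

theorem IsPreimage.dmapR (hS : IsPreimage μL μR jL jR iM iL iR) (hμ : Smooth μR) (hj : Smooth jR)
    (s : S) (v : S.Model) : dmap μR (iM s) (dmap iM s v) = dmap jR (iR s) (dmap iR s v) :=
  (tmap_comp_apply hμ hS.immersed.smooth s v).symm.trans ((congrArg (fun G : S → NR => dmap G s v)
    (funext hS.eqR)).trans (tmap_comp_apply hj hS.smoothR s v))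

theorem IsPreimage.mem_range (hS : IsPreimage μL μR jL jR iM iL iR) {x : M} (hL : μL x ∈ range jL)
    (hR : μR x ∈ range jR) : x ∈ range iM := by
  obtain ⟨a, ha⟩ := hL
  obtain ⟨b, hb⟩ := hR
  obtain ⟨s, hs⟩ := hS.range_eq.symm.subset
    (show (x, a, b) ∈ {p : M × OL × OR | μL p.1 = jL p.2.1 ∧ μR p.1 = jR p.2.2} from
      ⟨ha.symm, hb.symm⟩)
  exact ⟨s, congrArg Prod.fst hs⟩

/-- Equivariance carries the orbit in `M` to orbits in `NL` and `NR`, which cannot leave `OL` and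
`OR`. -/
theorem IsPreimage.mem_range_of_sameOrbit (hS : IsPreimage μL μR jL jR iM iL iR)
    (hL : AL.IsOrbit h jL) (hR : AR.IsOrbit h jR) (hμL : Smooth μL) (hμR : Smooth μR)
    (eL : Equivariant A AL μL) (eR : Equivariant A AR μR) {s : S} {y : M}
    (hy : A.SameOrbit h (iM s) y) : y ∈ range iM := by
  refine hS.mem_range (hL.mem_range (a := iL s) ?_) (hR.mem_range (a := iR s) ?_)
  · rw [← hS.eqL]
    exact LieAct.SameOrbit.map hμL id (fun _ hv => hv) (fun v _ x => eL v x) hy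
  · rw [← hS.eqR]
    exact LieAct.SameOrbit.map hμR id (fun _ hv => hv) (fun v _ x => eR v x) hy

/-- The preimage is embedded if the submanifolds are. -/
theorem IsPreimage.isEmbedding (hS : IsPreimage μL μR jL jR iM iL iR) (hμL : Continuous μL)
    (hμR : Continuous μR) (hL : IsEmbedding jL) (hR : IsEmbedding jR) : IsEmbedding iM := by
  refine ⟨?_, hS.immersed.injective⟩
  refine isInducing_iff_nhds.2 fun s => le_antisymm
    ((hS.immersed.smooth.continuous.tendsto s).le_comap) ?_
  -- The topology of the fibre product is generated by `iM`, `iL` and `iR`. When `jL` and `jR` are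
  -- embeddings, the last two add nothing, since `jL ∘ iL = μL ∘ iM` and likewise on the right.
  rw [hS.embedding.isInducing.nhds_eq_comap s, nhds_prod_eq, nhds_prod_eq, prod_eq_inf,
    prod_eq_inf]
  simp only [comap_inf, comap_comap]
  refine le_inf le_rfl (le_inf ?_ ?_)
  · rw [hL.isInducing.nhds_eq_comap, comap_comap, ← hS.eqL]
    change _ ≤ comap (jL ∘ iL) _
    rw [← show μL ∘ iM = jL ∘ iL from funext hS.eqL, ← comap_comap]
    exact comap_mono (hμL.tendsto (iM s)).le_comap
  · rw [hR.isInducing.nhds_eq_comap, comap_comap, ← hS.eqR]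
    change _ ≤ comap (jR ∘ iR) _
    rw [← show μR ∘ iM = jR ∘ iR from funext hS.eqR, ← comap_comap]
    exact comap_mono (hμR.tendsto (iM s)).le_comap

end Preimage

/-! ## Linear algebra -/

section LinearAlgebra

variable {V W A B : Type*} [AddCommGroup V] [Module ℝ V] [AddCommGroup W] [Module ℝ W]
  [AddCommGroup A] [Module ℝ A] [AddCommGroup B] [Module ℝ B]

theorem exists_dual_comp_eq (f : W →ₗ[ℝ] V) (θ : W →ₗ[ℝ] ℝ) (h : ∀ w, f w = 0 → θ w = 0) :
    ∃ l : V →ₗ[ℝ] ℝ, ∀ w, l (f w) = θ w := by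
  have h1 : θ ∈ (LinearMap.ker f).dualAnnihilator :=
    (Submodule.mem_dualAnnihilator θ).2 fun w hw => h w hw
  rw [← LinearMap.range_dualMap_eq_dualAnnihilator_ker] at h1
  obtain ⟨l, rfl⟩ := h1
  exact ⟨l, fun w => rfl⟩

/-- A linear form vanishing on `F₁⁻¹(W₁) ∩ F₂⁻¹(W₂)` is the sum of the pullbacks of forms vanishing
on `W₁` and `W₂`. -/
theorem exists_dual_add_eq (F₁ : V →ₗ[ℝ] A) (F₂ : V →ₗ[ℝ] B) (W₁ : Submodule ℝ A)
    (W₂ : Submodule ℝ B) (b : V →ₗ[ℝ] ℝ) (h : ∀ v, F₁ v ∈ W₁ → F₂ v ∈ W₂ → b v = 0) :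
    ∃ (l : A →ₗ[ℝ] ℝ) (k : B →ₗ[ℝ] ℝ), (∀ w ∈ W₁, l w = 0) ∧ (∀ w ∈ W₂, k w = 0) ∧
      ∀ v, b v = l (F₁ v) + k (F₂ v) := by
  -- The form vanishes on the kernel of the map to A/W₁ × B/W₂, hence factors through it.
  obtain ⟨θ, hθ⟩ := exists_dual_comp_eq ((W₁.mkQ ∘ₗ F₁).prod (W₂.mkQ ∘ₗ F₂)) b fun v hv => by
    have h1 := congrArg Prod.fst hv
    have h2 := congrArg Prod.snd hv
    exact h v ((Submodule.Quotient.mk_eq_zero W₁).1 h1) ((Submodule.Quotient.mk_eq_zero W₂).1 h2)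
  refine ⟨θ ∘ₗ LinearMap.inl ℝ _ _ ∘ₗ W₁.mkQ, θ ∘ₗ LinearMap.inr ℝ _ _ ∘ₗ W₂.mkQ, fun w hw => ?_,
    fun w hw => ?_, fun v => ?_⟩
  · have : W₁.mkQ w = 0 := (Submodule.Quotient.mk_eq_zero W₁).2 hw
    simp only [LinearMap.comp_apply, this, map_zero]
  · have : W₂.mkQ w = 0 := (Submodule.Quotient.mk_eq_zero W₂).2 hw
    simp only [LinearMap.comp_apply, this, map_zero]
  · rw [← hθ]
    simp only [LinearMap.comp_apply, ← map_add]
    congr 1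
    simp

theorem exists_eval_eq [FiniteDimensional ℝ W] (f : V →ₗ[ℝ] Module.Dual ℝ W) (θ : V →ₗ[ℝ] ℝ)
    (h : ∀ v, f v = 0 → θ v = 0) : ∃ w, ∀ v, θ v = f v w := by
  obtain ⟨l, hl⟩ := exists_dual_comp_eq f θ h
  obtain ⟨w, rfl⟩ := (Module.bijective_dual_eval ℝ W).2 l
  exact ⟨w, fun v => (hl v).symm⟩

/-- A subspace of the dual with zero common kernel is the whole dual. -/
theorem exists_of_forall_eq_zero [FiniteDimensional ℝ W] (Ψ : V →ₗ[ℝ] Module.Dual ℝ W)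
    (h : ∀ w, (∀ v, Ψ v w = 0) → w = 0) (θ : W →ₗ[ℝ] ℝ) : ∃ v, ∀ w, θ w = Ψ v w := by
  obtain ⟨l, hl⟩ := exists_dual_comp_eq Ψ.flip θ fun w hw => by
    rw [h w fun v => LinearMap.congr_fun hw v, map_zero]
  have h1 : LinearMap.range Ψ = ⊤ := by
    rw [← Subspace.dualCoannihilator_dualAnnihilator_eq (W := LinearMap.range Ψ)]
    have : (LinearMap.range Ψ).dualCoannihilator = ⊥ := by
      rw [eq_bot_iff]
      intro w hw
      exact h w fun v => (Submodule.mem_dualCoannihilator _).1 hw _ ⟨v, rfl⟩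
    rw [this, Submodule.dualAnnihilator_bot]
  obtain ⟨v, hv⟩ := LinearMap.range_eq_top.1 h1 θ
  exact ⟨v, fun w => by rw [hv]⟩

end LinearAlgebra

/-! ### The form σ on covectors -/

section Covectors

variable {g : Type*} [LieRing g] [LieAlgebra ℝ g] {M N : Mfd.{u}}

/-- A linear form on a tangent space as a covector. -/
def toCovector {x : M} (l : M.Model →ₗ[ℝ] ℝ) : M.coT x :=
  (⟨l, LinearMap.continuous_of_finiteDimensional l⟩ : M.Model →L[ℝ] ℝ)

theorem LieAct.coat_apply (A : LieAct g M) (x : M) (α : M.coT x) (v : g) :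
    A.coat x α v = α (A.rho v x) := rfl

theorem LieAct.coat_add (A : LieAct g M) (x : M) (α β : M.coT x) :
    A.coat x (α + β) = A.coat x α + A.coat x β := rfl

theorem LieAct.coat_sub (A : LieAct g M) (x : M) (α β : M.coT x) :
    A.coat x (α - β) = A.coat x α - A.coat x β := rfl

theorem Equivariant.coat_comp {A : LieAct g M} {B : LieAct g N} {F : M → N}
    (hF : Equivariant A B F) (x : M) (l : N.coT (F x)) :
    A.coat x (l.comp (tmap F x)) = B.coat (F x) l :=
  LinearMap.ext fun v => congrArg l (hF v x)

variable {t : InvTensor g} (P : QPoisson t M)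

theorem QPoisson.pi_eq (x : M) (α β : M.coT x) :
    P.pi x α β = P.sigma x α β - (1 / 2) * P.coat x β (t.sharp (P.coat x α)) := by
  unfold QPoisson.sigma; ring

/-- Skewness of π leaves only the t-part in the symmetrization of σ. -/
theorem QPoisson.sigma_swap (x : M) (α β : M.coT x) :
    P.sigma x α β = P.coat x β (t.sharp (P.coat x α)) - P.sigma x β α := by
  unfold QPoisson.sigma
  rw [P.skew x β α, t.symm (P.coat x β)]
  ring

theorem QPoisson.sigma_add_left (x : M) (α α' β : M.coT x) :
    P.sigma x (α + α') β = P.sigma x α β + P.sigma x α' β := by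
  unfold QPoisson.sigma
  rw [P.coat_add, map_add, map_add, map_add, LinearMap.add_apply]
  ring

theorem QPoisson.sigma_add_right (x : M) (α β β' : M.coT x) :
    P.sigma x α (β + β') = P.sigma x α β + P.sigma x α β' := by
  unfold QPoisson.sigma
  rw [P.coat_add, map_add, LinearMap.add_apply]
  ring

theorem QPoisson.sigma_sub_right (x : M) (α β β' : M.coT x) :
    P.sigma x α (β - β') = P.sigma x α β - P.sigma x α β' := by
  unfold QPoisson.sigma
  rw [P.coat_sub, map_sub, LinearMap.sub_apply]
  ring

/-- The symmetric part of σ = 0: stabilizers are coisotropic. -/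
theorem QPoisson.IsCommutative.coat_sharp {P : QPoisson t M} (h : P.IsCommutative) (x : M)
    (α β : M.coT x) : P.coat x β (t.sharp (P.coat x α)) = 0 := by
  have := P.sigma_swap x α β
  rw [h, h, sub_zero] at this
  exact this.symm

theorem InvTensor.apply_sharp_eq_zero (t : InvTensor g) {c : Submodule ℝ g} {α β : Module.Dual ℝ g}
    (hα : ∀ w ∈ t.perp c, α w = 0) (hβ : ∀ u ∈ c, β u = 0) : α (t.sharp β) = 0 :=
  hα _ ⟨β, (Submodule.mem_dualAnnihilator β).2 hβ, rfl⟩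

end Covectors

/-! ## Split-symplectic central pairs at a point -/

section Pair

variable {g : Type*} [LieRing g] [LieAlgebra ℝ g] {t : InvTensor g} {M NL NR : Mfd.{u}}
  {P : QPoisson t M} {PL : QPoisson t NL} {PR : QPoisson t NR} {μL : M → NL} {μR : M → NR}

theorem IsCentralPair.sigma_left (h : IsCentralPair P PL PR μL μR) (x : M) (l : NL.coT (μL x))
    (β : M.coT x) : P.sigma x (l.comp (tmap μL x)) β = 0 := by
  obtain ⟨f, hf, rfl⟩ := exists_smoothFun_diff_eq _ l
  rw [← diff_comp hf h.smoothL]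
  exact h.centralL f hf x β

theorem IsCentralPair.sigma_right (h : IsCentralPair P PL PR μL μR) (x : M) (k : NR.coT (μR x))
    (β : M.coT x) : P.sigma x β (k.comp (tmap μR x)) = 0 := by
  obtain ⟨f, hf, rfl⟩ := exists_smoothFun_diff_eq _ k
  rw [← diff_comp hf h.smoothR]
  exact h.centralR f hf x β

/-- In the slot where a central pullback is not null, only the symmetric part of σ survives. -/
theorem IsCentralPair.sigma_left' (h : IsCentralPair P PL PR μL μR) (x : M) (l : NL.coT (μL x))
    (β : M.coT x) :
    P.sigma x β (l.comp (tmap μL x)) = P.coat x β (t.sharp (PL.coat (μL x) l)) := by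
  rw [P.sigma_swap, h.sigma_left, h.equivariantL.coat_comp, t.symm, sub_zero]

theorem IsCentralPair.sigma_right' (h : IsCentralPair P PL PR μL μR) (x : M) (k : NR.coT (μR x))
    (β : M.coT x) :
    P.sigma x (k.comp (tmap μR x)) β = P.coat x β (t.sharp (PR.coat (μR x) k)) := by
  rw [P.sigma_swap, h.sigma_right, h.equivariantR.coat_comp, sub_zero]

variable {c : Submodule ℝ g}

/-- Covectors vanishing on the preimage of the tangent spaces of orbits. -/
theorem IsCentralPair.exists_eq_add (x : M) {a : M.coT x}
    (ha : ∀ ξ : M.T x, tmap μL x ξ ∈ c.map (PL.at (μL x)) → tmap μR x ξ ∈ c.map (PR.at (μR x)) →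
      a ξ = 0) :
    ∃ (l : NL.coT (μL x)) (k : NR.coT (μR x)), (∀ u ∈ c, PL.coat (μL x) l u = 0) ∧
      (∀ u ∈ c, PR.coat (μR x) k u = 0) ∧ a = l.comp (tmap μL x) + k.comp (tmap μR x) := by
  obtain ⟨l, k, hl, hk, h⟩ := exists_dual_add_eq
    (tmap μL x : M.T x →ₗ[ℝ] NL.T (μL x)) (tmap μR x : M.T x →ₗ[ℝ] NR.T (μR x)) _ _
    (a : M.T x →ₗ[ℝ] ℝ) ha
  exact ⟨toCovector l, toCovector k, fun u hu => hl _ ⟨u, hu, rfl⟩, fun u hu => hk _ ⟨u, hu, rfl⟩,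
    ContinuousLinearMap.ext h⟩

/-- The left part is null by centrality and `l` is unrestricted; the right part contributes the
pairing of ρ*b with t♯ρ*k, an element of c^⊥. The freedom in `l` is what makes the reduced left map
central. -/
theorem IsCentralPair.sigma_eq_zero_left (h : IsCentralPair P PL PR μL μR) (x : M) {a b : M.coT x}
    (hb : ∀ w ∈ t.perp c, P.coat x b w = 0) {l : NL.coT (μL x)} {k : NR.coT (μR x)}
    (hk : ∀ u ∈ c, PR.coat (μR x) k u = 0) (ha : a = l.comp (tmap μL x) + k.comp (tmap μR x)) :
    P.sigma x a b = 0 := by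
  rw [ha, P.sigma_add_left, h.sigma_left, h.sigma_right', zero_add]
  exact t.apply_sharp_eq_zero hb hk

theorem IsCentralPair.sigma_eq_zero_right (h : IsCentralPair P PL PR μL μR) (x : M) {a b : M.coT x}
    (hb : ∀ w ∈ t.perp c, P.coat x b w = 0) {l : NL.coT (μL x)} {k : NR.coT (μR x)}
    (hl : ∀ u ∈ c, PL.coat (μL x) l u = 0) (ha : a = l.comp (tmap μL x) + k.comp (tmap μR x)) :
    P.sigma x b a = 0 := by
  rw [ha, P.sigma_add_right, h.sigma_left', h.sigma_right, add_zero]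
  exact t.apply_sharp_eq_zero hb hl

/-- The bivector of the quotient by `c^⊥` is tangent to the preimage of a pair of orbits. -/
theorem IsCentralPair.pi_eq_zero (h : IsCentralPair P PL PR μL μR) (x : M) {a b : M.coT x}
    (hb : ∀ w ∈ t.perp c, P.coat x b w = 0)
    (ha : ∀ ξ : M.T x, tmap μL x ξ ∈ c.map (PL.at (μL x)) → tmap μR x ξ ∈ c.map (PR.at (μR x)) →
      a ξ = 0) : P.pi x a b = 0 := by
  obtain ⟨l, k, hl, hk, rfl⟩ := IsCentralPair.exists_eq_add x ha
  -- The t-part of σ vanishes for the same reason as σ, so π vanishes.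
  rw [P.pi_eq, h.sigma_eq_zero_left x hb hk rfl, P.coat_add, h.equivariantL.coat_comp,
    h.equivariantR.coat_comp, map_add, map_add, t.apply_sharp_eq_zero hb hl,
    t.apply_sharp_eq_zero hb hk]
  simp

/-- The image of the transpose of ρ at x is the annihilator of the stabilizer. -/
theorem LieAct.exists_coat_eq (A : LieAct g M) (x : M) {θ : Module.Dual ℝ g}
    (h : ∀ v, A.rho v x = 0 → θ v = 0) : ∃ l : M.coT x, A.coat x l = θ := by
  obtain ⟨l, hl⟩ := exists_dual_comp_eq (A.at x) θ h
  exact ⟨toCovector l, LinearMap.ext hl⟩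

/-- The dual form of T^big M = TM: no nonzero covector annihilates it. -/
theorem IsSplitSymplecticPair.eq_zero (h : IsSplitSymplecticPair P PL PR μL μR) (x : M)
    {b : M.coT x} (h1 : P.coat x b = 0) (h2 : ∀ a, P.pi x a b = 0) : b = 0 := by
  refine ContinuousLinearMap.ext fun ξ => ?_
  obtain ⟨v, α, hv⟩ := h.big x ξ
  rw [hv b, h2 α, add_zero]
  exact LinearMap.congr_fun h1 v

/-- L is the image of Ann L under the injective map t♯. -/
theorem InvTensor.IsLagrangian.eq_zero {L : Submodule ℝ g} (hL : t.IsLagrangian L)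
    (ht : t.Nondegenerate) {θ : Module.Dual ℝ g} (hθ : t.sharp θ ∈ L) : ∀ v ∈ L, θ v = 0 := by
  rw [← hL] at hθ
  obtain ⟨η, hη, h⟩ := hθ
  rw [← ht.1 h]
  exact (Submodule.mem_dualAnnihilator η).1 hη

/-- The hypothesis puts t♯θ in the stabilizer of μL(x). That stabilizer is Lagrangian, so θ
annihilates it and comes from a covector on `NL`. -/
theorem IsSplitSymplecticPair.exists_eq_left (h : IsSplitSymplecticPair P PL PR μL μR) (x : M)
    {θ : Module.Dual ℝ g} (hθ : ∀ l : NL.coT (μL x), PL.coat (μL x) l (t.sharp θ) = 0) :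
    ∃ l : NL.coT (μL x), PL.coat (μL x) l = θ :=
  PL.exists_coat_eq _ fun v hv => (h.lagrangianL (μL x)).eq_zero h.nondegenerate
    (cotangent_separates fun α => hθ α) v hv

theorem IsSplitSymplecticPair.exists_eq_right (h : IsSplitSymplecticPair P PL PR μL μR) (x : M)
    {θ : Module.Dual ℝ g} (hθ : ∀ l : NR.coT (μR x), PR.coat (μR x) l (t.sharp θ) = 0) :
    ∃ l : NR.coT (μR x), PR.coat (μR x) l = θ :=
  PR.exists_coat_eq _ fun v hv => (h.lagrangianR (μR x)).eq_zero h.nondegenerate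
    (cotangent_separates fun α => hθ α) v hv

/-- The functional π(·,b) vanishes on the annihilator of ρ(c^⊥), so by reflexivity it is evaluation
at a vector of ρ(c^⊥) = ρ(t♯ Ann c). -/
theorem QPoisson.exists_pi_eq [FiniteDimensional ℝ g] (P : QPoisson t M) (x : M) {b : M.coT x}
    (hb : ∀ a : M.coT x, (∀ w ∈ t.perp c, P.coat x a w = 0) → P.pi x a b = 0) :
    ∃ η : Module.Dual ℝ g, (∀ u ∈ c, η u = 0) ∧ ∀ a, P.pi x a b = P.coat x a (t.sharp η) := by
  let f : M.coT x →ₗ[ℝ] Module.Dual ℝ (t.perp c) :=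
    { toFun := fun a => P.coat x a ∘ₗ (t.perp c).subtype
      map_add' := fun _ _ => rfl
      map_smul' := fun _ _ => rfl }
  obtain ⟨⟨w, η, hη, hw⟩, h⟩ := exists_eval_eq f ((P.pi x).flip b) fun a ha =>
    hb a fun w hw => LinearMap.congr_fun ha ⟨w, hw⟩
  refine ⟨η, (Submodule.mem_dualAnnihilator η).1 hη, fun a => (h a).trans ?_⟩
  exact congrArg (P.coat x a) hw.symm

/-- The kernel of the reduced structure. -/
theorem IsSplitSymplecticPair.exists_eq_add [FiniteDimensional ℝ g]
    (h : IsSplitSymplecticPair P PL PR μL μR) (x : M) {b : M.coT x}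
    (hbc : ∀ u ∈ c, P.coat x b u = 0)
    (hb : ∀ a : M.coT x, (∀ w ∈ t.perp c, P.coat x a w = 0) → P.pi x a b = 0) :
    ∃ (l : NL.coT (μL x)) (k : NR.coT (μR x)), (∀ u ∈ c, PL.coat (μL x) l u = 0) ∧
      (∀ u ∈ c, PR.coat (μR x) k u = 0) ∧ b = l.comp (tmap μL x) + k.comp (tmap μR x) := by
  obtain ⟨η, hη, hπ⟩ := P.exists_pi_eq x hb
  have hσ : ∀ a, P.sigma x a b = P.coat x a (t.sharp (η + (1 / 2 : ℝ) • P.coat x b)) := by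
    intro a
    unfold QPoisson.sigma
    rw [hπ, t.symm (P.coat x a) (P.coat x b), map_add, map_add, map_smul, map_smul, smul_eq_mul]
  -- Left centrality gives σ(μL*l, b) = 0 for all l, so t♯(η + ½ρ*b) fixes μL(x). Subtracting the
  -- resulting pullback from b puts it in the right kernel of σ.
  obtain ⟨l, hl⟩ := h.exists_eq_left x (θ := η + (1 / 2 : ℝ) • P.coat x b) fun l => by
    have h1 := hσ (l.comp (tmap μL x))
    rw [h.sigma_left, h.equivariantL.coat_comp] at h1
    exact h1.symm
  have hσ₁ : ∀ a, P.sigma x a (b - l.comp (tmap μL x)) = 0 := fun a => by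
    rw [P.sigma_sub_right, h.sigma_left', hl, hσ, sub_self]
  -- For a covector in the right kernel of σ, pairing with μR*k on the left shows that t♯ of its
  -- image in the dual of g fixes μR(x).
  obtain ⟨k, hk⟩ := h.exists_eq_right x (θ := P.coat x (b - l.comp (tmap μL x))) fun k => by
    rw [t.symm, ← h.sigma_right', hσ₁]
  -- What remains kills ρ(g) and is in the kernel of π, so it annihilates T^big M.
  have hb₂ : b - l.comp (tmap μL x) - k.comp (tmap μR x) = 0 := by
    have h1 : P.coat x (b - l.comp (tmap μL x) - k.comp (tmap μR x)) = 0 := by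
      rw [P.coat_sub, h.equivariantR.coat_comp, hk, sub_self]
    refine h.eq_zero x h1 fun a => ?_
    rw [P.pi_eq, P.sigma_sub_right, hσ₁, h.sigma_right, h1]
    simp
  have hlc : ∀ u ∈ c, PL.coat (μL x) l u = 0 := fun u hu => by
    rw [hl, LinearMap.add_apply, LinearMap.smul_apply, hη u hu, hbc u hu]; simp
  refine ⟨l, k, hlc, fun u hu => ?_, ?_⟩
  · rw [hk, P.coat_sub, LinearMap.sub_apply, hbc u hu, h.equivariantL.coat_comp, hlc u hu, sub_zero]
  · rw [sub_sub, sub_eq_zero] at hb₂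
    exact hb₂

end Pair

/-! ## Reduction of the Lie algebra -/

section Algebra

variable {g : Type*} [LieRing g] [LieAlgebra ℝ g] (t : InvTensor g) (c : LieSubalgebra ℝ g)
  (hc : t.IsCoisotropic c.toSubmodule)

theorem InvTensor.apply_perp_eq_zero {c : Submodule ℝ g} {α : Module.Dual ℝ g}
    (hα : t.sharp α ∈ c) : ∀ w ∈ t.perp c, α w = 0 := by
  rintro _ ⟨γ, hγ, rfl⟩
  rw [t.symm]
  exact (Submodule.mem_dualAnnihilator γ).1 hγ _ hα

/-- Covectors vanishing on `c^⊥` descend from `c` to `c / c^⊥`. -/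
theorem InvTensor.exists_dual_redMk {α : Module.Dual ℝ g}
    (hα : ∀ w ∈ t.perp c.toSubmodule, α w = 0) :
    ∃ ξ : Module.Dual ℝ (t.RedAlg c), ∀ u : c, α (u : g) = ξ (t.redMk c u) := by
  obtain ⟨ξ, hξ⟩ := exists_dual_comp_eq (t.redMk c) (α ∘ₗ (c.incl : c →ₗ[ℝ] g))
    fun u hu => hα _ ((t.redMk_eq_zero c u).1 hu)
  exact ⟨ξ, fun u => (hξ u).symm⟩

variable {t c}

/-- A representative u in c is t♯α, and α kills c^⊥ because u is in c, so α descends: the reduced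
map is onto. Injectivity follows from surjectivity by symmetry. -/
theorem InvTensor.Nondegenerate.reduced (ht : t.Nondegenerate) : (t.reduced c hc).Nondegenerate := by
  have hs : Surjective (t.reduced c hc).sharp := by
    intro w
    obtain ⟨u, rfl⟩ := t.redMk_surjective c w
    obtain ⟨α, hα⟩ := ht.2 (u : g)
    obtain ⟨ξ, hξ⟩ := t.exists_dual_redMk c (t.apply_perp_eq_zero (c := c.toSubmodule)
      (by rw [hα]; exact u.2))
    refine ⟨ξ, (t.redSharp_apply c hc ξ α hξ).trans ?_⟩
    exact congrArg _ (Subtype.ext hα)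
  refine ⟨?_, hs⟩
  rw [injective_iff_map_eq_zero]
  intro ξ hξ
  refine LinearMap.ext fun w => ?_
  obtain ⟨η, rfl⟩ := hs w
  rw [(t.reduced c hc).symm, hξ, map_zero]; rfl

/-- Reduction of Lagrangian subspaces. -/
theorem InvTensor.IsLagrangian.reduced {L : Submodule ℝ g} (hL : t.IsLagrangian L)
    {L' : Submodule ℝ (t.RedAlg c)}
    (hLL' : ∀ u : c, t.redMk c u ∈ L' ↔ (u : g) ∈ L ⊔ t.perp c.toSubmodule) :
    (t.reduced c hc).IsLagrangian L' := by
  refine le_antisymm ?_ ?_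
  · rintro _ ⟨ξ, hξ, rfl⟩
    have hξ := (Submodule.mem_dualAnnihilator ξ).1 hξ
    rw [show (t.reduced c hc).sharp ξ = _ from t.redSharp_apply c hc ξ _ (t.ext_apply c ξ), hLL']
    -- The extended form vanishes on L ∩ c, hence is a sum from Ann L and Ann c; t♯ sends these to L
    -- and c^⊥.
    obtain ⟨l, k, hl, hk, h⟩ := exists_dual_add_eq (LinearMap.id : g →ₗ[ℝ] g) LinearMap.id L
      c.toSubmodule (t.ext c ξ) fun v hv hv' => by
        refine (t.ext_apply c ξ ⟨v, hv'⟩).trans (hξ _ ((hLL' _).2 (Submodule.mem_sup_left hv)))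
    have h' : t.ext c ξ = l + k := LinearMap.ext h
    change t.sharp (t.ext c ξ) ∈ _
    rw [h', map_add]
    refine Submodule.add_mem_sup ?_ ⟨k, (Submodule.mem_dualAnnihilator k).2 hk, rfl⟩
    rw [← hL]
    exact ⟨l, (Submodule.mem_dualAnnihilator l).2 hl, rfl⟩
  · intro w hw
    obtain ⟨u, rfl⟩ := t.redMk_surjective c w
    -- Modulo c^⊥ the representative may be taken in L ∩ c. It is then t♯α with α in Ann L, and α
    -- kills c^⊥ because t♯α is in c.
    obtain ⟨l, hl, k, hk, hlk⟩ := Submodule.mem_sup.1 ((hLL' u).1 hw)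
    have hlc : l ∈ c.toSubmodule := by
      rw [show l = u - k by rw [← hlk, add_sub_cancel_right]]
      exact c.toSubmodule.sub_mem u.2 (t.perp_le_of_isCoisotropic hc hk)
    have hu : t.redMk c u = t.redMk c ⟨l, hlc⟩ := by
      rw [← sub_eq_zero, ← map_sub, t.redMk_eq_zero]
      change (u : g) - l ∈ _
      rw [← hlk, add_sub_cancel_left]
      exact hk
    have hl' := hl
    rw [← hL] at hl'
    obtain ⟨α, hα, rfl⟩ := hl'
    have hα := (Submodule.mem_dualAnnihilator α).1 hα
    have hαp := t.apply_perp_eq_zero hlc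
    obtain ⟨ξ, hξ⟩ := t.exists_dual_redMk c hαp
    refine ⟨ξ, (Submodule.mem_dualAnnihilator ξ).2 fun w hw => ?_, ?_⟩
    · obtain ⟨u', rfl⟩ := t.redMk_surjective c w
      obtain ⟨l', hl', k', hk', hlk'⟩ := Submodule.mem_sup.1 ((hLL' u').1 hw)
      rw [← hξ, ← hlk', map_add, hα l' hl', hαp k' hk', add_zero]
    · rw [hu]
      exact t.redSharp_apply c hc ξ α hξ

end Algebra

/-! ## Quotients of orbits -/

section Orbits

variable {g : Type*} [LieRing g] [LieAlgebra ℝ g] {t : InvTensor g} {c : LieSubalgebra ℝ g}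
  {N O B : Mfd.{u}}

theorem exists_covector_comp_eq {j : O → N} {a : O} (hj : Injective (tmap j a)) (β : O.coT a) :
    ∃ l : N.coT (j a), l.comp (tmap j a) = β := by
  obtain ⟨l, hl⟩ := exists_dual_comp_eq (tmap j a : O.T a →ₗ[ℝ] N.T (j a)) (β : O.T a →ₗ[ℝ] ℝ)
    fun w hw => by
      have : w = 0 := hj (Eq.trans hw (map_zero (tmap j a)).symm)
      rw [this, map_zero]
  exact ⟨toCovector l, ContinuousLinearMap.ext hl⟩

theorem LieAct.IsOrbit.exists_tmap_eq {A : LieAct g N} {h : Submodule ℝ g} {j : O → N}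
    (hj : A.IsOrbit h j) {v : g} (hv : v ∈ h) (a : O) : ∃ ξ : O.T a, tmap j a ξ = A.rho v (j a) :=
  (hj.tangent a).symm.le ⟨v, hv, rfl⟩

/-- Covectors on `N` and `B` with the same pullback to `O` induce compatible forms on c and c/c^⊥;
this is the kind of extension used to compute the reduced tensor. -/
theorem EquivariantRed.coat_eq {A : LieAct g N} {j : O → N} {p : O → B} {A' : LieAct (t.RedAlg c) B}
    (h : EquivariantRed t c A j A' p) {a : O}
    (hρ : ∀ v ∈ c, ∃ ξ : O.T a, tmap j a ξ = A.rho v (j a)) {l : N.coT (j a)} {α : B.coT (p a)}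
    (hl : l.comp (tmap j a) = α.comp (tmap p a)) (u : c) :
    A.coat (j a) l (u : g) = A'.coat (p a) α (t.redMk c u) := by
  obtain ⟨ξ, hξ⟩ := hρ u u.2
  rw [LieAct.coat_apply, LieAct.coat_apply, ← hξ, ← h u a ξ hξ]
  exact congrArg (fun L : O.coT a => L ξ) hl

/-- The quotient by `c^⊥` of a `c`-orbit in a quasi-Poisson-commutative manifold with Lagrangian
stabilizers. -/
theorem LieAct.IsOrbit.exists_quotient {P : QPoisson t N} (hP : P.IsCommutative)
    (hlag : ∀ y, t.IsLagrangian (P.stabilizer y)) (hc : t.IsCoisotropic c.toSubmodule) {j : O → N}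
    (hj : P.IsOrbit c.toSubmodule j) {p : O → B} (hp : P.IsQuotient (t.perp c.toSubmodule) j p) :
    ∃ PB : QPoisson (t.reduced c hc) B, EquivariantRed t c P.toLieAct j PB.toLieAct p ∧
      PB.IsCommutative ∧ PB.IsTransitive ∧ ∀ y, (t.reduced c hc).IsLagrangian (PB.stabilizer y) := by
  have hs := hp.surjSubmersion
  have hρ : ∀ v ∈ c, ∀ a, ∃ ξ : O.T a, tmap j a ξ = P.rho v (j a) :=
    fun v hv a => hj.exists_tmap_eq hv a
  obtain ⟨A, hA⟩ := hp.exists_action t c hc hj.immersed hρ (fun a y hy => hj.mem_range hy)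
  -- The reduced pairing equals the pairing upstairs of extended covectors, which is zero because
  -- `N` is commutative. So the zero bivector works.
  obtain ⟨PB, hPB, hcomm⟩ := A.exists_commutative (t.reduced c hc) fun y α β => by
    obtain ⟨a, rfl⟩ := hs.surjective y
    obtain ⟨l, hl⟩ := exists_covector_comp_eq (hj.immersed.immersion a) (α.comp (tmap p a))
    obtain ⟨k, hk⟩ := exists_covector_comp_eq (hj.immersed.immersion a) (β.comp (tmap p a))
    rw [t.reduced_apply c hc (hA.coat_eq (fun v hv => hρ v hv a) hl)
      (hA.coat_eq (fun v hv => hρ v hv a) hk)]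
    exact hP.coat_sharp _ _ _
  subst hPB
  refine ⟨PB, hA, hcomm, ⟨fun y η => ?_, fun y y' => ?_⟩, fun y => ?_⟩
  · obtain ⟨a, rfl⟩ := hs.surjective y
    obtain ⟨ξ, rfl⟩ := hs.submersion a η
    obtain ⟨v, hv, h⟩ := (hj.tangent a).le ⟨ξ, rfl⟩
    exact ⟨t.redMk c ⟨v, hv⟩, (hA ⟨v, hv⟩ a ξ h.symm).symm⟩
  · obtain ⟨a, rfl⟩ := hs.surjective y
    obtain ⟨b, rfl⟩ := hs.surjective y'
    classical
    obtain ⟨A₁, hA₁⟩ := P.exists_restrict_subalgebra c hj.immersed hρ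
    have h1 : A₁.SameOrbit ⊤ a b := by
      refine LieAct.SameOrbit.lift (A := P.toLieAct) (h := c.toSubmodule) (h' := ⊤)
        hj.immersed
        (fun v => if hv : v ∈ c then ⟨v, hv⟩ else 0) (fun _ _ => Submodule.mem_top) (fun v hv x => ?_)
        (fun a y hy => hj.mem_range hy) (hj.sameOrbit a b)
      have hv' : v ∈ c := hv
      rw [dif_pos hv']; exact hA₁ ⟨v, hv'⟩ x
    exact LieAct.SameOrbit.map (h' := ⊤) hs.smooth (t.redMk c) (fun _ _ => Submodule.mem_top)
      (fun v _ x => hA v x _ (hA₁ v x)) h1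
  · obtain ⟨a, rfl⟩ := hs.surjective y
    -- The class of u fixes p(a) exactly when ρ(u) lies in ρ(c^⊥) at j(a), that is, when u lies in
    -- the old stabilizer plus c^⊥.
    refine (hlag (j a)).reduced hc fun u => ?_
    obtain ⟨ξ, hξ⟩ := hρ u u.2 a
    have h1 : t.redMk c u ∈ PB.stabilizer (p a) ↔ tmap p a ξ = 0 := by
      rw [hA u a ξ hξ]; rfl
    rw [h1, hp.tangent, hξ]
    constructor
    · rintro ⟨w, hw, h⟩
      refine Submodule.mem_sup.2 ⟨u - w, ?_, w, hw, sub_add_cancel _ _⟩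
      change P.at (j a) ((u : g) - w) = 0
      rw [map_sub, h]
      exact sub_self _
    · intro h
      obtain ⟨l, hl, w, hw, h⟩ := Submodule.mem_sup.1 h
      refine ⟨w, hw, ?_⟩
      have hl : P.at (j a) l = 0 := hl
      change P.at (j a) w = P.at (j a) u
      rw [← h, map_add, hl, zero_add]

end Orbits

/-! ## The reduced central pair -/

section Descent

variable {g : Type*} [LieRing g] [LieAlgebra ℝ g] {t : InvTensor g} {c : LieSubalgebra ℝ g}
  {M N O B Q S M' : Mfd.{u}}

theorem IsSurjSubmersion.exists_descend {r : S → M'} (hr : IsSurjSubmersion r) {f : S → B}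
    (hf : Smooth f) (h : ∀ a b, r a = r b → f a = f b) :
    ∃ ν : M' → B, Smooth ν ∧ ∀ s, ν (r s) = f s := by
  obtain ⟨s, hs⟩ := hr.surjective.hasRightInverse
  have h1 : ∀ a, f (s (r a)) = f a := fun a => h _ _ (hs (r a))
  refine ⟨f ∘ s, hr.smooth_of_comp ?_, h1⟩
  rwa [show (f ∘ s) ∘ r = f from funext h1]

/-- The chain rule for a commuting square, in model spaces because the two corner points are only
propositionally equal. -/
theorem dmap_comp_eq {F : M → N} {G : S → M} {F' : B → N} {G' : S → B} (hF : Smooth F)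
    (hG : Smooth G) (hF' : Smooth F') (hG' : Smooth G') (h : ∀ s, F (G s) = F' (G' s)) (s : S)
    (v : S.Model) : dmap F (G s) (dmap G s v) = dmap F' (G' s) (dmap G' s v) :=
  (tmap_comp_apply hF hG s v).symm.trans ((congrArg (fun H : S → N => dmap H s v)
    (funext h : F ∘ G = F' ∘ G')).trans (tmap_comp_apply hF' hG' s v))

/-- The pullback of a covector at a point `y = q x`. -/
def pullCovector (q : M → Q) (x : M) {y : Q} (α : Q.coT y) : M.coT x :=
  (α : Q.Model →L[ℝ] ℝ).comp (dmap q x)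

variable {hc : t.IsCoisotropic c.toSubmodule} {P : QPoisson t M} {PQ : QPoisson (t.reduced c hc) Q}
  {q : M → Q}

theorem coat_pullCovector (hA : EquivariantRed t c P.toLieAct id PQ.toLieAct q) {x : M} {y : Q}
    (hy : y = q x) (α : Q.coT y) (u : c) :
    P.coat x (pullCovector q x α) (u : g) = PQ.coat y α (t.redMk c u) := by
  subst hy
  exact congrArg α (hA u x _ (tmap_id _ _))

theorem pi_pullCovector (hpush : PushesForward q P.pi PQ.pi) {x : M} {y : Q}
    (hy : y = q x) (α β : Q.coT y) :
    P.pi x (pullCovector q x α) (pullCovector q x β) = PQ.pi y α β := by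
  subst hy
  exact hpush x α β

/-- Pullbacks from the quotient restrict on c to the descended forms, so both π and the t-part of
the reduced σ are computed on `M`. -/
theorem sigma_pullCovector (hA : EquivariantRed t c P.toLieAct id PQ.toLieAct q)
    (hpush : PushesForward q P.pi PQ.pi) {x : M} {y : Q} (hy : y = q x) (α β : Q.coT y) :
    P.sigma x (pullCovector q x α) (pullCovector q x β) = PQ.sigma y α β := by
  unfold QPoisson.sigma
  rw [pi_pullCovector hpush hy, t.reduced_apply c hc (coat_pullCovector hA hy α)
    (coat_pullCovector hA hy β)]

theorem LieAct.IsQuotient.coat_pullCovector (hq : P.IsQuotient (t.perp c.toSubmodule) id q) {x : M}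
    {y : Q} (α : Q.coT y) {w : g} (hw : w ∈ t.perp c.toSubmodule) :
    P.coat x (pullCovector q x α) w = 0 := by
  have h : dmap q x (P.rho w x) = 0 :=
    (hq.tangent x (P.rho w x)).2 ⟨w, hw, (tmap_id x _).symm⟩
  exact (congrArg (α : Q.Model →L[ℝ] ℝ) h).trans (map_zero (α : Q.Model →L[ℝ] ℝ))

/-- The kernel of the tangent map of q is ρ(c^⊥), so every covector killing c^⊥ descends. -/
theorem LieAct.IsQuotient.exists_pullCovector (hq : P.IsQuotient (t.perp c.toSubmodule) id q) {x : M}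
    {y : Q} {a : M.coT x} (ha : ∀ w ∈ t.perp c.toSubmodule, P.coat x a w = 0) :
    ∃ α : Q.coT y, pullCovector q x α = a := by
  obtain ⟨l, hl⟩ := exists_dual_comp_eq (dmap q x : M.Model →ₗ[ℝ] Q.Model) (a : M.T x →ₗ[ℝ] ℝ)
    fun ξ hξ => by
      obtain ⟨w, hw, h⟩ := (hq.tangent x ξ).1 hξ
      have h : P.rho w x = ξ := h.trans (tmap_id x ξ)
      rw [← h]
      exact ha w hw
  exact ⟨toCovector l, ContinuousLinearMap.ext hl⟩

theorem IsQPMap.coat_comp {P : QPoisson t M} {P' : QPoisson t N} {F : M → N} (hF : IsQPMap P P' F)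
    (x : M) (α : N.coT (F x)) : P.coat x (α.comp (tmap F x)) = P'.coat (F x) α :=
  hF.equivariant.coat_comp x α

theorem IsQPMap.sigma_comp {P : QPoisson t M} {P' : QPoisson t N} {F : M → N} (hF : IsQPMap P P' F)
    (x : M) (α β : N.coT (F x)) :
    P.sigma x (α.comp (tmap F x)) (β.comp (tmap F x)) = P'.sigma (F x) α β := by
  unfold QPoisson.sigma
  rw [hF.pushforward, hF.coat_comp, hF.coat_comp]

/-- The action on a quotient of a submanifold, in terms of the action on the ambient quotient. -/
theorem EquivariantRed.of_restrict {A : LieAct g M} {AQ : LieAct (t.RedAlg c) Q}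
    {A' : LieAct (t.RedAlg c) M'} {i : S → M} {r : S → M'} {ι : M' → Q}
    (hA : EquivariantRed t c A id AQ q) (hq : Smooth q) (hi : Smooth i) (hr : Smooth r)
    (hι : IsInjImmersion ι) (hιr : ∀ s, ι (r s) = q (i s)) (hA' : Equivariant A' AQ ι) :
    EquivariantRed t c A i A' r := by
  intro u s ξ hξ
  apply hι.immersion
  rw [hA']
  have h1 : dmap ι (r s) (dmap r s ξ) = dmap q (i s) (dmap i s ξ) :=
    dmap_comp_eq hι.smooth hr hq hi hιr s ξ
  have h2 : tmap q (i s) (tmap i s ξ) = AQ.rho (t.redMk c u) (q (i s)) :=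
    hA u (i s) _ ((tmap_id _ _).trans hξ)
  exact (h1.trans h2).trans (congrArg (fun y => (AQ.rho (t.redMk c u) y : Q.Model)) (hιr s)).symm

/-- The maps induced between quotients by equivariant maps are equivariant. -/
theorem EquivariantRed.equivariant {A : LieAct g M} {AN : LieAct g N} {A' : LieAct (t.RedAlg c) M'}
    {AB : LieAct (t.RedAlg c) B} {i : S → M} {r : S → M'} {j : O → N} {p : O → B} {iO : S → O}
    {μ : M → N} {ν : M' → B} (hA : EquivariantRed t c A i A' r) (hB : EquivariantRed t c AN j AB p)
    (hr : IsSurjSubmersion r) (hi : Smooth i) (hj : Smooth j) (hp : Smooth p) (hiO : Smooth iO)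
    (hμ : Smooth μ) (hν : Smooth ν) (hμe : Equivariant A AN μ) (heq : ∀ s, μ (i s) = j (iO s))
    (hνr : ∀ s, ν (r s) = p (iO s))
    (hρ : ∀ v ∈ c, ∀ s, ∃ ξ : S.T s, tmap i s ξ = A.rho v (i s)) : Equivariant A' AB ν := by
  intro v m
  obtain ⟨s, rfl⟩ := hr.surjective m
  obtain ⟨u, rfl⟩ := t.redMk_surjective c v
  obtain ⟨ξ, hξ⟩ := hρ u u.2 s
  rw [← hA u s ξ hξ]
  have h1 : dmap ν (r s) (dmap r s ξ) = dmap p (iO s) (dmap iO s ξ) :=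
    dmap_comp_eq hν hr.smooth hp hiO hνr s ξ
  have h2 : dmap μ (i s) (dmap i s ξ) = dmap j (iO s) (dmap iO s ξ) :=
    dmap_comp_eq hμ hi hj hiO heq s ξ
  have h3 : tmap μ (i s) (tmap i s ξ) = AN.rho u (μ (i s)) := by rw [hξ, hμe]
  have h4 : tmap j (iO s) (tmap iO s ξ) = AN.rho u (j (iO s)) :=
    h2.symm.trans (h3.trans (congrArg (fun y => (AN.rho u y : N.Model)) (heq s)))
  have h5 := hB u (iO s) _ h4
  exact (h1.trans h5).trans (congrArg (fun y => (AB.rho (t.redMk c u) y : B.Model)) (hνr s)).symm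

/-- The differential of f∘p on the orbit extends to the ambient `N`; pulled back through μ it
represents, on S, the differential of the reduced function. -/
theorem exists_covector_preimage {i : S → M} {r : S → M'} {j : O → N} {p : O → B} {iO : S → O}
    {μ : M → N} {ν : M' → B} (hi : Smooth i) (hr : Smooth r) (hj : IsInjImmersion j) (hp : Smooth p)
    (hiO : Smooth iO) (hμ : Smooth μ) (hν : Smooth ν) (heq : ∀ s, μ (i s) = j (iO s))
    (hνr : ∀ s, ν (r s) = p (iO s)) {f : B → ℝ} (hf : SmoothFun f) (s : S) :
    ∃ l : N.coT (μ (i s)), ∀ v : S.T s,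
      diff (f ∘ ν) (r s) (tmap r s v) = l (tmap μ (i s) (tmap i s v)) := by
  obtain ⟨l, hl⟩ := exists_covector_comp_eq (hj.immersion (iO s)) (diff (f ∘ p) (iO s))
  refine ⟨(l : N.Model →L[ℝ] ℝ), fun v => ?_⟩
  have h1 : (f ∘ ν) ∘ r = (f ∘ p) ∘ iO := funext fun s => congrArg f (hνr s)
  rw [← diff_comp_apply (hf.comp hν) hr, h1, diff_comp_apply (hf.comp hp) hiO, ← hl]
  exact congrArg (l : N.Model →L[ℝ] ℝ) (dmap_comp_eq hμ hi hj.smooth hiO heq s v).symm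

end Descent

/-! ### Tangency, centrality and non-degeneracy after reduction -/

section ReducedPair

variable {g : Type*} [LieRing g] [LieAlgebra ℝ g] {t : InvTensor g} {c : LieSubalgebra ℝ g}
  {hc : t.IsCoisotropic c.toSubmodule} {M NL NR OL OR Q BL BR S M' : Mfd.{u}}
  {P : QPoisson t M} {PL : QPoisson t NL} {PR : QPoisson t NR} {μL : M → NL} {μR : M → NR}
  {jL : OL → NL} {jR : OR → NR} {iM : S → M} {iL : S → OL} {iR : S → OR} {q : M → Q}
  {PQ : QPoisson (t.reduced c hc) Q} {r : S → M'} {ι : M' → Q}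
  {pL : OL → BL} {pR : OR → BR} {νL : M' → BL} {νR : M' → BR}
  {P' : QPoisson (t.reduced c hc) M'}

/-- The tangent spaces of `S` consist of the vectors sent to the tangent spaces of the orbits. -/
def HasPreimageTangent (PL : QPoisson t NL) (PR : QPoisson t NR) (c : Submodule ℝ g) (μL : M → NL)
    (μR : M → NR) (iM : S → M) : Prop :=
  ∀ s (ξ : M.T (iM s)), (∃ v, tmap iM s v = ξ) ↔
    tmap μL (iM s) ξ ∈ c.map (PL.at (μL (iM s))) ∧ tmap μR (iM s) ξ ∈ c.map (PR.at (μR (iM s)))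

/-- The tangent spaces of the orbits are the images of c under ρ, so the description of TS as a
fibre product loses its reference to `OL` and `OR`. -/
theorem IsPreimage.hasPreimageTangent {c : Submodule ℝ g}
    (hS : IsPreimage μL μR jL jR iM iL iR) (hL : PL.IsOrbit c jL) (hR : PR.IsOrbit c jR)
    (hμL : Smooth μL) (hμR : Smooth μR)
    (htan : ∀ s (ξ : M.Model) (η : OL.Model) (ζ : OR.Model),
      dmap μL (iM s) ξ = dmap jL (iL s) η → dmap μR (iM s) ξ = dmap jR (iR s) ζ →
        ∃ v : S.T s, tmap iM s v = ξ) :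
    HasPreimageTangent PL PR c μL μR iM := by
  intro s ξ
  constructor
  · rintro ⟨v, rfl⟩
    exact ⟨hL.dmap_mem (hS.eqL s) (hS.dmapL hμL hL.immersed.smooth s v).symm,
      hR.dmap_mem (hS.eqR s) (hS.dmapR hμR hR.immersed.smooth s v).symm⟩
  · rintro ⟨h1, h2⟩
    obtain ⟨η, hη⟩ := hL.exists_dmap_eq (hS.eqL s) h1
    obtain ⟨ζ, hζ⟩ := hR.exists_dmap_eq (hS.eqR s) h2
    exact htan s ξ η ζ hη.symm hζ.symm

theorem HasPreimageTangent.exists_tmap_eq {c : Submodule ℝ g}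
    (hT : HasPreimageTangent PL PR c μL μR iM) (eL : Equivariant P.toLieAct PL.toLieAct μL)
    (eR : Equivariant P.toLieAct PR.toLieAct μR) {v : g} (hv : v ∈ c) (s : S) :
    ∃ ξ : S.T s, tmap iM s ξ = P.rho v (iM s) :=
  (hT s _).2 ⟨⟨v, hv, (eL v _).symm⟩, ⟨v, hv, (eR v _).symm⟩⟩

/-- The bivector of `M / c^⊥` is tangent to the reduced submanifold. -/
theorem IsCentralPair.pi_reduced_eq_zero (h : IsCentralPair P PL PR μL μR)
    (hT : HasPreimageTangent PL PR c.toSubmodule μL μR iM)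
    (hq : P.IsQuotient (t.perp c.toSubmodule) id q) (hpush : PushesForward q P.pi PQ.pi)
    (hiM : Smooth iM) (hr : IsSurjSubmersion r) (hι : Smooth ι) (hιr : ∀ s, ι (r s) = q (iM s))
    (m : M') (α β : Q.coT (ι m)) (hα : α.comp (tmap ι m) = 0) : PQ.pi (ι m) α β = 0 := by
  obtain ⟨s, rfl⟩ := hr.surjective m
  rw [← pi_pullCovector hpush (hιr s)]
  refine h.pi_eq_zero (c := c.toSubmodule) (iM s) (fun w hw => hq.coat_pullCovector β hw)
    fun ξ h1 h2 => ?_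
  obtain ⟨v, rfl⟩ := (hT s ξ).2 ⟨h1, h2⟩
  have e1 : dmap ι (r s) (dmap r s v) = dmap q (iM s) (dmap iM s v) :=
    dmap_comp_eq hι hr.smooth hq.surjSubmersion.smooth hiM hιr s v
  have e2 : (α : Q.Model →L[ℝ] ℝ) (dmap ι (r s) (dmap r s v)) = 0 :=
    congrArg (fun L : M'.coT (r s) => L (tmap r s v)) hα
  exact (congrArg (α : Q.Model →L[ℝ] ℝ) e1).symm.trans e2

/-- A covector on `M / c^⊥` whose restriction to the reduced submanifold is pulled back from
the orbits. -/
theorem HasPreimageTangent.exists_eq_add (hT : HasPreimageTangent PL PR c.toSubmodule μL μR iM)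
    (hq : Smooth q) (hiM : Smooth iM) (hr : Smooth r) (hι : Smooth ι)
    (hιr : ∀ s, ι (r s) = q (iM s)) (s : S) (α : Q.coT (ι (r s)))
    {l₀ : NL.coT (μL (iM s))} {k₀ : NR.coT (μR (iM s))}
    (h : ∀ v : S.T s, α (tmap ι (r s) (tmap r s v)) =
      l₀ (tmap μL (iM s) (tmap iM s v)) + k₀ (tmap μR (iM s) (tmap iM s v))) :
    ∃ (l : NL.coT (μL (iM s))) (k : NR.coT (μR (iM s))),
      (∀ u ∈ c, PL.coat (μL (iM s)) l u = 0) ∧ (∀ u ∈ c, PR.coat (μR (iM s)) k u = 0) ∧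
      pullCovector q (iM s) α =
        (l₀ + l).comp (tmap μL (iM s)) + (k₀ + k).comp (tmap μR (iM s)) := by
  obtain ⟨l, k, hl, hk, hlk⟩ := IsCentralPair.exists_eq_add (PL := PL) (PR := PR)
    (c := c.toSubmodule) (iM s) (a := pullCovector q (iM s) α -
      (l₀.comp (tmap μL (iM s)) + k₀.comp (tmap μR (iM s)))) fun ξ h1 h2 => by
    obtain ⟨v, rfl⟩ := (hT s ξ).2 ⟨h1, h2⟩
    have e1 : dmap ι (r s) (dmap r s v) = dmap q (iM s) (dmap iM s v) :=
      dmap_comp_eq hι hr hq hiM hιr s v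
    exact sub_eq_zero.2 ((congrArg (α : Q.Model →L[ℝ] ℝ) e1).symm.trans (h v))
  refine ⟨l, k, hl, hk, ?_⟩
  rw [ContinuousLinearMap.add_comp, ContinuousLinearMap.add_comp, add_add_add_comm, ← hlk,
    add_sub_cancel]

/-- The reduced maps are central. -/
theorem IsCentralPair.leftCentral_reduced (h : IsCentralPair P PL PR μL μR)
    (hS : IsPreimage μL μR jL jR iM iL iR)
    (hT : HasPreimageTangent PL PR c.toSubmodule μL μR iM) (hjL : IsInjImmersion jL)
    (hq : P.IsQuotient (t.perp c.toSubmodule) id q)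
    (hA : EquivariantRed t c P.toLieAct id PQ.toLieAct q) (hpush : PushesForward q P.pi PQ.pi)
    (hr : IsSurjSubmersion r) (hι : IsInjImmersion ι) (hιr : ∀ s, ι (r s) = q (iM s))
    (hP' : IsQPMap P' PQ ι) (hpL : Smooth pL) (hνL : Smooth νL) (hνr : ∀ s, νL (r s) = pL (iL s))
    {f : BL → ℝ} (hf : SmoothFun f) : P'.LeftCentral (f ∘ νL) := by
  intro m β'
  obtain ⟨s, rfl⟩ := hr.surjective m
  obtain ⟨β, rfl⟩ := exists_covector_comp_eq (hι.immersion (r s)) β'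
  obtain ⟨α, hα⟩ := exists_covector_comp_eq (hι.immersion (r s)) (diff (f ∘ νL) (r s))
  obtain ⟨l₀, hl₀⟩ := exists_covector_preimage hS.immersed.smooth hr.smooth hjL hpL hS.smoothL
    h.smoothL hνL hS.eqL hνr hf s
  -- On S the differential comes from `NL` alone, so the right component of its extension kills c;
  -- the left component is arbitrary, which left centrality allows.
  obtain ⟨l, k, -, hk, hlk⟩ := hT.exists_eq_add hq.surjSubmersion.smooth hS.immersed.smooth
    hr.smooth hι.smooth hιr s α (l₀ := l₀) (k₀ := 0) fun v => by
      rw [← hl₀, ← hα]; exact (add_zero _).symm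
  rw [← hα, hP'.sigma_comp, ← sigma_pullCovector hA hpush (hιr s)]
  refine h.sigma_eq_zero_left (c := c.toSubmodule) (iM s)
    (fun w hw => hq.coat_pullCovector β hw) (k := 0 + k) ?_ hlk
  rw [zero_add]
  exact hk

theorem IsCentralPair.rightCentral_reduced (h : IsCentralPair P PL PR μL μR)
    (hS : IsPreimage μL μR jL jR iM iL iR)
    (hT : HasPreimageTangent PL PR c.toSubmodule μL μR iM) (hjR : IsInjImmersion jR)
    (hq : P.IsQuotient (t.perp c.toSubmodule) id q)
    (hA : EquivariantRed t c P.toLieAct id PQ.toLieAct q) (hpush : PushesForward q P.pi PQ.pi)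
    (hr : IsSurjSubmersion r) (hι : IsInjImmersion ι) (hιr : ∀ s, ι (r s) = q (iM s))
    (hP' : IsQPMap P' PQ ι) (hpR : Smooth pR) (hνR : Smooth νR) (hνr : ∀ s, νR (r s) = pR (iR s))
    {f : BR → ℝ} (hf : SmoothFun f) : P'.RightCentral (f ∘ νR) := by
  intro m β'
  obtain ⟨s, rfl⟩ := hr.surjective m
  obtain ⟨β, rfl⟩ := exists_covector_comp_eq (hι.immersion (r s)) β'
  obtain ⟨α, hα⟩ := exists_covector_comp_eq (hι.immersion (r s)) (diff (f ∘ νR) (r s))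
  obtain ⟨k₀, hk₀⟩ := exists_covector_preimage hS.immersed.smooth hr.smooth hjR hpR hS.smoothR
    h.smoothR hνR hS.eqR hνr hf s
  obtain ⟨l, k, hl, -, hlk⟩ := hT.exists_eq_add hq.surjSubmersion.smooth hS.immersed.smooth
    hr.smooth hι.smooth hιr s α (l₀ := 0) (k₀ := k₀) fun v => by
      rw [← hk₀, ← hα]; exact (zero_add _).symm
  rw [← hα, hP'.sigma_comp, ← sigma_pullCovector hA hpush (hιr s)]
  refine h.sigma_eq_zero_right (c := c.toSubmodule) (iM s)
    (fun w hw => hq.coat_pullCovector β hw) (l := 0 + l) ?_ hlk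
  rw [zero_add]
  exact hl

/-- `T^{big}` of a quasi-Poisson manifold is everything if no covector annihilates it. -/
theorem QPoisson.bigTangentEqTop_of_forall_eq_zero (P : QPoisson t M)
    (h : ∀ x (b : M.coT x), P.coat x b = 0 → (∀ a, P.pi x a b = 0) → b = 0) :
    P.BigTangentEqTop := by
  intro x ξ
  -- Vectors ρ(v) + π(α,·) viewed as functionals on covectors; these exhaust the bidual because no
  -- nonzero covector is killed by all of them.
  let Ψ : g × M.coT x →ₗ[ℝ] Module.Dual ℝ (M.coT x) :=
    { toFun := fun p =>
        { toFun := fun b => b (P.rho p.1 x) + P.pi x p.2 b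
          map_add' := fun b b' => by
            rw [map_add, add_add_add_comm]; rfl
          map_smul' := fun r b => by
            rw [map_smul, RingHom.id_apply, smul_add]; rfl }
      map_add' := fun p p' => by
        refine LinearMap.ext fun b => ?_
        change b (P.at x (p.1 + p'.1)) + P.pi x (p.2 + p'.2) b =
          (b (P.at x p.1) + P.pi x p.2 b) + (b (P.at x p'.1) + P.pi x p'.2 b)
        rw [map_add, map_add, map_add, LinearMap.add_apply]
        ring
      map_smul' := fun r p => by
        refine LinearMap.ext fun b => ?_
        change b (P.at x (r • p.1)) + P.pi x (r • p.2) b = r * (b (P.at x p.1) + P.pi x p.2 b)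
        rw [map_smul, map_smul, map_smul, LinearMap.smul_apply, smul_eq_mul, smul_eq_mul]
        ring }
  have : FiniteDimensional ℝ (M.coT x) :=
    inferInstanceAs (FiniteDimensional ℝ (M.Model →L[ℝ] ℝ))
  obtain ⟨⟨v, a⟩, hva⟩ := exists_of_forall_eq_zero Ψ (fun b hb => h x b
    (LinearMap.ext fun v => by
      have h1 : b (P.rho v x) + P.pi x 0 b = 0 := hb (v, 0)
      rwa [map_zero, LinearMap.zero_apply, add_zero] at h1)
    (fun a => by
      have h1 : b (P.at x 0) + P.pi x a b = 0 := hb (0, a)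
      rwa [map_zero, map_zero, zero_add] at h1))
    ({ toFun := fun b => b ξ, map_add' := fun _ _ => rfl, map_smul' := fun _ _ => rfl } :
      M.coT x →ₗ[ℝ] ℝ)
  exact ⟨v, a, hva⟩

/-- A covector on M' annihilating T^big M' extends to M/c^⊥. The pullback of this extension to M is
a sum of pullbacks of covectors killing the c-directions; such a sum vanishes on TS, and TS surjects
onto TM'. -/
theorem IsSplitSymplecticPair.bigTangent_reduced [FiniteDimensional ℝ g]
    (h : IsSplitSymplecticPair P PL PR μL μR)
    (hT : HasPreimageTangent PL PR c.toSubmodule μL μR iM)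
    (hq : P.IsQuotient (t.perp c.toSubmodule) id q)
    (hA : EquivariantRed t c P.toLieAct id PQ.toLieAct q) (hpush : PushesForward q P.pi PQ.pi)
    (hiM : Smooth iM) (hr : IsSurjSubmersion r) (hι : IsInjImmersion ι)
    (hιr : ∀ s, ι (r s) = q (iM s)) (hP' : IsQPMap P' PQ ι) : P'.BigTangentEqTop := by
  refine P'.bigTangentEqTop_of_forall_eq_zero fun m b' hb' hπ' => ?_
  obtain ⟨s, rfl⟩ := hr.surjective m
  obtain ⟨β, rfl⟩ := exists_covector_comp_eq (hι.immersion (r s)) b'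
  obtain ⟨l, k, hl, hk, hlk⟩ := h.exists_eq_add (c := c.toSubmodule) (iM s)
    (b := pullCovector q (iM s) β)
    (fun u hu => by
      rw [hP'.coat_comp] at hb'
      rw [coat_pullCovector hA (hιr s) β ⟨u, hu⟩, hb']; rfl)
    (fun a ha => by
      obtain ⟨α, rfl⟩ := hq.exists_pullCovector (y := ι (r s)) ha
      rw [pi_pullCovector hpush (hιr s), ← hP'.pushforward]
      exact hπ' _)
  refine ContinuousLinearMap.ext fun ξ => ?_
  obtain ⟨v, rfl⟩ := hr.submersion s ξ
  obtain ⟨⟨u, hu, h1⟩, ⟨w, hw, h2⟩⟩ := (hT s _).1 ⟨v, rfl⟩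
  have e1 : dmap ι (r s) (dmap r s v) = dmap q (iM s) (dmap iM s v) :=
    dmap_comp_eq hι.smooth hr.smooth hq.surjSubmersion.smooth hiM hιr s v
  have e2 : pullCovector q (iM s) β (tmap iM s v) = 0 := by
    rw [hlk]
    change l (tmap μL (iM s) (tmap iM s v)) + k (tmap μR (iM s) (tmap iM s v)) = 0
    rw [← h1, ← h2]
    exact (congrArg₂ (· + ·) (hl u hu) (hk w hw)).trans (add_zero 0)
  exact (congrArg (β : Q.Model →L[ℝ] ℝ) e1).trans e2

end ReducedPair

end QuasiPoisson

end

/-! ### The reduction theorem -/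

theorem mainTheorem4 {g : Type v} [LieRing g] [LieAlgebra ℝ g] [FiniteDimensional ℝ g]
    (t : InvTensor g)
    {M NL NR OL OR Q BL BR : Mfd.{u}}
    -- the split-symplectic central pair
    (P : QPoisson t M) (PL : QPoisson t NL) (PR : QPoisson t NR) (μL : M → NL) (μR : M → NR)
    (hpair : IsSplitSymplecticPair P PL PR μL μR)
    -- the coisotropic subalgebra and its orbits
    (c : LieSubalgebra ℝ g) (hc : t.IsCoisotropic c.toSubmodule)
    (jL : OL → NL) (hOL : PL.IsOrbit c.toSubmodule jL)
    (jR : OR → NR) (hOR : PR.IsOrbit c.toSubmodule jR)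
    (htrans : TransversePair μL μR jL jR)
    -- the quotients of `M`, `OL`, `OR` by `c^⊥` are manifolds `Q`, `BL`, `BR`
    (q : M → Q) (hq : P.IsQuotient (t.perp c.toSubmodule) id q)
    (pL : OL → BL) (hpL : PL.IsQuotient (t.perp c.toSubmodule) jL pL)
    (pR : OR → BR) (hpR : PR.IsQuotient (t.perp c.toSubmodule) jR pR) :
    -- the quasi-Poisson structure on `M/c^⊥`
    ∃ PQ : QPoisson (t.reduced c hc) Q,
      EquivariantRed t c P.toLieAct id PQ.toLieAct q ∧ PushesForward q P.pi PQ.pi ∧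
    -- the submanifold `S = μL⁻¹(OL) ∩ μR⁻¹(OR)` of `M`
    ∃ (S : Mfd.{u}) (iM : S → M) (iL : S → OL) (iR : S → OR),
      IsPreimage μL μR jL jR iM iL iR ∧
    -- its quotient `M' = S/c^⊥`, an immersed submanifold of `M/c^⊥`
    -- (embedded if `OL` and `OR` are)
    ∃ (M' : Mfd.{u}) (r : S → M') (ι : M' → Q) (νL : M' → BL) (νR : M' → BR),
      P.IsQuotient (t.perp c.toSubmodule) iM r ∧
      IsInjImmersion ι ∧
      (Topology.IsEmbedding jL → Topology.IsEmbedding jR → Topology.IsEmbedding ι) ∧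
      (∀ s, ι (r s) = q (iM s)) ∧ (∀ s, νL (r s) = pL (iL s)) ∧ (∀ s, νR (r s) = pR (iR s)) ∧
    -- the quasi-Poisson structures on `M'`, `OL/c^⊥` and `OR/c^⊥`
    ∃ (P' : QPoisson (t.reduced c hc) M') (PBL : QPoisson (t.reduced c hc) BL)
      (PBR : QPoisson (t.reduced c hc) BR),
      IsQPMap P' PQ ι ∧
      EquivariantRed t c PL.toLieAct jL PBL.toLieAct pL ∧
      EquivariantRed t c PR.toLieAct jR PBR.toLieAct pR ∧
      IsSplitSymplecticPair P' PBL PBR νL νR := by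
  obtain ⟨PQ, hA, hpush⟩ := P.exists_descend c hc hq
  refine ⟨PQ, hA, hpush, ?_⟩
  have hpc := hpair.toIsCentralPair
  obtain ⟨S, iM, iL, iR, hS, hiM, htan⟩ := exists_isPreimage hpair.smoothL hpair.smoothR
    hOL.immersed hOR.immersed htrans
  have hT := hS.hasPreimageTangent hOL hOR hpair.smoothL hpair.smoothR htan
  have hρ : ∀ v ∈ c, ∀ s, ∃ ξ : S.T s, tmap iM s ξ = P.rho v (iM s) := fun v hv s =>
    hT.exists_tmap_eq hpair.equivariantL hpair.equivariantR hv s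
  refine ⟨S, iM, iL, iR, hS, ?_⟩
  obtain ⟨M', r, ι, hr, hι, hιr, hemb⟩ := hq.exists_submanifold t c hc hS.immersed hρ
    fun s y hy => hS.mem_range_of_sameOrbit hOL hOR hpair.smoothL hpair.smoothR
      hpair.equivariantL hpair.equivariantR hy
  have hrs := hr.surjSubmersion
  -- Equivariance sends c^⊥-orbits in S to c^⊥-orbits in `OL`, so the composite to `BL` is constant
  -- on the fibres of `r`.
  obtain ⟨νL, hνL, hνLr⟩ := hrs.exists_descend
    (hpL.surjSubmersion.smooth.comp hS.smoothL) fun a b hab => (hpL.fibres _ _).2 (by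
      rw [← hS.eqL, ← hS.eqL]
      exact LieAct.SameOrbit.map hpair.smoothL id (fun _ h => h)
        (fun v _ x => hpair.equivariantL v x) ((hr.fibres a b).1 hab))
  obtain ⟨νR, hνR, hνRr⟩ := hrs.exists_descend
    (hpR.surjSubmersion.smooth.comp hS.smoothR) fun a b hab => (hpR.fibres _ _).2 (by
      rw [← hS.eqR, ← hS.eqR]
      exact LieAct.SameOrbit.map hpair.smoothR id (fun _ h => h)
        (fun v _ x => hpair.equivariantR v x) ((hr.fibres a b).1 hab))
  refine ⟨M', r, ι, νL, νR, hr, hι, fun h1 h2 => hemb (hS.isEmbedding hpair.smoothL.continuous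
    hpair.smoothR.continuous h1 h2), hιr, hνLr, hνRr, ?_⟩
  -- The fields of the action are tangent to M' because they lift to S; the bivector is tangent by
  -- the conormal computation.
  obtain ⟨P', hP'⟩ := PQ.exists_restrict hι
    (fun v m => by
      obtain ⟨s, rfl⟩ := hrs.surjective m
      obtain ⟨u, rfl⟩ := t.redMk_surjective c v
      obtain ⟨ξ, hξ⟩ := hρ u u.2 s
      refine ⟨tmap r s ξ, ?_⟩
      have h1 : dmap ι (r s) (dmap r s ξ) = dmap q (iM s) (dmap iM s ξ) :=
        dmap_comp_eq hι.smooth hrs.smooth hq.surjSubmersion.smooth hiM hιr s ξ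
      have h2 : tmap q (iM s) (tmap iM s ξ) = PQ.rho (t.redMk c u) (q (iM s)) :=
        hA u (iM s) _ ((tmap_id _ _).trans hξ)
      exact (h1.trans h2).trans
        (congrArg (fun y => (PQ.rho (t.redMk c u) y : Q.Model)) (hιr s)).symm)
    (fun m α β hα => hpc.pi_reduced_eq_zero hT hq hpush hiM hrs hι.smooth hιr m α β hα)
  obtain ⟨PBL, hBL, hcL, htL, hlL⟩ := hOL.exists_quotient hpair.commL hpair.lagrangianL hc hpL
  obtain ⟨PBR, hBR, hcR, htR, hlR⟩ := hOR.exists_quotient hpair.commR hpair.lagrangianR hc hpR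
  have hA' : EquivariantRed t c P.toLieAct iM P'.toLieAct r :=
    hA.of_restrict hq.surjSubmersion.smooth hiM hrs.smooth hι hιr hP'.equivariant
  exact ⟨P', PBL, PBR, hP', hBL, hBR,
    { commL := hcL
      commR := hcR
      smoothL := hνL
      smoothR := hνR
      equivariantL := hA'.equivariant hBL hrs hiM hOL.immersed.smooth hpL.surjSubmersion.smooth
        hS.smoothL hpair.smoothL hνL hpair.equivariantL hS.eqL hνLr hρ
      equivariantR := hA'.equivariant hBR hrs hiM hOR.immersed.smooth hpR.surjSubmersion.smooth
        hS.smoothR hpair.smoothR hνR hpair.equivariantR hS.eqR hνRr hρ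
      centralL := fun f hf => hpc.leftCentral_reduced hS hT hOL.immersed hq hA hpush hrs hι hιr hP'
        hpL.surjSubmersion.smooth hνL hνLr hf
      centralR := fun f hf => hpc.rightCentral_reduced hS hT hOR.immersed hq hA hpush hrs hι hιr hP'
        hpR.surjSubmersion.smooth hνR hνRr hf
      nondegenerate := hpair.nondegenerate.reduced hc
      big := hpair.bigTangent_reduced hT hq hA hpush hiM hrs hι hιr hP'
      transitiveL := htL
      transitiveR := htR
      lagrangianL := hlL
      lagrangianR := hlR }⟩
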